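/- Conventions: manifolds are smooth, Hausdorff, finite-dimensional and without boundary; maps, functions, forms and vector fields are smooth; the Hamiltonian vector field $X_H$ of $H$ on a symplectic manifold $(M,\omega)$ is given by $i_{X_H}\omega=-dH$; a set is invariant under a vector field if every integral curve (on an open interval) that meets the set stays in it; $M/Y$ denotes the space of orbits of a vector field $Y$. Let $(M,\omega)$ be a symplectic manifold and let $\mathbf D$ be a complete vector field without zeros on $M$ with $L_{\mathbf D}\omega=\omega$. Let $H_1,\dots,H_k:M\to\mathbb R$ be functions and $\Lambda_1,\dots,\Lambda_k\in\mathbb R$ with $L_{\mathbf D}H_j=\Lambda_jH_j$, and put $H_a=a_1H_1+\dots+a_kH_k$ for $a\in\mathbb R^k$. On $\hat M=M\times\mathbb R^k\times\mathbb R^k\ni(m,a,b)$ put $$\hat\omega=\omega+\sum_i da_i\wedge db^i,\qquad \hat H(m,a,b)=H_a(m),\qquad \hat{\mathbf D}=\mathbf D+\sum_i(1-\Lambda_i)a_i\partial_{a_i}+\sum_i\Lambda_ib^i\partial_{b^i},$$ let $\pi_o:\hat M\to M\times\mathbb R^k$, $(m,a,b)\mapsto(m,a)$, and put on $M\times\mathbb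 R^k$ $$\bar{\mathbf D}=\mathbf D+\sum_i(1-\Lambda_i)a_i\partial_{a_i},\qquad X(m,a)=X_{H_a}(m).$$ Assume that the orbit spaces $\hat C=\hat M/\hat{\mathbf D}$ and $\bar M=(M\times\mathbb R^k)/\bar{\mathbf D}$ are manifolds, of dimensions $\dim\hat M-1$ and $\dim M+k-1$, such that the projections $\hat\pi:\hat M\to\hat C$ and $\bar\pi:M\times\mathbb R^k\to\bar M$ are submersions. Then $\pi_{o*}X_{\hat H}=X$; there are a unique vector field $\hat X=\hat\pi_*X_{\hat H}$ on $\hat C$, a unique vector field $\bar X=\bar\pi_*X$ on $\bar M$ and a unique map $\bar\pi_o:\hat C\to\bar M$ with $\bar\pi_o\circ\hat\pi=\bar\pi\circ\pi_o$, and all three are smooth. The field $\hat X$ is a contact Hamiltonian vector field: for every nowhere vanishing function $\rho$ on $\hat M$ with $L_{\hat{\mathbf D}}\rho=\rho$ there are a contact form $\eta$ and a function $\mathscr H$ on $\hat C$ with $\hat\pi^*\eta=\rho^{-1}\,i_{\hat{\mathbf D}}\hat\omega$ and $\hat\pi^*\mathscr H=-\hat H/\rho$, and $$i_{\hat X}\,d\eta=d\mathscr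 H-\mathscr R(\mathscr H)\,\eta,\qquad i_{\hat X}\eta=-\mathscr H,$$ where $\mathscr R$ is the Reeb vector field of $\eta$ (defined by $i_{\mathscr R}d\eta=0$, $i_{\mathscr R}\eta=1$). Moreover, for each fixed $a_o\in\mathbb R^k$ the set $\hat C_{a_o}=\hat\pi(M\times\{a_o\}\times\mathbb R^k)\subset\hat C$ is $\hat X$-invariant, its image $\bar M_{a_o}=\bar\pi_o(\hat C_{a_o})\subset\bar M$ is $\bar X$-invariant, and $\bar X|_{\bar M_{a_o}}=\bar\pi_{o*}\hat X$, that is, $d\bar\pi_o(\hat X(c))=\bar X(\bar\pi_o(c))$ for all $c\in\hat C_{a_o}$. -/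

import Mathlib

open scoped Manifold ContDiff

namespace ScalingReduction

noncomputable section

section Forms

variable {E : Type*} [NormedAddCommGroup E] [NormedSpace ℝ E]
  {H : Type*} [TopologicalSpace H] (I : ModelWithCorners ℝ E H)
  {E' : Type*} [NormedAddCommGroup E'] [NormedSpace ℝ E']
  {H' : Type*} [TopologicalSpace H'] (I' : ModelWithCorners ℝ E' H')
  (M : Type*) [TopologicalSpace M] [ChartedSpace H M]
  {N : Type*} [TopologicalSpace N] [ChartedSpace H' N]
  {n : ℕ}

/-- Real differential `n`-forms (not necessarily smooth) on the manifold `M`. -/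
abbrev DForm (n : ℕ) := (x : M) → TangentSpace I x [⋀^Fin n]→L[ℝ] ℝ

/-- Vector fields (not necessarily smooth) on the manifold `M`. -/
abbrev VField := (x : M) → TangentSpace I x

variable {M}

/-- The coordinate expression of a form in the preferred chart at `x₀`: the pull back of the form
under the inverse of that chart. -/
def formInChart (Ω : DForm I M n) (x₀ : M) (y : E) : E [⋀^Fin n]→L[ℝ] ℝ :=
  (Ω ((extChartAt I x₀).symm y)).compContinuousLinearMap
    (mfderiv 𝓘(ℝ, E) I (extChartAt I x₀).symm y)

/-- A form is smooth if all its coordinate expressions are. -/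
def IsSmoothForm (Ω : DForm I M n) : Prop :=
  ∀ x₀ : M, ContDiffOn ℝ ∞ (formInChart I Ω x₀) (extChartAt I x₀).target

/-- The exterior derivative, computed at `x` in the preferred chart at `x`. -/
def extD (Ω : DForm I M n) : DForm I M (n + 1) := fun x =>
  (extDeriv (formInChart I Ω x) (extChartAt I x x)).compContinuousLinearMap
    (mfderiv I 𝓘(ℝ, E) (extChartAt I x) x)

/-- The interior product `i_X Ω`. -/
def interiorProd (X : VField I M) (Ω : DForm I M (n + 1)) : DForm I M n := fun x =>
  ContinuousAlternatingMap.curryLeft (𝕜 := ℝ) (E := E) (F := ℝ) (n := n) (Ω x) (X x)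

/-- The Lie derivative of a form of positive degree, `L_X Ω = d (i_X Ω) + i_X (dΩ)`. -/
def lieD (X : VField I M) (Ω : DForm I M (n + 1)) : DForm I M (n + 1) := fun x =>
  extD I (interiorProd I X Ω) x + interiorProd I X (extD I Ω) x

/-- The pull back of a form under a map. -/
def pullbackForm (f : M → N) (η : DForm I' N n) : DForm I M n := fun x =>
  (η (f x)).compContinuousLinearMap (mfderiv I I' f x)

/-- The differential of a real function, as a covector at each point. In particular `X f` is
`differential I f x (X x)`. -/
def differential (f : M → ℝ) (x : M) : TangentSpace I x →L[ℝ] ℝ :=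
  mfderiv I 𝓘(ℝ, ℝ) f x

/-- Smooth vector fields. -/
def IsSmoothField [IsManifold I 1 M] (X : VField I M) : Prop :=
  ContMDiff I I.tangent ∞ (fun x => (⟨x, X x⟩ : TangentBundle I M))

/-- `f_* X = Y`: the field `X` projects to the field `Y` under `f`. -/
def IsPushforward (f : M → N) (X : VField I M) (Y : VField I' N) : Prop :=
  ∀ x : M, mfderiv I I' f x (X x) = Y (f x)

/-- A complete vector field: every point is the start of an integral curve defined for all time. -/
def IsCompleteField (X : VField I M) : Prop :=
  ∀ x : M, ∃ γ : ℝ → M, γ 0 = x ∧ IsMIntegralCurve γ X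

/-- A set is invariant under `X` (under its local flow) if every integral curve of `X`, on any open
interval, that meets the set stays in it. -/
def IsInvariantSet (X : VField I M) (S : Set M) : Prop :=
  ∀ (γ : ℝ → M) (J : Set ℝ), IsOpen J → J.OrdConnected → IsMIntegralCurveOn γ X J →
    ∀ s ∈ J, γ s ∈ S → ∀ t ∈ J, γ t ∈ S

/-- Two points lie on a common integral curve of `X`. -/
def OnCommonCurve (X : VField I M) (x y : M) : Prop :=
  ∃ (γ : ℝ → M) (J : Set ℝ), IsOpen J ∧ J.OrdConnected ∧ IsMIntegralCurveOn γ X J ∧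
    (∃ s ∈ J, γ s = x) ∧ ∃ t ∈ J, γ t = y

/-- The orbit relation of `X` (for a smooth field on a Hausdorff manifold, lying on a common
integral curve already is an equivalence relation). -/
def orbitSetoid (X : VField I M) : Setoid M := Relation.EqvGen.setoid (OnCommonCurve I X)

/-- The space of orbits `M / X`, with the quotient topology. -/
def OrbitSpace (X : VField I M) : Type _ := Quotient (orbitSetoid I X)

instance (X : VField I M) : TopologicalSpace (OrbitSpace I X) :=
  inferInstanceAs (TopologicalSpace (Quotient (orbitSetoid I X)))

/-- The projection `M → M / X`. -/
def orbitProj (X : VField I M) : M → OrbitSpace I X := Quotient.mk (orbitSetoid I X)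

/-- A symplectic form: a smooth, closed, nondegenerate `2`-form. -/
structure IsSymplectic (Ω : DForm I M 2) : Prop where
  smooth : IsSmoothForm I Ω
  closed : ∀ x, extD I Ω x = 0
  nondegenerate : ∀ (x : M) (v : TangentSpace I x), (∀ w, Ω x ![v, w] = 0) → v = 0

/-- The Hamiltonian vector field `X_h` of `h`, the solution of `i_{X_h} Ω = - dh`. -/
def hamiltonianField (Ω : DForm I M 2) (h : M → ℝ) : VField I M := fun x =>
  Classical.epsilon fun v : TangentSpace I x => ∀ w, Ω x ![v, w] = - differential I h x w

/-- A contact form `η`: a smooth `1`-form with no zeros such that `dη` is nondegenerate on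
`ker η`. -/
structure IsContactForm (η : DForm I M 1) : Prop where
  smooth : IsSmoothForm I η
  ne_zero : ∀ x : M, η x ≠ 0
  nondegenerate : ∀ (x : M) (v : TangentSpace I x), η x ![v] = 0 →
    (∀ w, η x ![w] = 0 → extD I η x ![v, w] = 0) → v = 0

/-- The Reeb vector field of `η`: `i_R dη = 0` and `i_R η = 1`. -/
structure IsReebField (η : DForm I M 1) (R : VField I M) : Prop where
  interior_extD : ∀ (x : M) (w : TangentSpace I x), extD I η x ![R x, w] = 0
  interior : ∀ x : M, η x ![R x] = 1

/-- `X` is the contact Hamiltonian vector field of `h` with respect to the contact form `η`: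
`i_X dη = dh - R(h) η` and `i_X η = - h`, where `R` is the Reeb vector field. -/
def IsContactHamiltonianField (η : DForm I M 1) (h : M → ℝ) (X : VField I M) : Prop :=
  ∃ R : VField I M, IsReebField I η R ∧
    (∀ (x : M) (w : TangentSpace I x), extD I η x ![X x, w] =
      differential I h x w - differential I h x (R x) * η x ![w]) ∧
    ∀ x : M, η x ![X x] = - h x

/-- A nowhere vanishing (smooth) scaling function `ρ` for the vector field `D`: `L_D ρ = ρ`. -/
structure IsScalingFunction (D : VField I M) (ρ : M → ℝ) : Prop where
  smooth : ContMDiff I 𝓘(ℝ, ℝ) ∞ ρ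
  ne_zero : ∀ x, ρ x ≠ 0
  homogeneous : ∀ x, differential I ρ x (D x) = ρ x

/-- The wedge product `α ∧ β` of two covectors at a point:
`(α ∧ β)(u, v) = α(u) β(v) - α(v) β(u)`. -/
def wedgeCovectors {x : M} (α β : TangentSpace I x →L[ℝ] ℝ) : TangentSpace I x [⋀^Fin 2]→L[ℝ] ℝ :=
  ContinuousAlternatingMap.alternatizeUncurryFin (𝕜 := ℝ) (E := E) (F := ℝ) (n := 1)
    (ContinuousLinearMap.smulRight (M₁ := E) α
      (ContinuousAlternatingMap.ofSubsingleton ℝ E ℝ (0 : Fin 1) β))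

end Forms

section Facts

variable {E : Type*} [NormedAddCommGroup E] [NormedSpace ℝ E]
  {H : Type*} [TopologicalSpace H] (I : ModelWithCorners ℝ E H)
  {M : Type*} [TopologicalSpace M] [ChartedSpace H M]

theorem wedgeCovectors_apply {x : M} (α β : TangentSpace I x →L[ℝ] ℝ) (u v : TangentSpace I x) :
    wedgeCovectors I α β ![u, v] = α u * β v - α v * β u := by
  change ContinuousAlternatingMap.alternatizeUncurryFin (𝕜 := ℝ) (E := E) (F := ℝ) (n := 1)
    (ContinuousLinearMap.smulRight (M₁ := E) α
      (ContinuousAlternatingMap.ofSubsingleton ℝ E ℝ (0 : Fin 1) β)) ![u, v] = _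
  rw [ContinuousAlternatingMap.alternatizeUncurryFin_apply]
  simp [Fin.sum_univ_two]
  rfl

theorem hamiltonianField_spec [FiniteDimensional ℝ E] {Ω : DForm I M 2} (h : M → ℝ) (x : M)
    (hΩ : ∀ v : TangentSpace I x, (∀ w, Ω x ![v, w] = 0) → v = 0) (w : TangentSpace I x) :
    Ω x ![hamiltonianField I Ω h x, w] = - differential I h x w := by
  let B : E →ₗ[ℝ] Module.Dual ℝ E := LinearMap.mk₂ ℝ (fun v w : E => Ω x ![v, w])
    (fun u v w => (Ω x).map_vecCons_add ![w] u v)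
    (fun c u w => (Ω x).map_vecCons_smul ![w] c u)
    (fun u v w => by
      have hu : ∀ y : E, Function.update (![u, v] : Fin 2 → E) 1 y = ![u, y] := fun y => by
        funext i; fin_cases i <;> rfl
      have := (Ω x).map_update_add ![u, v] 1 v w
      erw [hu, hu, hu] at this
      exact this)
    (fun c u v => by
      have hu : ∀ y : E, Function.update (![u, v] : Fin 2 → E) 1 y = ![u, y] := fun y => by
        funext i; fin_cases i <;> rfl
      have := (Ω x).map_update_smul ![u, v] 1 c v
      erw [hu, hu] at this
      exact this)
  have hinj : Function.Injective B := by
    rw [injective_iff_map_eq_zero]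
    intro v hv
    exact hΩ v fun w => LinearMap.congr_fun hv w
  have hsurj : Function.Surjective B :=
    (LinearMap.injective_iff_surjective_of_finrank_eq_finrank
      (Subspace.dual_finrank_eq (K := ℝ) (V := E)).symm).1 hinj
  obtain ⟨v, hv⟩ := hsurj (-(differential I h x : E →L[ℝ] ℝ).toLinearMap)
  exact Classical.epsilon_spec (p := fun v : TangentSpace I x =>
    ∀ w, Ω x ![v, w] = - differential I h x w) ⟨v, fun w => LinearMap.congr_fun hv w⟩ w

end Facts

section Lift

variable {E : Type*} [NormedAddCommGroup E] [NormedSpace ℝ E]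
  {H : Type*} [TopologicalSpace H] (I : ModelWithCorners ℝ E H)
  {M : Type*} [TopologicalSpace M] [ChartedSpace H M] {k : ℕ}

/-- The model of `M × ℝ^k`. -/
abbrev paramModel (k : ℕ) := I.prod 𝓘(ℝ, Fin k → ℝ)

/-- The model of `M × ℝ^k × ℝ^k`. -/
abbrev liftedModel (k : ℕ) := I.prod (𝓘(ℝ, Fin k → ℝ).prod 𝓘(ℝ, Fin k → ℝ))

/-- The parameter space `M × ℝ^k`, with points `(m, a)`. -/
abbrev ParamSpace (M : Type*) (k : ℕ) := M × (Fin k → ℝ)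

/-- The lifted phase space `M × ℝ^k × ℝ^k`, with points `(m, a, b)`. -/
abbrev LiftedSpace (M : Type*) (k : ℕ) := M × (Fin k → ℝ) × (Fin k → ℝ)

/-- The Hamiltonian `H_a = ∑ a_i H_i` on `M`. -/
def coupledHamiltonian (h : Fin k → M → ℝ) (a : Fin k → ℝ) (m : M) : ℝ := ∑ i, a i * h i m

/-- The lifted Hamiltonian `(m, a, b) ↦ H_a m`. -/
def liftedHamiltonian (h : Fin k → M → ℝ) (x : LiftedSpace M k) : ℝ :=
  coupledHamiltonian h x.2.1 x.1

/-- The lifted form `Ω + ∑ da_i ∧ db_i`. -/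
def liftedForm (k : ℕ) (Ω : DForm I M 2) : DForm (liftedModel I k) (LiftedSpace M k) 2 := fun x =>
  pullbackForm (liftedModel I k) I Prod.fst Ω x +
    ∑ i, wedgeCovectors (liftedModel I k)
      (differential (liftedModel I k) (fun y : LiftedSpace M k => y.2.1 i) x)
      (differential (liftedModel I k) (fun y : LiftedSpace M k => y.2.2 i) x)

/-- The vector field `D + ∑ (1 - Λ_i) a_i ∂_{a_i} + ∑ Λ_i b_i ∂_{b_i}` on `M × ℝ^k × ℝ^k`. -/
def liftedScaling (D : VField I M) (Λ : Fin k → ℝ) : VField (liftedModel I k) (LiftedSpace M k) :=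
  fun x => (D x.1, (fun i => (1 - Λ i) * x.2.1 i), (fun i => Λ i * x.2.2 i))

/-- The vector field `D + ∑ (1 - Λ_i) a_i ∂_{a_i}` on `M × ℝ^k`. -/
def paramScaling (D : VField I M) (Λ : Fin k → ℝ) : VField (paramModel I k) (ParamSpace M k) :=
  fun x => (D x.1, (fun i => (1 - Λ i) * x.2 i))

/-- The vector field `X(m, a) = X_{H_a}(m)` on `M × ℝ^k`. -/
def paramField (Ω : DForm I M 2) (h : Fin k → M → ℝ) : VField (paramModel I k) (ParamSpace M k) :=
  fun x => (hamiltonianField I Ω (coupledHamiltonian h x.2) x.1, (0 : Fin k → ℝ))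

/-- The projection `(m, a, b) ↦ (m, a)`. -/
def forgetMomenta (M : Type*) (k : ℕ) (x : LiftedSpace M k) : ParamSpace M k := (x.1, x.2.1)

/-- The Hamiltonian vector field of the lifted Hamiltonian with respect to the lifted form. -/
abbrev liftedHamiltonianField (Ω : DForm I M 2) (h : Fin k → M → ℝ) :
    VField (liftedModel I k) (LiftedSpace M k) :=
  hamiltonianField (liftedModel I k) (liftedForm I k Ω) (liftedHamiltonian h)

/-- The orbit space of the lifted scaling field on `M × ℝ^k × ℝ^k`. -/
abbrev LiftedQuotient (D : VField I M) (Λ : Fin k → ℝ) :=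
  OrbitSpace (liftedModel I k) (liftedScaling I D Λ)

/-- The orbit space of the scaling field on the parameter space `M × ℝ^k`. -/
abbrev ParamQuotient (D : VField I M) (Λ : Fin k → ℝ) :=
  OrbitSpace (paramModel I k) (paramScaling I D Λ)

/-- The projection of `M × ℝ^k × ℝ^k` onto its orbit space. -/
abbrev liftedProj (D : VField I M) (Λ : Fin k → ℝ) : LiftedSpace M k → LiftedQuotient I D Λ :=
  orbitProj (liftedModel I k) (liftedScaling I D Λ)

/-- The projection of `M × ℝ^k` onto its orbit space. -/
abbrev paramProj (D : VField I M) (Λ : Fin k → ℝ) : ParamSpace M k → ParamQuotient I D Λ :=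
  orbitProj (paramModel I k) (paramScaling I D Λ)

/-- The image in the lifted orbit space of `M × {a₀} × ℝ^k`. -/
def fixedParamSet (D : VField I M) (Λ : Fin k → ℝ) (a₀ : Fin k → ℝ) :
    Set (LiftedQuotient I D Λ) :=
  liftedProj I D Λ '' {x | x.2.1 = a₀}

end Lift

end

end ScalingReduction

open ScalingReduction

open scoped Manifold ContDiff Topology

namespace ScalingReduction

noncomputable section

set_option linter.unusedSectionVars false

section Flat

variable {E : Type*} [NormedAddCommGroup E] [NormedSpace ℝ E]
  {F : Type*} [NormedAddCommGroup F] [NormedSpace ℝ F]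

/-- The identification of `1`-forms at a point with covectors. -/
def covectorCLM (E : Type*) [NormedAddCommGroup E] [NormedSpace ℝ E] :
    (E [⋀^Fin 1]→L[ℝ] ℝ) →L[ℝ] E →L[ℝ] ℝ :=
  ((ContinuousAlternatingMap.ofSubsingletonLIE (𝕜 := ℝ) (E := E) (F := ℝ)
    (0 : Fin 1)).symm.toContinuousLinearEquiv : (E [⋀^Fin 1]→L[ℝ] ℝ) →L[ℝ] E →L[ℝ] ℝ)

theorem covectorCLM_apply (α : E [⋀^Fin 1]→L[ℝ] ℝ) (v : E) : covectorCLM E α v = α ![v] := by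
  change α (fun _ => v) = α ![v]
  congr 1
  ext i
  fin_cases i
  rfl

/-- The identification of `2`-forms at a point with bilinear maps. -/
def bilinearCLM (E : Type*) [NormedAddCommGroup E] [NormedSpace ℝ E] :
    (E [⋀^Fin 2]→L[ℝ] ℝ) →L[ℝ] E →L[ℝ] E →L[ℝ] ℝ :=
  (ContinuousLinearMap.compL ℝ E (E [⋀^Fin 1]→L[ℝ] ℝ) (E →L[ℝ] ℝ) (covectorCLM E)).comp
    (ContinuousAlternatingMap.curryLeftLI (𝕜 := ℝ) (E := E) (F := ℝ) (n := 1)).toContinuousLinearMap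

theorem bilinearCLM_apply (Ω : E [⋀^Fin 2]→L[ℝ] ℝ) (u v : E) :
    bilinearCLM E Ω u v = Ω ![u, v] :=
  covectorCLM_apply (Ω.curryLeft u) v

theorem twoForm_swap (Ω : E [⋀^Fin 2]→L[ℝ] ℝ) (u v : E) : Ω ![u, v] = - Ω ![v, u] := by
  have := Ω.map_swap ![v, u] (show (0 : Fin 2) ≠ 1 by decide)
  have h : ![v, u] ∘ Equiv.swap (0 : Fin 2) 1 = ![u, v] := by ext i; fin_cases i <;> rfl
  rw [h] at this
  exact this

theorem extDeriv_oneForm {α : E → E [⋀^Fin 1]→L[ℝ] ℝ} {x : E} (hα : DifferentiableAt ℝ α x)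
    (u v : E) : extDeriv α x ![u, v] =
      fderiv ℝ (fun y => α y ![v]) x u - fderiv ℝ (fun y => α y ![u]) x v := by
  rw [extDeriv_apply hα, Fin.sum_univ_two]
  have h0 : (0 : Fin 2).removeNth ![u, v] = ![v] := by ext i; fin_cases i; rfl
  have h1 : (1 : Fin 2).removeNth ![u, v] = ![u] := by ext i; fin_cases i; rfl
  rw [h0, h1]
  simp [sub_eq_add_neg]

theorem extDeriv_twoForm {Ω : E → E [⋀^Fin 2]→L[ℝ] ℝ} {x : E} (hΩ : DifferentiableAt ℝ Ω x)
    (u v w : E) : extDeriv Ω x ![u, v, w] =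
      fderiv ℝ (fun y => Ω y ![v, w]) x u - fderiv ℝ (fun y => Ω y ![u, w]) x v +
        fderiv ℝ (fun y => Ω y ![u, v]) x w := by
  rw [extDeriv_apply hΩ, Fin.sum_univ_three]
  have h0 : (0 : Fin 3).removeNth ![u, v, w] = ![v, w] := by ext i; fin_cases i <;> rfl
  have h1 : (1 : Fin 3).removeNth ![u, v, w] = ![u, w] := by ext i; fin_cases i <;> rfl
  have h2 : (2 : Fin 3).removeNth ![u, v, w] = ![u, v] := by ext i; fin_cases i <;> rfl
  rw [h0, h1, h2]
  simp [sub_eq_add_neg]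

theorem fderiv_oneForm_apply {α : E → E [⋀^Fin 1]→L[ℝ] ℝ} {x : E} (hα : DifferentiableAt ℝ α x)
    {V : E → E} (hV : DifferentiableAt ℝ V x) (u : E) :
    fderiv ℝ (fun y => α y ![V y]) x u =
      fderiv ℝ (fun y => α y ![V x]) x u + α x ![fderiv ℝ V x u] := by
  have hc : HasFDerivAt (fun y => covectorCLM E (α y)) ((covectorCLM E).comp (fderiv ℝ α x)) x :=
    (covectorCLM E).hasFDerivAt.comp x hα.hasFDerivAt
  simp only [← covectorCLM_apply]
  rw [(hc.clm_apply hV.hasFDerivAt).fderiv, (hc.clm_apply (hasFDerivAt_const (V x) x)).fderiv]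
  simp [add_comm]

theorem fderiv_twoForm_apply {Ω : E → E [⋀^Fin 2]→L[ℝ] ℝ} {x : E} (hΩ : DifferentiableAt ℝ Ω x)
    {V : E → E} (hV : DifferentiableAt ℝ V x) (w u : E) :
    fderiv ℝ (fun y => Ω y ![V y, w]) x u =
      fderiv ℝ (fun y => Ω y ![V x, w]) x u + Ω x ![fderiv ℝ V x u, w] := by
  have hc : HasFDerivAt (fun y => bilinearCLM E (Ω y)) ((bilinearCLM E).comp (fderiv ℝ Ω x)) x :=
    HasFDerivAt.comp x (g := bilinearCLM E) (ContinuousLinearMap.hasFDerivAt _) hΩ.hasFDerivAt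
  simp only [← bilinearCLM_apply]
  rw [((hc.clm_apply hV.hasFDerivAt).clm_apply (hasFDerivAt_const w x)).fderiv,
    ((hc.clm_apply (hasFDerivAt_const (V x) x)).clm_apply (hasFDerivAt_const w x)).fderiv]
  simp [add_comm]

theorem curryLeft_differentiableAt {n : ℕ} {Ω : E → E [⋀^Fin (n + 1)]→L[ℝ] ℝ} {x : E}
    (hΩ : DifferentiableAt ℝ Ω x) : DifferentiableAt ℝ (fun y => (Ω y).curryLeft) x :=
  DifferentiableAt.comp x (g := ContinuousAlternatingMap.curryLeftLI (𝕜 := ℝ) (E := E) (F := ℝ)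
    (n := n)) ((LinearIsometry.contDiff (n := 1) _).differentiable one_ne_zero _) hΩ

theorem curryLeft_contDiffAt {n : ℕ} {Ω : E → E [⋀^Fin (n + 1)]→L[ℝ] ℝ} {x : E}
    {r : WithTop ℕ∞} (hΩ : ContDiffAt ℝ r Ω x) : ContDiffAt ℝ r (fun y => (Ω y).curryLeft) x :=
  ContDiffAt.comp x (g := ContinuousAlternatingMap.curryLeftLI (𝕜 := ℝ) (E := E) (F := ℝ)
    (n := n)) (LinearIsometry.contDiff _).contDiffAt hΩ

/-- In a normed space: if `D` is a Liouville field of the closed form `Ω` and `D f = Λ f`, then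
the Hamiltonian field `X` of `f` satisfies `[D, X] = (Λ - 1) X`. -/
theorem lieBracket_hamiltonian_flat {Ω : E → E [⋀^Fin 2]→L[ℝ] ℝ} {D X : E → E} {f : E → ℝ}
    {x : E} {Λ : ℝ} (hΩ : DifferentiableAt ℝ Ω x) (hD : DifferentiableAt ℝ D x)
    (hX : DifferentiableAt ℝ X x) (hf : ContDiffAt ℝ 2 f x) (hclosed : extDeriv Ω x = 0)
    (hLiouville : extDeriv (fun y => (Ω y).curryLeft (D y)) x = Ω x)
    (hXf : ∀ᶠ y in 𝓝 x, ∀ w, Ω y ![X y, w] = - fderiv ℝ f y w)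
    (hDf : ∀ᶠ y in 𝓝 x, fderiv ℝ f y (D y) = Λ * f y)
    (hnd : ∀ v, (∀ w, Ω x ![v, w] = 0) → v = 0) :
    fderiv ℝ X x (D x) - fderiv ℝ D x (X x) = (Λ - 1) • X x := by
  rw [← sub_eq_zero]
  apply hnd
  intro w
  have hf' : DifferentiableAt ℝ (fderiv ℝ f) x :=
    (hf.fderiv_right (m := 1) (by norm_num)).differentiableAt one_ne_zero
  have hsymm : fderiv ℝ (fderiv ℝ f) x (D x) w = fderiv ℝ (fderiv ℝ f) x w (D x) :=
    (hf.isSymmSndFDerivAt (by simp)) _ _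
  have h1 : fderiv ℝ (fun y => Ω y ![X x, w]) x (D x) + Ω x ![fderiv ℝ X x (D x), w] =
      - fderiv ℝ (fderiv ℝ f) x (D x) w := by
    rw [← fderiv_twoForm_apply hΩ hX]
    have : (fun y => Ω y ![X y, w]) =ᶠ[𝓝 x] fun y => - fderiv ℝ f y w := by
      filter_upwards [hXf] with y hy using hy w
    rw [this.fderiv_eq, fderiv_fun_neg,
      (hf'.hasFDerivAt.clm_apply (hasFDerivAt_const w x)).fderiv]
    simp
  have h2 : fderiv ℝ (fderiv ℝ f) x w (D x) + fderiv ℝ f x (fderiv ℝ D x w) =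
      Λ * fderiv ℝ f x w := by
    have e : (fun y => fderiv ℝ f y (D y)) =ᶠ[𝓝 x] fun y => Λ * f y := hDf
    have := congrArg (fun L : E →L[ℝ] ℝ => L w) e.fderiv_eq
    rw [(hf'.hasFDerivAt.clm_apply hD.hasFDerivAt).fderiv,
      fderiv_const_mul (hf.differentiableAt (by norm_num))] at this
    simpa [add_comm] using this
  have h3 := extDeriv_twoForm hΩ (D x) (X x) w
  rw [hclosed, show (0 : E [⋀^Fin (2 + 1)]→L[ℝ] ℝ) ![D x, X x, w] = 0 from rfl] at h3
  have hα : DifferentiableAt ℝ (fun y => (Ω y).curryLeft (D y)) x :=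
    (curryLeft_differentiableAt hΩ).clm_apply hD
  have h4 := extDeriv_oneForm hα (X x) w
  rw [hLiouville] at h4
  have e4 : ∀ (y v : E), (Ω y).curryLeft (D y) ![v] = Ω y ![D y, v] := fun y v => rfl
  simp only [e4] at h4
  rw [fderiv_twoForm_apply hΩ hD, fderiv_twoForm_apply hΩ hD] at h4
  have h5 : Ω x ![X x, fderiv ℝ D x w] = - fderiv ℝ f x (fderiv ℝ D x w) := hXf.self_of_nhds _
  have h6 : Ω x ![X x, w] = - fderiv ℝ f x w := hXf.self_of_nhds _
  have h7 := twoForm_swap (Ω x) (fderiv ℝ D x w) (X x)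
  have h8 : Ω x ![fderiv ℝ X x (D x) - fderiv ℝ D x (X x) - (Λ - 1) • X x, w] =
      Ω x ![fderiv ℝ X x (D x), w] - Ω x ![fderiv ℝ D x (X x), w] - (Λ - 1) * Ω x ![X x, w] := by
    simp only [← bilinearCLM_apply]
    simp
  rw [h8]
  linear_combination h1 + h3 + h4 + h5 - h7 - h2 - Λ * h6 - hsymm

end Flat

section FlatProjection

variable {E : Type*} [NormedAddCommGroup E] [NormedSpace ℝ E]
  {F : Type*} [NormedAddCommGroup F] [NormedSpace ℝ F]

/-- If `Φ` is constant along the field `D`, its second derivative along `D` is determined by the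
first derivative of `D`. -/
theorem fderiv_fderiv_of_vertical {Φ : E → F} {D : E → E} {x : E} (hΦ : ContDiffAt ℝ 2 Φ x)
    (hD : DifferentiableAt ℝ D x) (hΦD : ∀ᶠ y in 𝓝 x, fderiv ℝ Φ y (D y) = 0) (v : E) :
    fderiv ℝ (fderiv ℝ Φ) x (D x) v = - fderiv ℝ Φ x (fderiv ℝ D x v) := by
  have hΦ' : DifferentiableAt ℝ (fderiv ℝ Φ) x :=
    (hΦ.fderiv_right (m := 1) (by norm_num)).differentiableAt one_ne_zero
  have hsymm : fderiv ℝ (fderiv ℝ Φ) x (D x) v = fderiv ℝ (fderiv ℝ Φ) x v (D x) :=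
    (hΦ.isSymmSndFDerivAt (by simp)) _ _
  have e : (fun y => fderiv ℝ Φ y (D y)) =ᶠ[𝓝 x] fun _ => (0 : F) := hΦD
  have h := congrArg (fun L : E →L[ℝ] F => L v) e.fderiv_eq
  rw [(hΦ'.hasFDerivAt.clm_apply hD.hasFDerivAt).fderiv] at h
  have h' : fderiv ℝ Φ x (fderiv ℝ D x v) + fderiv ℝ (fderiv ℝ Φ) x v (D x) = 0 := by
    simpa using h
  rw [hsymm]
  exact eq_neg_of_add_eq_zero_right h'

/-- The image under `Φ` of a field commuting with the vertical field `D` has vanishing derivative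
along `D`. -/
theorem hasFDerivAt_image_of_commute {Φ : E → F} {D X : E → E} {x : E} (hΦ : ContDiffAt ℝ 2 Φ x)
    (hD : DifferentiableAt ℝ D x) (hX : DifferentiableAt ℝ X x)
    (hΦD : ∀ᶠ y in 𝓝 x, fderiv ℝ Φ y (D y) = 0)
    (hcomm : fderiv ℝ X x (D x) = fderiv ℝ D x (X x)) :
    ∃ L : E →L[ℝ] F, HasFDerivAt (fun y => fderiv ℝ Φ y (X y)) L x ∧ L (D x) = 0 := by
  have hΦ' : DifferentiableAt ℝ (fderiv ℝ Φ) x :=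
    (hΦ.fderiv_right (m := 1) (by norm_num)).differentiableAt one_ne_zero
  refine ⟨_, hΦ'.hasFDerivAt.clm_apply hX.hasFDerivAt, ?_⟩
  have := fderiv_fderiv_of_vertical hΦ hD hΦD (X x)
  simp [this, hcomm]

/-- The covectors through which a basic form factors are stationary along a curve tangent to the
vertical field. -/
theorem hasDerivAt_descended_covector [CompleteSpace F] {Φ : E → F} {D : E → E} {x : E}
    {θ : E → E [⋀^Fin 1]→L[ℝ] ℝ} (hΦ : ContDiffAt ℝ 2 Φ x) (hD : DifferentiableAt ℝ D x)
    (hθ : DifferentiableAt ℝ θ x) (hΦD : ∀ᶠ y in 𝓝 x, fderiv ℝ Φ y (D y) = 0)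
    (hθD : ∀ᶠ y in 𝓝 x, θ y ![D y] = 0) (hdθ : ∀ v, extDeriv θ x ![D x, v] = 0)
    (S : F →L[ℝ] E) (hS : (fderiv ℝ Φ x).comp S = ContinuousLinearMap.id ℝ F)
    {z : ℝ → E} {t₀ : ℝ} (hz : HasDerivAt z (D x) t₀) (hz₀ : z t₀ = x) {l : ℝ → F →L[ℝ] ℝ}
    (hl : ∀ᶠ t in 𝓝 t₀, ∀ v, l t (fderiv ℝ Φ (z t) v) = θ (z t) ![v]) :
    HasDerivAt l 0 t₀ := by
  subst hz₀
  have hΦ' : DifferentiableAt ℝ (fderiv ℝ Φ) (z t₀) :=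
    (hΦ.fderiv_right (m := 1) (by norm_num)).differentiableAt one_ne_zero
  have hc : HasFDerivAt (fun y => covectorCLM E (θ y)) ((covectorCLM E).comp (fderiv ℝ θ (z t₀)))
      (z t₀) := (covectorCLM E).hasFDerivAt.comp (z t₀) hθ.hasFDerivAt
  have hA : HasDerivAt (fun t => (fderiv ℝ Φ (z t)).comp S)
      ((fderiv ℝ (fderiv ℝ Φ) (z t₀) (D (z t₀))).comp S) t₀ := by
    have := (hΦ'.hasFDerivAt.comp_hasDerivAt t₀ hz).clm_comp (hasDerivAt_const t₀ S)
    simpa using this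
  have hB : HasDerivAt (fun t => (covectorCLM E (θ (z t))).comp S)
      ((covectorCLM E (fderiv ℝ θ (z t₀) (D (z t₀)))).comp S) t₀ := by
    have := (hc.comp_hasDerivAt t₀ hz).clm_comp (hasDerivAt_const t₀ S)
    simpa using this
  set A : ℝ → F →L[ℝ] F := fun t => (fderiv ℝ Φ (z t)).comp S with hAdef
  have hA₀ : A t₀ = 1 := hS
  have hC : HasDerivAt (fun t => (covectorCLM E (θ (z t))).comp S - (l t₀).comp (A t)) 0 t₀ := by
    have h := hB.sub ((hasDerivAt_const t₀ (l t₀)).clm_comp hA)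
    refine h.congr_deriv (ContinuousLinearMap.ext fun w => ?_)
    have e : (fun y => θ y ![D y]) =ᶠ[𝓝 (z t₀)] fun _ => (0 : ℝ) := hθD
    have h1 := congrArg (fun L : E →L[ℝ] ℝ => L (S w)) e.fderiv_eq
    rw [fderiv_oneForm_apply hθ hD] at h1
    have h2 := hdθ (S w)
    rw [extDeriv_oneForm hθ] at h2
    have h3 := fderiv_fderiv_of_vertical hΦ hD hΦD (S w)
    have h4 := hl.self_of_nhds (fderiv ℝ D (z t₀) (S w))
    have h5 : fderiv ℝ (fun y => θ y ![S w]) (z t₀) (D (z t₀)) =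
        covectorCLM E (fderiv ℝ θ (z t₀) (D (z t₀))) (S w) := by
      simp only [← covectorCLM_apply]
      rw [(hc.clm_apply (hasFDerivAt_const (S w) _)).fderiv]
      simp
    have h6 : fderiv ℝ (fun _ : E => (0 : ℝ)) (z t₀) (S w) = 0 := by simp
    rw [h6] at h1
    simp only [ContinuousLinearMap.zero_comp, zero_add, sub_apply,
      ContinuousLinearMap.comp_apply, zero_apply]
    rw [h3, map_neg, h4, ← h5]
    linarith
  have hinv : DifferentiableAt ℝ (fun t => Ring.inverse (A t)) t₀ := by
    refine DifferentiableAt.comp t₀ (g := Ring.inverse) ?_ hA.differentiableAt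
    rw [hA₀]
    exact differentiableAt_inverse isUnit_one
  have hCi := hC.clm_comp hinv.hasDerivAt
  have hC₀ : (covectorCLM E (θ (z t₀))).comp S - (l t₀).comp (A t₀) = 0 := by
    ext w
    have := hl.self_of_nhds (S w)
    simp [hAdef, this, covectorCLM_apply]
  rw [hC₀] at hCi
  have hunit : ∀ᶠ t in 𝓝 t₀, IsUnit (A t) := by
    have : {a : F →L[ℝ] F | IsUnit a} ∈ 𝓝 (A t₀) := by
      rw [hA₀]
      exact Units.isOpen.mem_nhds isUnit_one
    exact hA.continuousAt this
  have hfin := hCi.const_add (l t₀)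
  have key : (fun t => l t₀ + ((covectorCLM E (θ (z t))).comp S - (l t₀).comp (A t)).comp
      (Ring.inverse (A t))) =ᶠ[𝓝 t₀] l := by
    filter_upwards [hl, hunit] with t ht hu
    have e1 : (covectorCLM E (θ (z t))).comp S = (l t).comp (A t) := by
      ext w
      simp [hAdef, ht, covectorCLM_apply]
    have e2 : (A t).comp (Ring.inverse (A t)) = ContinuousLinearMap.id ℝ F :=
      Ring.mul_inverse_cancel _ hu
    rw [e1, ← ContinuousLinearMap.sub_comp, ContinuousLinearMap.comp_assoc, e2,
      ContinuousLinearMap.comp_id]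
    abel
  have := hfin.congr_of_eventuallyEq key.symm
  simpa using this

end FlatProjection

section Charts

variable {E : Type*} [NormedAddCommGroup E] [NormedSpace ℝ E]
  {H : Type*} [TopologicalSpace H] (I : ModelWithCorners ℝ E H) [I.Boundaryless]
  {M : Type*} [TopologicalSpace M] [ChartedSpace H M] [IsManifold I ∞ M]
  {E' : Type*} [NormedAddCommGroup E'] [NormedSpace ℝ E']
  {H' : Type*} [TopologicalSpace H'] (I' : ModelWithCorners ℝ E' H') [I'.Boundaryless]
  {N : Type*} [TopologicalSpace N] [ChartedSpace H' N] [IsManifold I' ∞ N]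
  {n : ℕ}

/-- The coordinate expression of a vector field in the preferred chart at `x₀`. -/
def fieldInChart (X : VField I M) (x₀ : M) (y : E) : E :=
  mfderiv I 𝓘(ℝ, E) (extChartAt I x₀) ((extChartAt I x₀).symm y) (X ((extChartAt I x₀).symm y))

theorem mdifferentiableAt_extChartAt_symm {x₀ : M} {y : E} (hy : y ∈ (extChartAt I x₀).target) :
    MDifferentiableAt 𝓘(ℝ, E) I (extChartAt I x₀).symm y :=
  ((mdifferentiableOn_extChartAt_symm (I := I) (x := x₀)) y hy).mdifferentiableAt
    ((isOpen_extChartAt_target x₀).mem_nhds hy)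

theorem mfderiv_symm_mfderiv_extChartAt {x₀ : M} {y : E} (hy : y ∈ (extChartAt I x₀).target)
    (v : TangentSpace I ((extChartAt I x₀).symm y)) :
    mfderiv 𝓘(ℝ, E) I (extChartAt I x₀).symm y
      (mfderiv I 𝓘(ℝ, E) (extChartAt I x₀) ((extChartAt I x₀).symm y) v) = v := by
  have h := mfderivWithin_extChartAt_symm_comp_mfderiv_extChartAt (I := I) hy
  rw [I.range_eq_univ, mfderivWithin_univ] at h
  exact congrArg (fun L => L v) h

theorem mfderiv_extChartAt_mfderiv_symm {x₀ : M} {y : E} (hy : y ∈ (extChartAt I x₀).target)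
    (v : E) :
    mfderiv I 𝓘(ℝ, E) (extChartAt I x₀) ((extChartAt I x₀).symm y)
      (mfderiv 𝓘(ℝ, E) I (extChartAt I x₀).symm y v) = v := by
  have h := mfderiv_extChartAt_comp_mfderivWithin_extChartAt_symm (I := I) hy
  rw [I.range_eq_univ, mfderivWithin_univ] at h
  exact congrArg (fun L => L v) h

theorem mfderiv_extChartAt_symm_self (x : M) (v : E) :
    mfderiv 𝓘(ℝ, E) I (extChartAt I x).symm (extChartAt I x x) v = v := by
  have h := mfderivWithin_range_extChartAt_symm (I := I) (x := x)
  rw [I.range_eq_univ, mfderivWithin_univ] at h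
  exact congrArg (fun L => L v) h

theorem mfderiv_extChartAt_self_apply (x : M) (v : E) :
    mfderiv I 𝓘(ℝ, E) (extChartAt I x) x v = v :=
  congrArg (fun L => L v) (mfderiv_extChartAt_self (I := I) (x := x))

theorem mfderiv_symm_fieldInChart (X : VField I M) {x₀ : M} {y : E}
    (hy : y ∈ (extChartAt I x₀).target) :
    mfderiv 𝓘(ℝ, E) I (extChartAt I x₀).symm y (fieldInChart (E := E) I X x₀ y) =
      X ((extChartAt I x₀).symm y) :=
  mfderiv_symm_mfderiv_extChartAt I hy _

theorem fieldInChart_self (X : VField I M) (x : M) :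
    fieldInChart I X x (extChartAt I x x) = X x := by
  unfold fieldInChart
  rw [extChartAt_to_inv x]
  exact mfderiv_extChartAt_self_apply I x _

theorem formInChart_self (Ω : DForm I M n) (x : M) (v : Fin n → E) :
    formInChart I Ω x (extChartAt I x x) v = Ω x v := by
  change Ω ((extChartAt I x).symm (extChartAt I x x))
    (fun i => mfderiv 𝓘(ℝ, E) I (extChartAt I x).symm (extChartAt I x x) (v i)) = _
  simp only [mfderiv_extChartAt_symm_self]
  rw [extChartAt_to_inv x]

theorem extD_apply (Ω : DForm I M n) (x : M) (v : Fin (n + 1) → E) :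
    extD I Ω x v = extDeriv (formInChart I Ω x) (extChartAt I x x) v := by
  change extDeriv (formInChart I Ω x) (extChartAt I x x)
    (fun i => mfderiv I 𝓘(ℝ, E) (extChartAt I x) x (v i)) = _
  simp only [mfderiv_extChartAt_self_apply]

theorem formInChart_interiorProd (X : VField I M) (Ω : DForm I M (n + 1)) {x₀ : M} {y : E}
    (hy : y ∈ (extChartAt I x₀).target) :
    formInChart I (interiorProd I X Ω) x₀ y =
      (formInChart I Ω x₀ y).curryLeft (fieldInChart I X x₀ y) := by
  ext v
  change Ω ((extChartAt I x₀).symm y) (Matrix.vecCons (X ((extChartAt I x₀).symm y))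
    (fun i => mfderiv 𝓘(ℝ, E) I (extChartAt I x₀).symm y (v i))) =
    Ω ((extChartAt I x₀).symm y) (fun i => mfderiv 𝓘(ℝ, E) I (extChartAt I x₀).symm y
      (Matrix.vecCons (fieldInChart (E := E) I X x₀ y) v i))
  congr 1
  ext i
  refine Fin.cases ?_ (fun j => ?_) i
  · exact (mfderiv_symm_fieldInChart I X hy).symm
  · rfl

theorem fderiv_writtenInCharts {f : M → N} {x₀ : M} {c₀ : N} {y : E}
    (hy : y ∈ (extChartAt I x₀).target)
    (hc : f ((extChartAt I x₀).symm y) ∈ (extChartAt I' c₀).source)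
    (hf : MDifferentiableAt I I' f ((extChartAt I x₀).symm y)) (v : E) :
    fderiv ℝ (extChartAt I' c₀ ∘ f ∘ (extChartAt I x₀).symm) y v =
      mfderiv I' 𝓘(ℝ, E') (extChartAt I' c₀) (f ((extChartAt I x₀).symm y))
        (mfderiv I I' f ((extChartAt I x₀).symm y)
          (mfderiv 𝓘(ℝ, E) I (extChartAt I x₀).symm y v)) := by
  have h1 := mdifferentiableAt_extChartAt_symm I hy
  have h3 : MDifferentiableAt I' 𝓘(ℝ, E') (extChartAt I' c₀) (f ((extChartAt I x₀).symm y)) :=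
    mdifferentiableAt_extChartAt (by rwa [← extChartAt_source I'])
  have e : fderiv ℝ (extChartAt I' c₀ ∘ f ∘ (extChartAt I x₀).symm) y =
    mfderiv 𝓘(ℝ, E) 𝓘(ℝ, E') (extChartAt I' c₀ ∘ f ∘ (extChartAt I x₀).symm) y :=
      mfderiv_eq_fderiv.symm
  exact (congrArg (fun L : E →L[ℝ] E' => L v) e).trans
    ((mfderiv_comp_apply (I' := I') y h3 (hf.comp y h1) v).trans
      (congrArg _ (mfderiv_comp_apply y hf h1 v)))

theorem fderiv_function_inChart {f : M → ℝ} {x₀ : M} {y : E}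
    (hy : y ∈ (extChartAt I x₀).target)
    (hf : MDifferentiableAt I 𝓘(ℝ, ℝ) f ((extChartAt I x₀).symm y)) (v : E) :
    fderiv ℝ (f ∘ (extChartAt I x₀).symm) y v =
      differential I f ((extChartAt I x₀).symm y)
        (mfderiv 𝓘(ℝ, E) I (extChartAt I x₀).symm y v) := by
  have h1 := mdifferentiableAt_extChartAt_symm I hy
  have e : fderiv ℝ (f ∘ (extChartAt I x₀).symm) y =
    mfderiv 𝓘(ℝ, E) 𝓘(ℝ, ℝ) (f ∘ (extChartAt I x₀).symm) y := mfderiv_eq_fderiv.symm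
  exact (congrArg (fun L : E →L[ℝ] ℝ => L v) e).trans (mfderiv_comp_apply y hf h1 v)

theorem fderiv_function_inChart_self {f : M → ℝ} {x : M}
    (hf : MDifferentiableAt I 𝓘(ℝ, ℝ) f x) (v : E) :
    fderiv ℝ (f ∘ (extChartAt I x).symm) (extChartAt I x x) v = differential I f x v := by
  rw [fderiv_function_inChart I (mem_extChartAt_target x) (by rwa [extChartAt_to_inv x]),
    mfderiv_extChartAt_symm_self, extChartAt_to_inv x]

theorem contDiffAt_function_inChart {f : M → ℝ} (hf : ContMDiff I 𝓘(ℝ, ℝ) ∞ f) {x₀ : M} {y : E}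
    (hy : y ∈ (extChartAt I x₀).target) : ContDiffAt ℝ ∞ (f ∘ (extChartAt I x₀).symm) y := by
  rw [← contMDiffAt_iff_contDiffAt]
  exact hf.contMDiffAt.comp y ((contMDiffOn_extChartAt_symm x₀).contMDiffAt
    ((isOpen_extChartAt_target x₀).mem_nhds hy))

theorem contDiffAt_writtenInCharts {f : M → N} {x₀ : M} {c₀ : N} {y : E}
    (hf : ContMDiffAt I I' ∞ f ((extChartAt I x₀).symm y))
    (hy : y ∈ (extChartAt I x₀).target)
    (hc : f ((extChartAt I x₀).symm y) ∈ (extChartAt I' c₀).source) :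
    ContDiffAt ℝ ∞ (extChartAt I' c₀ ∘ f ∘ (extChartAt I x₀).symm) y := by
  rw [← contMDiffAt_iff_contDiffAt]
  have h := (contMDiffOn_extChartAt_symm (I := I) (n := ∞) x₀).contMDiffAt
    ((isOpen_extChartAt_target x₀).mem_nhds hy)
  have h' : ContMDiffAt I' 𝓘(ℝ, E') ∞ (extChartAt I' c₀) (f ((extChartAt I x₀).symm y)) :=
    contMDiffAt_extChartAt' (by rwa [← extChartAt_source I'])
  exact ContMDiffAt.comp y h' (hf.comp y h)

theorem contMDiffAt_field_iff (X : VField I M) {x₀ x : M} (hx : x ∈ (extChartAt I x₀).source) :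
    ContMDiffAt I I.tangent ∞ (fun x => (⟨x, X x⟩ : TangentBundle I M)) x ↔
      ContDiffAt ℝ ∞ (fieldInChart I X x₀) (extChartAt I x₀ x) := by
  have hx' : x ∈ (chartAt H x₀).source := by rwa [← extChartAt_source I]
  have h1 := (trivializationAt E (TangentSpace I) x₀).contMDiffAt_section_iff (n := ∞) (IB := I)
    (s := X) (x₀ := x) (by simpa using hx')
  have h2 : (fun x => ((trivializationAt E (TangentSpace I) x₀) ⟨x, X x⟩).2) =ᶠ[𝓝 x]
      fieldInChart I X x₀ ∘ extChartAt I x₀ := by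
    filter_upwards [(chartAt H x₀).open_source.mem_nhds hx'] with y hy
    have h3 := TangentBundle.continuousLinearMapAt_trivializationAt (I := I) hy
    have h4 := congrArg (fun L => L (X y)) h3
    rw [Bundle.Trivialization.continuousLinearMapAt_apply,
      Bundle.Trivialization.linearMapAt_apply, if_pos (by simpa using hy)] at h4
    rw [h4, Function.comp_apply, fieldInChart,
      (extChartAt I x₀).left_inv (by rwa [extChartAt_source I])]
    rfl
  rw [show I.tangent = I.prod 𝓘(ℝ, E) from rfl, h1, h2.contMDiffAt_iff,
    ← contMDiffAt_iff_contDiffAt]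
  constructor
  · intro h
    have hs := (contMDiffOn_extChartAt_symm (I := I) (n := ∞) x₀).contMDiffAt
      ((isOpen_extChartAt_target x₀).mem_nhds ((extChartAt I x₀).map_source hx))
    have h5 : ContMDiffAt 𝓘(ℝ, E) 𝓘(ℝ, E) ∞
        ((fieldInChart I X x₀ ∘ extChartAt I x₀) ∘ (extChartAt I x₀).symm)
        (extChartAt I x₀ x) := by
      refine ContMDiffAt.comp (extChartAt I x₀ x) ?_ hs
      rwa [(extChartAt I x₀).left_inv hx]
    refine h5.congr_of_eventuallyEq ?_
    filter_upwards [(isOpen_extChartAt_target x₀).mem_nhds ((extChartAt I x₀).map_source hx)]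
      with y hy
    simp only [Function.comp_apply]
    rw [(extChartAt I x₀).right_inv hy]
  · intro h
    exact h.comp x (contMDiffAt_extChartAt' hx')

theorem isSmoothField_iff (X : VField I M) :
    IsSmoothField I X ↔ ∀ x, ContDiffAt ℝ ∞ (fieldInChart I X x) (extChartAt I x x) :=
  forall_congr' fun x => contMDiffAt_field_iff I X (mem_extChartAt_source x)

variable {I}

theorem IsSmoothField.contDiffAt {X : VField I M} (hX : IsSmoothField I X) {x₀ : M} {y : E}
    (hy : y ∈ (extChartAt I x₀).target) : ContDiffAt ℝ ∞ (fieldInChart I X x₀) y := by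
  have h := (contMDiffAt_field_iff I X ((extChartAt I x₀).map_target hy)).1 (hX _)
  rwa [(extChartAt I x₀).right_inv hy] at h

theorem IsSmoothForm.contDiffAt {Ω : DForm I M n} (hΩ : IsSmoothForm I Ω) {x₀ : M} {y : E}
    (hy : y ∈ (extChartAt I x₀).target) : ContDiffAt ℝ ∞ (formInChart I Ω x₀) y :=
  (hΩ x₀ y hy).contDiffAt ((isOpen_extChartAt_target x₀).mem_nhds hy)

theorem IsSmoothForm.interiorProd {X : VField I M} (hX : IsSmoothField I X)
    {Ω : DForm I M (n + 1)} (hΩ : IsSmoothForm I Ω) : IsSmoothForm I (interiorProd I X Ω) := by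
  intro x₀ y hy
  refine ContDiffAt.contDiffWithinAt ?_
  refine ((curryLeft_contDiffAt (hΩ.contDiffAt hy)).clm_apply (hX.contDiffAt hy)).congr_of_eventuallyEq ?_
  filter_upwards [(isOpen_extChartAt_target x₀).mem_nhds hy] with z hz
  exact formInChart_interiorProd I X Ω hz

theorem hasDerivAt_integralCurve_inChart {X : VField I M} {γ : ℝ → M} {J : Set ℝ} (hJ : IsOpen J)
    (hγ : IsMIntegralCurveOn γ X J) {t : ℝ} (ht : t ∈ J) {x₀ : M}
    (hx : γ t ∈ (extChartAt I x₀).source) :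
    HasDerivAt (fun s => extChartAt I x₀ (γ s)) (fieldInChart I X x₀ (extChartAt I x₀ (γ t))) t := by
  have h1 := (hγ t ht).hasMFDerivAt (hJ.mem_nhds ht)
  have h2 := (mdifferentiableAt_extChartAt (I := I) (x := x₀) (y := γ t)
    (by rwa [← extChartAt_source I])).hasMFDerivAt
  obtain ⟨L, hL, hL1⟩ : ∃ L : ℝ →L[ℝ] E, HasFDerivAt (fun s => extChartAt I x₀ (γ s)) L t ∧
      L 1 = mfderiv I 𝓘(ℝ, E) (extChartAt I x₀) (γ t) ((1 : ℝ) • X (γ t)) :=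
    ⟨_, hasMFDerivAt_iff_hasFDerivAt.1 (h2.comp t h1), rfl⟩
  refine hL.hasDerivAt.congr_deriv ?_
  rw [hL1, one_smul]
  unfold fieldInChart
  rw [(extChartAt I x₀).left_inv hx]

end Charts

section Submersions

variable {E : Type*} [NormedAddCommGroup E] [NormedSpace ℝ E]
  {H : Type*} [TopologicalSpace H] {I : ModelWithCorners ℝ E H} [I.Boundaryless]
  {M : Type*} [TopologicalSpace M] [ChartedSpace H M] [IsManifold I ∞ M]
  {E' : Type*} [NormedAddCommGroup E'] [NormedSpace ℝ E']
  {H' : Type*} [TopologicalSpace H'] {I' : ModelWithCorners ℝ E' H'} [I'.Boundaryless]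
  {N : Type*} [TopologicalSpace N] [ChartedSpace H' N] [IsManifold I' ∞ N]
  {E'' : Type*} [NormedAddCommGroup E''] [NormedSpace ℝ E'']
  {H'' : Type*} [TopologicalSpace H''] {I'' : ModelWithCorners ℝ E'' H''}
  {L : Type*} [TopologicalSpace L] [ChartedSpace H'' L]

/-- A submersion has smooth local sections through every point. -/
theorem exists_local_section {f : M → N} (hf : Manifold.IsSubmersion I I' ∞ f) (x : M) :
    ∃ (σ : N → M) (U : Set N), IsOpen U ∧ f x ∈ U ∧ ContMDiffOn I' I ∞ σ U ∧ σ (f x) = x ∧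
      ∀ c ∈ U, f (σ c) = c := by
  have hx := hf.isSubmersionOfComplement_complement x
  set φ := hx.domChart.extend I with hφ
  set ψ := hx.codChart.extend I' with hψ
  set w := (hx.equiv (φ x)).2
  have hxs : x ∈ φ.source := by rw [hφ, hx.domChart.extend_source]; exact hx.mem_domChart_source
  have hφo : IsOpen φ.target := hx.domChart.isOpen_extend_target
  have hψo : IsOpen ψ.source := by rw [hψ]; exact hx.codChart.isOpen_extend_source
  have hψc : ContinuousOn ψ ψ.source := hx.codChart.continuousOn_extend
  let τ : N → E := fun c => hx.equiv.symm (ψ c, w)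
  have hτc : ContinuousOn τ ψ.source :=
    hx.equiv.symm.continuous.comp_continuousOn (hψc.prodMk continuousOn_const)
  have hτs : ContMDiffOn I' 𝓘(ℝ, E) ∞ τ ψ.source := by
    have h1 : ContMDiffOn I' 𝓘(ℝ, E') ∞ ψ ψ.source := by
      rw [hψ, hx.codChart.extend_source]
      exact OpenPartialHomeomorph.contMDiffOn_extend hx.codChart_mem_maximalAtlas
    have h2 : ContDiff ℝ ∞ (fun u : E' => hx.equiv.symm (u, w)) :=
      hx.equiv.symm.contDiff.comp (contDiff_id.prodMk contDiff_const)
    exact h2.contMDiff.comp_contMDiffOn h1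
  have hfx : ψ (f x) = (hx.equiv (φ x)).1 := by
    have := hx.writtenInCharts (φ.map_source hxs)
    rw [Function.comp_apply, Function.comp_apply] at this
    change ψ (f (φ.symm (φ x))) = _ at this
    rwa [φ.left_inv hxs] at this
  have hτx : τ (f x) = φ x := by
    change hx.equiv.symm (ψ (f x), w) = φ x
    rw [hfx]
    exact hx.equiv.symm_apply_apply _
  have hfxs : f x ∈ ψ.source := by
    rw [hψ, hx.codChart.extend_source]; exact hx.mem_codChart_source
  refine ⟨fun c => φ.symm (τ c), ψ.source ∩ τ ⁻¹' φ.target, hτc.isOpen_inter_preimage hψo hφo,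
    ⟨hfxs, ?_⟩, ?_, ?_, ?_⟩
  · change τ (f x) ∈ φ.target
    rw [hτx]
    exact φ.map_source hxs
  · have h1 : ContMDiffOn 𝓘(ℝ, E) I ∞ φ.symm φ.target := by
      rw [hφ, hx.domChart.extend_target']
      exact contMDiffOn_extend_symm hx.domChart_mem_maximalAtlas
    exact h1.comp (hτs.mono Set.inter_subset_left) fun c hc => hc.2
  · change φ.symm (τ (f x)) = x
    rw [hτx, φ.left_inv hxs]
  · rintro c ⟨hc, hc'⟩
    have h1 : ψ (f (φ.symm (τ c))) = ψ c := by
      have := hx.writtenInCharts hc'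
      refine this.trans ?_
      change (hx.equiv (hx.equiv.symm (ψ c, w))).1 = ψ c
      rw [hx.equiv.apply_symm_apply]
    have h2 : f (φ.symm (τ c)) ∈ ψ.source := by
      rw [hψ, hx.codChart.extend_source]
      refine hx.mapsto_domChart_source_codChart_source ?_
      rw [← hx.domChart.extend_source (I := I)]
      exact φ.map_target hc'
    exact ψ.injOn h2 hc h1

theorem surjective_mfderiv_of_isSubmersion {f : M → N} (hf : Manifold.IsSubmersion I I' ∞ f)
    (x : M) : Function.Surjective (mfderiv I I' f x) := by
  obtain ⟨σ, U, hU, hxU, hσ, hσx, hfσ⟩ := exists_local_section hf x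
  intro w
  have h1 : MDifferentiableAt I' I σ (f x) :=
    (hσ.contMDiffAt (hU.mem_nhds hxU)).mdifferentiableAt (by simp)
  have h2 : MDifferentiableAt I I' f (σ (f x)) := hf.contMDiff.mdifferentiableAt (by simp)
  have h3 := mfderiv_comp_apply (f x) h2 h1 w
  have h4 : f ∘ σ =ᶠ[𝓝 (f x)] id := by
    filter_upwards [hU.mem_nhds hxU] with c hc using hfσ c hc
  have h5 : (mfderiv I' I' (f ∘ σ) (f x) w : E') = w := by
    rw [h4.mfderiv_eq, mfderiv_id]
    rfl
  revert h3
  generalize mfderiv I' I σ (f x) w = v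
  revert v
  rw [hσx]
  intro v hv
  exact ⟨v, hv.symm.trans h5⟩

/-- A map that becomes smooth after composition with a surjective submersion is smooth. -/
theorem contMDiff_of_comp_isSubmersion {f : M → N} (hf : Manifold.IsSubmersion I I' ∞ f)
    (hsurj : Function.Surjective f) {g : N → L} (hg : ContMDiff I I'' ∞ (fun x => g (f x))) :
    ContMDiff I' I'' ∞ g := by
  intro c
  obtain ⟨x, rfl⟩ := hsurj c
  obtain ⟨σ, U, hU, hxU, hσ, hσx, hfσ⟩ := exists_local_section hf x
  have h := hg.contMDiffAt.comp (f x) (hσ.contMDiffAt (hU.mem_nhds hxU))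
  refine h.congr_of_eventuallyEq ?_
  filter_upwards [hU.mem_nhds hxU] with c hc
  simp [hfσ c hc]

theorem isSmoothField_of_isPushforward {f : M → N} (hf : Manifold.IsSubmersion I I' ∞ f)
    (hsurj : Function.Surjective f) {X : VField I M} (hX : IsSmoothField I X) {Y : VField I' N}
    (hXY : IsPushforward I I' f X Y) : IsSmoothField I' Y := by
  refine contMDiff_of_comp_isSubmersion hf hsurj (g := fun c => (⟨c, Y c⟩ : TangentBundle I' N)) ?_
  have h := (hf.contMDiff.contMDiff_tangentMap (m := ∞) (by simp)).comp hX
  refine h.congr fun x => ?_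
  change (⟨f x, Y (f x)⟩ : TangentBundle I' N) = ⟨f x, mfderiv I I' f x (X x)⟩
  rw [hXY x]

end Submersions

section Orbits

variable {E : Type*} [NormedAddCommGroup E] [NormedSpace ℝ E]
  {H : Type*} [TopologicalSpace H] (I : ModelWithCorners ℝ E H)
  {M : Type*} [TopologicalSpace M] [ChartedSpace H M]

theorem orbitProj_surjective (D : VField I M) : Function.Surjective (orbitProj I D) :=
  Quotient.mk_surjective

theorem orbitProj_integralCurve {D : VField I M} {γ : ℝ → M} {J : Set ℝ} (hJ : IsOpen J)
    (hJ' : J.OrdConnected) (hγ : IsMIntegralCurveOn γ D J) {s t : ℝ} (hs : s ∈ J) (ht : t ∈ J) :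
    orbitProj I D (γ s) = orbitProj I D (γ t) :=
  Quotient.sound (s := orbitSetoid I D)
    (Relation.EqvGen.rel _ _ ⟨γ, J, hJ, hJ', hγ, ⟨s, hs, rfl⟩, t, ht, rfl⟩)

/-- An equivalence relation that holds along integral curves holds along orbits. -/
theorem rel_of_orbitProj_eq {D : VField I M} {r : M → M → Prop} (hr : Equivalence r)
    (h : ∀ (γ : ℝ → M) (J : Set ℝ), IsOpen J → J.OrdConnected → IsMIntegralCurveOn γ D J →
      ∀ s ∈ J, ∀ t ∈ J, r (γ s) (γ t)) {x y : M} (hxy : orbitProj I D x = orbitProj I D y) :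
    r x y := by
  have h1 : Relation.EqvGen (OnCommonCurve I D) x y := Quotient.exact (s := orbitSetoid I D) hxy
  have h2 : Relation.EqvGen r x y := by
    refine h1.mono ?_
    rintro a b ⟨γ, J, hJ, hJ', hγ, ⟨s, hs, rfl⟩, t, ht, rfl⟩
    exact h γ J hJ hJ' hγ s hs t ht
  exact hr.eqvGen_iff.1 h2

theorem eq_of_hasDerivAt_zero {V : Type*} [NormedAddCommGroup V] [NormedSpace ℝ V] {g : ℝ → V}
    {J : Set ℝ} (hJ : IsOpen J) (hJ' : J.OrdConnected) (hg : ∀ t ∈ J, HasDerivAt g 0 t) {s t : ℝ}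
    (hs : s ∈ J) (ht : t ∈ J) : g s = g t :=
  hJ.is_const_of_deriv_eq_zero hJ'.isPreconnected
    (fun u hu => (hg u hu).differentiableAt.differentiableWithinAt)
    (fun u hu => (hg u hu).deriv) hs ht

variable [I.Boundaryless] [IsManifold I ∞ M] [CompleteSpace E]

theorem exists_integralCurve {D : VField I M} (hD : IsSmoothField I D) (x : M) (t₀ : ℝ) :
    ∃ (γ : ℝ → M) (J : Set ℝ), IsOpen J ∧ J.OrdConnected ∧ t₀ ∈ J ∧ γ t₀ = x ∧
      IsMIntegralCurveOn γ D J := by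
  obtain ⟨γ, hγ, hγ'⟩ := exists_isMIntegralCurveAt_of_contMDiffAt_boundaryless (I := I) t₀
    ((hD x).of_le (by simp) : ContMDiffAt I I.tangent 1 _ x)
  obtain ⟨ε, hε, hγ''⟩ := isMIntegralCurveAt_iff'.1 hγ'
  refine ⟨γ, Metric.ball t₀ ε, Metric.isOpen_ball, ?_, Metric.mem_ball_self hε, hγ, hγ''⟩
  rw [Real.ball_eq_Ioo]
  exact Set.ordConnected_Ioo

theorem hasDerivAt_comp_integralCurve {X : VField I M} {f : M → ℝ} (hf : ContMDiff I 𝓘(ℝ, ℝ) ∞ f)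
    {γ : ℝ → M} {J : Set ℝ} (hJ : IsOpen J) (hγ : IsMIntegralCurveOn γ X J) {t : ℝ} (ht : t ∈ J) :
    HasDerivAt (fun s => f (γ s)) (differential I f (γ t) (X (γ t))) t := by
  have h1 := (hγ t ht).hasMFDerivAt (hJ.mem_nhds ht)
  have h2 := (hf.mdifferentiableAt (x := γ t) (by simp)).hasMFDerivAt
  obtain ⟨L, hL, hL1⟩ : ∃ L : ℝ →L[ℝ] ℝ, HasFDerivAt (fun s => f (γ s)) L t ∧
      L 1 = mfderiv I 𝓘(ℝ, ℝ) f (γ t) ((1 : ℝ) • X (γ t)) :=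
    ⟨_, hasMFDerivAt_iff_hasFDerivAt.1 (h2.comp t h1), rfl⟩
  refine hL.hasDerivAt.congr_deriv ?_
  rw [hL1, one_smul]
  rfl

/-- A function with vanishing derivative along a field is constant on the orbits of the field. -/
theorem eq_of_differential_eq_zero {D : VField I M} {f : M → ℝ}
    (hf : ContMDiff I 𝓘(ℝ, ℝ) ∞ f) (hfD : ∀ x, differential I f x (D x) = 0) {x y : M}
    (hxy : orbitProj I D x = orbitProj I D y) : f x = f y := by
  refine rel_of_orbitProj_eq I (r := fun x y => f x = f y) ⟨fun _ => rfl, Eq.symm, Eq.trans⟩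
    ?_ hxy
  intro γ J hJ hJ' hγ s hs t ht
  refine eq_of_hasDerivAt_zero (g := fun t => f (γ t)) hJ hJ' (fun u hu => ?_) hs ht
  exact (hasDerivAt_comp_integralCurve I hf hJ hγ hu).congr_deriv (hfD (γ u))

variable {E' : Type*} [NormedAddCommGroup E'] [NormedSpace ℝ E']
  {H' : Type*} [TopologicalSpace H'] (I' : ModelWithCorners ℝ E' H') [I'.Boundaryless]

theorem mfderiv_orbitProj_self {D : VField I M} (hD : IsSmoothField I D)
    [ChartedSpace H' (OrbitSpace I D)]
    (hs : ContMDiff I I' ∞ (orbitProj I D)) (x : M) :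
    mfderiv I I' (orbitProj I D) x (D x) = 0 := by
  obtain ⟨γ, J, hJ, hJ', h0, rfl, hγ⟩ := exists_integralCurve I hD x 0
  have h1 := (hγ 0 h0).hasMFDerivAt (hJ.mem_nhds h0)
  have h2 := (hs.mdifferentiableAt (x := γ 0) (by simp)).hasMFDerivAt
  have h3 := h2.comp 0 h1
  have h4 : (orbitProj I D ∘ γ) =ᶠ[𝓝 0] fun _ => orbitProj I D (γ 0) := by
    filter_upwards [hJ.mem_nhds h0] with t ht using orbitProj_integralCurve I hJ hJ' hγ ht h0
  have h5 := h3.mfderiv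
  rw [h4.mfderiv_eq, mfderiv_const] at h5
  have h6 := congrArg (fun L => L (1 : ℝ)) h5
  have h7 : mfderiv I I' (orbitProj I D) (γ 0) ((1 : ℝ) • D (γ 0)) = 0 := h6.symm
  rwa [one_smul] at h7

end Orbits

section Invariance

variable {E : Type*} [NormedAddCommGroup E] [NormedSpace ℝ E] [CompleteSpace E]
  {H : Type*} [TopologicalSpace H] {I : ModelWithCorners ℝ E H} [I.Boundaryless]
  {M : Type*} [TopologicalSpace M] [ChartedSpace H M] [IsManifold I ∞ M]
  {E' : Type*} [NormedAddCommGroup E'] [NormedSpace ℝ E']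
  {H' : Type*} [TopologicalSpace H'] {I' : ModelWithCorners ℝ E' H'} [I'.Boundaryless]
  {N : Type*} [TopologicalSpace N] [ChartedSpace H' N] [IsManifold I' ∞ N]

theorem IsMIntegralCurveOn.comp_isPushforward {f : M → N} (hf : ContMDiff I I' ∞ f)
    {X : VField I M} {Y : VField I' N} (hXY : IsPushforward I I' f X Y) {γ : ℝ → M} {J : Set ℝ}
    (hγ : IsMIntegralCurveOn γ X J) : IsMIntegralCurveOn (f ∘ γ) Y J := by
  intro t ht
  have h2 := (hf.mdifferentiableAt (x := γ t) (by simp)).hasMFDerivAt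
  refine (h2.comp_hasMFDerivWithinAt t (hγ t ht)).congr_mfderiv ?_
  ext
  change mfderiv I I' f (γ t) ((1 : ℝ) • X (γ t)) = (1 : ℝ) • Y (f (γ t))
  rw [one_smul, one_smul, hXY]

/-- The image of an invariant saturated set under a surjective map of fields is invariant. -/
theorem isInvariantSet_of_preimage {f : M → N} (hf : ContMDiff I I' ∞ f)
    (hsurj : Function.Surjective f) {X : VField I M} (hX : IsSmoothField I X) {Y : VField I' N}
    (hY : IsSmoothField I' Y) (hXY : IsPushforward I I' f X Y) {S : Set N}
    (hS : IsInvariantSet I X (f ⁻¹' S)) : IsInvariantSet I' Y S := by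
  intro γ J hJ hJ' hγ s hs hsS t ht
  have key : ∀ u ∈ J, ∀ᶠ v in 𝓝 u, (γ v ∈ S ↔ γ u ∈ S) := by
    intro u hu
    obtain ⟨x, hx⟩ := hsurj (γ u)
    obtain ⟨β, K, hK, hK', huK, hβ, hβK⟩ := exists_integralCurve I hX x u
    have h1 := (IsMIntegralCurveOn.comp_isPushforward hf hXY hβK).isMIntegralCurveAt
      (hK.mem_nhds huK)
    have h2 := hγ.isMIntegralCurveAt (hJ.mem_nhds hu)
    have h3 := isMIntegralCurveAt_eventuallyEq_of_contMDiffAt_boundaryless (I := I')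
      ((hY (γ u)).of_le (by simp) : ContMDiffAt I' I'.tangent 1 _ (γ u)) h2 h1
      (by simp [hβ, hx])
    filter_upwards [h3, hK.mem_nhds huK] with v hv hvK
    have e1 : γ v = f (β v) := hv
    have e2 : γ u = f (β u) := by rw [hβ, hx]
    rw [e1, e2]
    exact ⟨fun h => hS β K hK hK' hβK v hvK h u huK, fun h => hS β K hK hK' hβK u huK h v hvK⟩
  by_contra htS
  have hopen : ∀ T : Set ℝ, (∀ u ∈ J, u ∈ T → ∀ᶠ v in 𝓝 u, v ∈ T) → IsOpen (J ∩ T) := by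
    intro T hT
    rw [isOpen_iff_mem_nhds]
    rintro u ⟨hu, huT⟩
    exact Filter.inter_mem (hJ.mem_nhds hu) (hT u hu huT)
  have hA := hopen {u | γ u ∈ S} fun u hu huS => (key u hu).mono fun v hv => hv.2 huS
  have hB := hopen {u | γ u ∉ S} fun u hu huS => (key u hu).mono fun v hv hv' => huS (hv.1 hv')
  obtain ⟨u, -, ⟨-, hu1⟩, -, hu2⟩ := hJ'.isPreconnected _ _ hA hB
    (fun u hu => (em (γ u ∈ S)).imp (fun h => ⟨hu, h⟩) (fun h => ⟨hu, h⟩))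
    ⟨s, hs, hs, hsS⟩ ⟨t, ht, ht, htS⟩
  exact hu2 hu1

end Invariance

section Descent

variable {E : Type*} [NormedAddCommGroup E] [NormedSpace ℝ E]
  {H : Type*} [TopologicalSpace H] (I : ModelWithCorners ℝ E H) [I.Boundaryless]
  {M : Type*} [TopologicalSpace M] [ChartedSpace H M] [IsManifold I ∞ M]
  {E' : Type*} [NormedAddCommGroup E'] [NormedSpace ℝ E']
  {H' : Type*} [TopologicalSpace H'] (I' : ModelWithCorners ℝ E' H') [I'.Boundaryless]
  {N : Type*} [TopologicalSpace N] [ChartedSpace H' N] [IsManifold I' ∞ N] {n : ℕ}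

theorem fderiv_writtenInCharts_of_eq {f : M → N} {x₀ x : M} (hx : x ∈ (extChartAt I x₀).source)
    (hf : MDifferentiableAt I I' f x) (hc : f x = f x₀) (v : E) :
    fderiv ℝ (extChartAt I' (f x₀) ∘ f ∘ (extChartAt I x₀).symm) (extChartAt I x₀ x) v =
      (mfderiv I I' f x (mfderiv 𝓘(ℝ, E) I (extChartAt I x₀).symm (extChartAt I x₀ x) v) : E') := by
  have hl := (extChartAt I x₀).left_inv hx
  rw [fderiv_writtenInCharts I I' ((extChartAt I x₀).map_source hx)
    (by rw [hl, hc]; exact mem_extChartAt_source _) (by rwa [hl])]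
  generalize (mfderiv 𝓘(ℝ, E) I (extChartAt I x₀).symm (extChartAt I x₀ x) v) = w
  revert w
  rw [hl, hc]
  exact fun w => mfderiv_extChartAt_self_apply I' (f x₀) _

theorem extD_pullbackForm {f : M → N} (hf : ContMDiff I I' ∞ f) {η : DForm I' N n}
    (hη : IsSmoothForm I' η) {θ : DForm I M n} (hθ : ∀ x, pullbackForm I I' f η x = θ x) (x : M)
    (v : Fin (n + 1) → E) :
    extD I θ x v = extD I' η (f x) (fun i => mfderiv I I' f x (v i)) := by
  have hy := mem_extChartAt_target (I := I) x
  have hxs := mem_extChartAt_source (I := I) x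
  set Φ := extChartAt I' (f x) ∘ f ∘ (extChartAt I x).symm with hΦ
  have hΦx : Φ (extChartAt I x x) = extChartAt I' (f x) (f x) := by
    simp only [hΦ, Function.comp_apply]
    rw [extChartAt_to_inv x]
  have hΦs : ContDiffAt ℝ ∞ Φ (extChartAt I x x) :=
    contDiffAt_writtenInCharts I I' hf.contMDiffAt hy
      (by rw [extChartAt_to_inv x]; exact mem_extChartAt_source _)
  have hev : formInChart I θ x =ᶠ[𝓝 (extChartAt I x x)]
      fun y => (formInChart I' η (f x) (Φ y)).compContinuousLinearMap (fderiv ℝ Φ y) := by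
    have hcont : ∀ᶠ y in 𝓝 (extChartAt I x x),
        f ((extChartAt I x).symm y) ∈ (extChartAt I' (f x)).source := by
      have h1 : ContinuousAt (fun y => f ((extChartAt I x).symm y)) (extChartAt I x x) :=
        (hf.continuous.continuousAt).comp (continuousAt_extChartAt_symm x)
      refine h1.preimage_mem_nhds ?_
      rw [extChartAt_to_inv x]
      exact extChartAt_source_mem_nhds _
    filter_upwards [(isOpen_extChartAt_target x).mem_nhds hy, hcont] with y hy hc
    ext w
    have hl : (extChartAt I' (f x)).symm (Φ y) = f ((extChartAt I x).symm y) :=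
      (extChartAt I' (f x)).left_inv hc
    have hd : ∀ i, (mfderiv 𝓘(ℝ, E') I' (extChartAt I' (f x)).symm (Φ y) (fderiv ℝ Φ y (w i)) : E')
        = mfderiv I I' f ((extChartAt I x).symm y)
          (mfderiv 𝓘(ℝ, E) I (extChartAt I x).symm y (w i)) := by
      intro i
      rw [hΦ, fderiv_writtenInCharts I I' hy hc (hf.mdifferentiableAt (by simp)), ← hΦ]
      have h := mfderiv_symm_mfderiv_extChartAt I' ((extChartAt I' (f x)).map_source hc)
      generalize mfderiv I I' f ((extChartAt I x).symm y)
          (mfderiv 𝓘(ℝ, E) I (extChartAt I x).symm y (w i)) = u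
      revert u
      rw [← hl]
      exact h
    have hη' : ∀ u : Fin n → E', η ((extChartAt I' (f x)).symm (Φ y)) u =
        η (f ((extChartAt I x).symm y)) u := by rw [hl]; exact fun u => rfl
    change θ ((extChartAt I x).symm y) (fun i => mfderiv 𝓘(ℝ, E) I (extChartAt I x).symm y (w i)) =
      η ((extChartAt I' (f x)).symm (Φ y)) (fun i => mfderiv 𝓘(ℝ, E') I' (extChartAt I' (f x)).symm
        (Φ y) (fderiv ℝ Φ y (w i)))
    rw [← hθ]
    refine Eq.trans ?_ (hη' _).symm
    change η _ (fun i => mfderiv I I' f ((extChartAt I x).symm y) (mfderiv 𝓘(ℝ, E) I _ y (w i))) = _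
    congr 1
    funext i
    exact (hd i).symm
  have hηd : DifferentiableAt ℝ (formInChart I' η (f x)) (Φ (extChartAt I x x)) := by
    rw [hΦx]
    exact (hη.contDiffAt (mem_extChartAt_target _)).differentiableAt (by simp)
  refine Eq.trans ?_ (extD_apply I' η (f x) (fun i => mfderiv I I' f x (v i))).symm
  rw [extD_apply, hev.extDeriv_eq,
    extDeriv_pullback (r := ∞) hηd hΦs (by simpa using WithTop.coe_le_coe.2 (le_top : (2 : ℕ∞) ≤ ⊤)), hΦx]
  change extDeriv _ _ (fun i => fderiv ℝ Φ (extChartAt I x x) (v i)) = _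
  congr 1
  funext i
  rw [hΦ, fderiv_writtenInCharts_of_eq I I' hxs (hf.mdifferentiableAt (by simp)) rfl,
    mfderiv_extChartAt_symm_self]

theorem contDiffAt_oneForm_comp {F : Type*} [NormedAddCommGroup F] [NormedSpace ℝ F]
    {α : E → E [⋀^Fin 1]→L[ℝ] ℝ} {S : F → E} {y : F} (hα : ContDiffAt ℝ ∞ α (S y))
    (hS : ContDiffAt ℝ ∞ S y) :
    ContDiffAt ℝ ∞ (fun z => (α (S z)).compContinuousLinearMap (fderiv ℝ S z)) y := by
  have h1 : ContDiffAt ℝ ∞ (fun z => covectorCLM E (α (S z))) y :=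
    (covectorCLM E).contDiff.contDiffAt.comp y (hα.comp y hS)
  have h2 : ContDiffAt ℝ ∞ (fderiv ℝ S) y := hS.fderiv_right (by simp)
  have h3 := h1.clm_comp h2
  have h4 : ContDiffAt ℝ ∞ (fun z => ContinuousAlternatingMap.ofSubsingletonLIE (𝕜 := ℝ) (E := F)
      (F := ℝ) (0 : Fin 1) ((covectorCLM E (α (S z))).comp (fderiv ℝ S z))) y :=
    (ContinuousAlternatingMap.ofSubsingletonLIE (𝕜 := ℝ) (E := F)
      (F := ℝ) (0 : Fin 1)).contDiff.contDiffAt.comp y h3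
  refine h4.congr_of_eventuallyEq (Filter.Eventually.of_forall fun z => ?_)
  ext w
  change α (S z) (fun i => fderiv ℝ S z (w i)) =
    covectorCLM E (α (S z)) (fderiv ℝ S z (w 0))
  rw [covectorCLM_apply]
  congr 1
  ext i
  fin_cases i
  rfl

/-- A `1`-form whose pull back under a surjective submersion is smooth is smooth. -/
theorem isSmoothForm_of_pullbackForm {f : M → N} (hf : Manifold.IsSubmersion I I' ∞ f)
    (hsurj : Function.Surjective f) {η : DForm I' N 1} {θ : DForm I M 1} (hθs : IsSmoothForm I θ)
    (hθ : ∀ x, pullbackForm I I' f η x = θ x) : IsSmoothForm I' η := by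
  intro c₀ y₁ hy₁
  refine ContDiffAt.contDiffWithinAt ?_
  obtain ⟨x₁, hx₁⟩ := hsurj ((extChartAt I' c₀).symm y₁)
  obtain ⟨σ, U, hU, hxU, hσ, hσx, hfσ⟩ := exists_local_section hf x₁
  have hsymm := fun (y : E') (hy : y ∈ (extChartAt I' c₀).target) =>
    (contMDiffOn_extChartAt_symm (I := I') (n := ∞) c₀).contMDiffAt
      ((isOpen_extChartAt_target c₀).mem_nhds hy)
  set s : E' → M := fun y => σ ((extChartAt I' c₀).symm y) with hs
  set V : Set E' := (extChartAt I' c₀).target ∩ (extChartAt I' c₀).symm ⁻¹' U with hV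
  have hVo : IsOpen V :=
    (contMDiffOn_extChartAt_symm (I := I') (n := ∞) c₀).continuousOn.isOpen_inter_preimage
      (isOpen_extChartAt_target c₀) hU
  have hsV : ∀ y ∈ V, ContMDiffAt 𝓘(ℝ, E') I ∞ s y := fun y hy =>
    (hσ.contMDiffAt (hU.mem_nhds hy.2)).comp y (hsymm y hy.1)
  have hfs : ∀ y ∈ V, f (s y) = (extChartAt I' c₀).symm y := fun y hy => hfσ _ hy.2
  have hy₁V : y₁ ∈ V := ⟨hy₁, by change (extChartAt I' c₀).symm y₁ ∈ U; rwa [← hx₁]⟩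
  have hsy₁ : s y₁ = x₁ := by simp only [hs]; rw [← hx₁, hσx]
  set S : E' → E := fun y => extChartAt I x₁ (s y) with hS
  have hW : ∀ᶠ y in 𝓝 y₁, s y ∈ (extChartAt I x₁).source := by
    refine (hsV y₁ hy₁V).continuousAt.preimage_mem_nhds ?_
    rw [hsy₁]
    exact extChartAt_source_mem_nhds _
  have hext : ∀ x ∈ (extChartAt I x₁).source, ContMDiffAt I 𝓘(ℝ, E) ∞ (extChartAt I x₁) x :=
    fun x hx => contMDiffAt_extChartAt' (by rwa [← extChartAt_source I])
  have hSs : ContDiffAt ℝ ∞ S y₁ := by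
    rw [← contMDiffAt_iff_contDiffAt]
    exact ContMDiffAt.comp y₁ (hext _ hW.self_of_nhds) (hsV y₁ hy₁V)
  have hθ₁ : ContDiffAt ℝ ∞ (formInChart I θ x₁) (S y₁) :=
    hθs.contDiffAt ((extChartAt I x₁).map_source hW.self_of_nhds)
  refine (contDiffAt_oneForm_comp hθ₁ hSs).congr_of_eventuallyEq ?_
  filter_upwards [hW, hVo.mem_nhds hy₁V] with y hyW hyV
  ext w
  have hl : (extChartAt I x₁).symm (S y) = s y := (extChartAt I x₁).left_inv hyW
  have hSd : ∀ v, fderiv ℝ S y v = (mfderiv I 𝓘(ℝ, E) (extChartAt I x₁) (s y)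
      (mfderiv 𝓘(ℝ, E') I s y v) : E) := fun v =>
    (congrArg (fun L : E' →L[ℝ] E => L v) (mfderiv_eq_fderiv (f := S) (x := y)).symm).trans
      (mfderiv_comp_apply y ((hext _ hyW).mdifferentiableAt (by simp))
        ((hsV y hyV).mdifferentiableAt (by simp)) v)
  have h1 : ∀ v : E', (mfderiv 𝓘(ℝ, E) I (extChartAt I x₁).symm (S y) (fderiv ℝ S y v) : E) =
      mfderiv 𝓘(ℝ, E') I s y v := by
    intro v
    rw [hSd]
    have h := mfderiv_symm_mfderiv_extChartAt I ((extChartAt I x₁).map_source hyW)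
    generalize mfderiv 𝓘(ℝ, E') I s y v = u
    revert u
    change ∀ u : TangentSpace I (s y), (mfderiv 𝓘(ℝ, E) I (extChartAt I x₁).symm (S y)
      (mfderiv I 𝓘(ℝ, E) (extChartAt I x₁) (s y) u) : E) = u
    rw [← hl]
    exact h
  have h2 : ∀ v : E', (mfderiv 𝓘(ℝ, E') I' (extChartAt I' c₀).symm y v : E') =
      mfderiv I I' f (s y) (mfderiv 𝓘(ℝ, E') I s y v) := by
    intro v
    have e : (extChartAt I' c₀).symm =ᶠ[𝓝 y] f ∘ s := by
      filter_upwards [hVo.mem_nhds hyV] with z hz using (hfs z hz).symm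
    rw [e.mfderiv_eq]
    exact mfderiv_comp_apply y (hf.contMDiff.mdifferentiableAt (by simp))
        ((hsV y hyV).mdifferentiableAt (by simp)) v
  have hη' : ∀ u : Fin 1 → E', η ((extChartAt I' c₀).symm y) u = η (f (s y)) u := by
    rw [hfs y hyV]; exact fun u => rfl
  have hθ' : ∀ u : Fin 1 → E, θ ((extChartAt I x₁).symm (S y)) u = θ (s y) u := by
    rw [hl]; exact fun u => rfl
  refine Eq.trans (b := η (f (s y)) (fun i => mfderiv I I' f (s y) (mfderiv 𝓘(ℝ, E') I s y (w i))))
    ((hη' _).trans (congrArg _ (funext fun i => h2 (w i)))) ?_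
  refine Eq.trans (b := θ (s y) (fun i => mfderiv 𝓘(ℝ, E') I s y (w i))) ?_
    ((congrArg (θ (s y)) (funext fun i => (h1 (w i)).symm)).trans (hθ' _).symm)
  rw [← hθ]
  rfl

end Descent

section OrbitDescent

variable {E : Type*} [NormedAddCommGroup E] [NormedSpace ℝ E] [FiniteDimensional ℝ E]
  {H : Type*} [TopologicalSpace H] (I : ModelWithCorners ℝ E H) [I.Boundaryless]
  {M : Type*} [TopologicalSpace M] [ChartedSpace H M] [IsManifold I ∞ M]
  {E' : Type*} [NormedAddCommGroup E'] [NormedSpace ℝ E'] [FiniteDimensional ℝ E']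
  {H' : Type*} [TopologicalSpace H'] (I' : ModelWithCorners ℝ E' H') [I'.Boundaryless]
  {D : VField I M} [ChartedSpace H' (OrbitSpace I D)] [IsManifold I' ∞ (OrbitSpace I D)]

theorem two_le_infty : (2 : WithTop ℕ∞) ≤ ∞ := WithTop.coe_le_coe.2 le_top

theorem exists_continuous_section {A : E →L[ℝ] E'} (hA : Function.Surjective A) :
    ∃ S : E' →L[ℝ] E, A.comp S = ContinuousLinearMap.id ℝ E' :=
  ContinuousLinearMap.exists_rightInverse_of_surjective A (LinearMap.range_eq_top.2 hA)

theorem covectorCLM_section {A : E →L[ℝ] E'} {S : E' →L[ℝ] E} {α : E [⋀^Fin 1]→L[ℝ] ℝ} {d : E}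
    (hS : A.comp S = ContinuousLinearMap.id ℝ E') (hA : ∀ v, A v = 0 → ∃ c : ℝ, v = c • d)
    (hα : α ![d] = 0) (v : E) : (covectorCLM E α).comp S (A v) = α ![v] := by
  have h1 : A (S (A v) - v) = 0 := by
    rw [map_sub, sub_eq_zero]
    exact congrArg (fun L : E' →L[ℝ] E' => L (A v)) hS
  obtain ⟨c, hc⟩ := hA _ h1
  have h2 : covectorCLM E α (S (A v) - v) = 0 := by
    rw [hc, map_smul, covectorCLM_apply, hα, smul_zero]
  rw [map_sub, sub_eq_zero, covectorCLM_apply _ v] at h2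
  exact h2

theorem eventually_chart_orbitProj (hs : ContMDiff I I' ∞ (orbitProj I D)) (x : M) :
    ∀ᶠ y in 𝓝 (extChartAt I x x), y ∈ (extChartAt I x).target ∧
      orbitProj I D ((extChartAt I x).symm y) ∈ (extChartAt I' (orbitProj I D x)).source := by
  refine Filter.Eventually.and ((isOpen_extChartAt_target x).mem_nhds (mem_extChartAt_target x)) ?_
  have h1 : ContinuousAt (fun y => orbitProj I D ((extChartAt I x).symm y)) (extChartAt I x x) :=
    (hs.continuous.continuousAt).comp (continuousAt_extChartAt_symm x)
  refine h1.preimage_mem_nhds ?_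
  rw [extChartAt_to_inv x]
  exact extChartAt_source_mem_nhds _

theorem eventually_fderiv_vertical (hD : IsSmoothField I D)
    (hs : ContMDiff I I' ∞ (orbitProj I D)) (x : M) :
    ∀ᶠ y in 𝓝 (extChartAt I x x), fderiv ℝ (extChartAt I' (orbitProj I D x) ∘ orbitProj I D ∘
      (extChartAt I x).symm) y (fieldInChart I D x y) = 0 := by
  filter_upwards [eventually_chart_orbitProj I I' hs x] with y hy
  rw [fderiv_writtenInCharts I I' hy.1 hy.2 (hs.mdifferentiableAt (by simp)),
    mfderiv_symm_fieldInChart I D hy.1, mfderiv_orbitProj_self I I' hD hs]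
  exact map_zero _

/-- The projection of a field commuting with `D` is the same at all points of an orbit. -/
theorem mfderiv_orbitProj_eq (hD : IsSmoothField I D) (hs : ContMDiff I I' ∞ (orbitProj I D))
    {X : VField I M} (hX : IsSmoothField I X)
    (hcomm : ∀ x, fderiv ℝ (fieldInChart I X x) (extChartAt I x x) (D x) =
      fderiv ℝ (fieldInChart I D x) (extChartAt I x x) (X x)) {x y : M}
    (hxy : orbitProj I D x = orbitProj I D y) :
    (mfderiv I I' (orbitProj I D) x (X x) : E') = mfderiv I I' (orbitProj I D) y (X y) := by
  refine rel_of_orbitProj_eq I (r := fun x y => (mfderiv I I' (orbitProj I D) x (X x) : E') =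
    mfderiv I I' (orbitProj I D) y (X y)) ⟨fun _ => rfl, Eq.symm, Eq.trans⟩ ?_ hxy
  intro γ J hJ hJ' hγ s hs' t ht
  refine eq_of_hasDerivAt_zero (g := fun t => (mfderiv I I' (orbitProj I D) (γ t) (X (γ t)) : E'))
    hJ hJ' (fun u hu => ?_) hs' ht
  have hy := mem_extChartAt_target (I := I) (γ u)
  have hΦs := contDiffAt_writtenInCharts I I' hs.contMDiffAt hy
      (by rw [extChartAt_to_inv (γ u)]; exact mem_extChartAt_source (orbitProj I D (γ u)))
  obtain ⟨L, hL, hL0⟩ := hasFDerivAt_image_of_commute (hΦs.of_le two_le_infty)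
    ((hD.contDiffAt hy).differentiableAt (by simp)) ((hX.contDiffAt hy).differentiableAt (by simp))
    (eventually_fderiv_vertical I I' hD hs (γ u))
    (by rw [fieldInChart_self, fieldInChart_self]; exact hcomm (γ u))
  have hz := hasDerivAt_integralCurve_inChart hJ hγ hu (mem_extChartAt_source (I := I) (γ u))
  have h := hL.comp_hasDerivAt u hz
  rw [hL0] at h
  refine h.congr_of_eventuallyEq ?_
  have hc : ContinuousAt γ u := (hγ.isMIntegralCurveAt (hJ.mem_nhds hu)).continuousAt
  filter_upwards [hJ.mem_nhds hu, hc.preimage_mem_nhds (extChartAt_source_mem_nhds (I := I) (γ u))]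
    with t ht hts
  have hts' : γ t ∈ (extChartAt I (γ u)).source := hts
  rw [Function.comp_apply, fderiv_writtenInCharts_of_eq I I' hts' (hs.mdifferentiableAt (by simp))
    (orbitProj_integralCurve I hJ hJ' hγ ht hu),
    mfderiv_symm_fieldInChart I X ((extChartAt I (γ u)).map_source hts'),
    (extChartAt I (γ u)).left_inv hts']

theorem existsUnique_pushforward (hD : IsSmoothField I D) (hs : ContMDiff I I' ∞ (orbitProj I D))
    {X : VField I M} (hX : IsSmoothField I X)
    (hcomm : ∀ x, fderiv ℝ (fieldInChart I X x) (extChartAt I x x) (D x) =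
      fderiv ℝ (fieldInChart I D x) (extChartAt I x x) (X x)) :
    ∃! Y : VField I' (OrbitSpace I D), IsPushforward I I' (orbitProj I D) X Y := by
  choose r hr using orbitProj_surjective I D
  refine ⟨fun c => (mfderiv I I' (orbitProj I D) (r c) (X (r c)) : E'), fun x => ?_, fun Y hY => ?_⟩
  · exact mfderiv_orbitProj_eq I I' hD hs hX hcomm (hr _).symm
  · funext c
    have h := hY (r c)
    have h2 : (Y (orbitProj I D (r c)) : E') = Y c := by rw [hr c]
    exact h2.symm.trans h.symm

/-- A basic `1`-form descends to the orbit space. -/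
theorem exists_form_of_basic (hD : IsSmoothField I D)
    (hsub : Manifold.IsSubmersion I I' ∞ (orbitProj I D))
    (hker : ∀ x (v : TangentSpace I x), mfderiv I I' (orbitProj I D) x v = 0 → ∃ c : ℝ, v = c • D x)
    {θ : DForm I M 1} (hθs : IsSmoothForm I θ) (hθD : ∀ x, θ x ![D x] = 0)
    (hdθ : ∀ x (v : TangentSpace I x), extD I θ x ![D x, v] = 0) :
    ∃ η : DForm I' (OrbitSpace I D) 1, IsSmoothForm I' η ∧
      ∀ x, pullbackForm I I' (orbitProj I D) η x = θ x := by
  have hs := hsub.contMDiff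
  have hS : ∀ x, ∃ S : E' →L[ℝ] E, (mfderiv I I' (orbitProj I D) x : E →L[ℝ] E').comp S =
      ContinuousLinearMap.id ℝ E' := fun x =>
    exists_continuous_section (E := E) (E' := E') (surjective_mfderiv_of_isSubmersion hsub x)
  choose S hS using hS
  let l : M → E' →L[ℝ] ℝ := fun x => (covectorCLM E (θ x)).comp (S x)
  have hl : ∀ (x : M) (v : E), l x (mfderiv I I' (orbitProj I D) x v : E') = θ x ![v] :=
    fun x v => covectorCLM_section (E := E) (E' := E') (hS x) (hker x) (hθD x) v
  have hconst : ∀ x y, orbitProj I D x = orbitProj I D y → l x = l y := by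
    intro x y hxy
    refine rel_of_orbitProj_eq I (r := fun x y => l x = l y) ⟨fun _ => rfl, Eq.symm, Eq.trans⟩
      ?_ hxy
    intro γ J hJ hJ' hγ s hs' t ht
    refine eq_of_hasDerivAt_zero (g := fun t => l (γ t)) hJ hJ' (fun u hu => ?_) hs' ht
    have hy := mem_extChartAt_target (I := I) (γ u)
    have hΦs := contDiffAt_writtenInCharts I I' hs.contMDiffAt hy
      (by rw [extChartAt_to_inv (γ u)]; exact mem_extChartAt_source (orbitProj I D (γ u)))
    have hz := hasDerivAt_integralCurve_inChart hJ hγ hu (mem_extChartAt_source (I := I) (γ u))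
    have hc : ContinuousAt γ u := (hγ.isMIntegralCurveAt (hJ.mem_nhds hu)).continuousAt
    refine hasDerivAt_descended_covector (hΦs.of_le two_le_infty)
      ((hD.contDiffAt hy).differentiableAt (by simp))
      ((hθs.contDiffAt hy).differentiableAt (by simp))
      (eventually_fderiv_vertical I I' hD hs (γ u)) ?_ ?_ (S (γ u)) ?_ hz rfl ?_
    · filter_upwards [(isOpen_extChartAt_target (γ u)).mem_nhds hy] with z hz
      have h := hθD ((extChartAt I (γ u)).symm z)
      refine Eq.trans ?_ h
      change θ _ (fun i => mfderiv 𝓘(ℝ, E) I (extChartAt I (γ u)).symm z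
        ((![fieldInChart I D (γ u) z] : Fin 1 → E) i)) = _
      congr 1
      funext i
      fin_cases i
      exact mfderiv_symm_fieldInChart I D hz
    · intro v
      rw [fieldInChart_self]
      exact (extD_apply I θ (γ u) _).symm.trans (hdθ (γ u) v)
    · refine Eq.trans ?_ (hS (γ u))
      ext w
      have h := fderiv_writtenInCharts_of_eq I I' (mem_extChartAt_source (I := I) (γ u))
        (hs.mdifferentiableAt (by simp)) rfl (S (γ u) w)
      rw [mfderiv_extChartAt_symm_self] at h
      exact h
    · filter_upwards [hJ.mem_nhds hu,
        hc.preimage_mem_nhds (extChartAt_source_mem_nhds (I := I) (γ u))] with t ht hts v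
      have hts' : γ t ∈ (extChartAt I (γ u)).source := hts
      rw [fderiv_writtenInCharts_of_eq I I' hts' (hs.mdifferentiableAt (by simp))
        (orbitProj_integralCurve I hJ hJ' hγ ht hu)]
      refine (hl _ _).trans ?_
      have hθ' : ∀ w : Fin 1 → E, θ ((extChartAt I (γ u)).symm (extChartAt I (γ u) (γ t))) w =
          θ (γ t) w := by
        rw [(extChartAt I (γ u)).left_inv hts']; exact fun w => rfl
      refine Eq.trans ?_ (hθ' _).symm
      congr 1
      funext i
      fin_cases i
      rfl
  choose r hr using orbitProj_surjective I D
  let η : DForm I' (OrbitSpace I D) 1 := fun c =>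
    (ContinuousAlternatingMap.ofSubsingleton ℝ E' ℝ (0 : Fin 1) (l (r c)))
  have hη : ∀ x, pullbackForm I I' (orbitProj I D) η x = θ x := by
    intro x
    ext v
    change l (r (orbitProj I D x)) (mfderiv I I' (orbitProj I D) x (v 0)) = θ x v
    rw [hconst _ _ (hr (orbitProj I D x))]
    refine (hl x (v 0)).trans ?_
    congr 1
    funext i
    fin_cases i
    rfl
  exact ⟨η, isSmoothForm_of_pullbackForm I I' hsub (orbitProj_surjective I D) hθs hη, hη⟩

end OrbitDescent

section Hamiltonian

variable {E : Type*} [NormedAddCommGroup E] [NormedSpace ℝ E] [FiniteDimensional ℝ E]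

theorem exists_equiv_of_nondegenerate {B : E →L[ℝ] E →L[ℝ] ℝ}
    (hB : ∀ v, (∀ w, B v w = 0) → v = 0) :
    ∃ e : E ≃L[ℝ] (E →L[ℝ] ℝ), (e : E →L[ℝ] E →L[ℝ] ℝ) = B := by
  have hinj : Function.Injective (B : E →ₗ[ℝ] E →L[ℝ] ℝ) := by
    rw [injective_iff_map_eq_zero]
    intro v hv
    exact hB v fun w => congrArg (fun L : E →L[ℝ] ℝ => L w) hv
  have hrank : Module.finrank ℝ E = Module.finrank ℝ (E →L[ℝ] ℝ) := by
    rw [← (LinearMap.toContinuousLinearMap : (E →ₗ[ℝ] ℝ) ≃ₗ[ℝ] E →L[ℝ] ℝ).finrank_eq]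
    exact (Subspace.dual_finrank_eq (K := ℝ) (V := E)).symm
  refine ⟨(LinearEquiv.ofInjectiveOfFinrankEq (B : E →ₗ[ℝ] E →L[ℝ] ℝ) hinj
    hrank).toContinuousLinearEquiv, ?_⟩
  ext v w
  rfl

/-- The solution `X` of `B X = β` depends smoothly on the nondegenerate form `B` and on `β`. -/
theorem contDiffAt_solution {B : E → E →L[ℝ] E →L[ℝ] ℝ} {β : E → E →L[ℝ] ℝ} {X : E → E} {y : E}
    (hB : ContDiffAt ℝ ∞ B y) (hβ : ContDiffAt ℝ ∞ β y)
    (hnd : ∀ v, (∀ w, B y v w = 0) → v = 0) (hX : ∀ᶠ z in 𝓝 y, B z (X z) = β z) :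
    ContDiffAt ℝ ∞ X y := by
  obtain ⟨e, he⟩ := exists_equiv_of_nondegenerate hnd
  have h1 : ContDiffAt ℝ ∞ ContinuousLinearMap.inverse (B y) := by
    rw [← he]
    exact contDiffAt_map_inverse e
  refine ((h1.comp y hB).clm_apply hβ).congr_of_eventuallyEq ?_
  have h2 : ∀ᶠ z in 𝓝 y, B z ∈ Set.range ((↑) : (E ≃L[ℝ] (E →L[ℝ] ℝ)) → E →L[ℝ] E →L[ℝ] ℝ) := by
    refine hB.continuousAt.preimage_mem_nhds ?_
    rw [← he]
    exact ContinuousLinearEquiv.nhds e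
  filter_upwards [h2, hX] with z hz hXz
  obtain ⟨e', he'⟩ := hz
  rw [Function.comp_apply, ← hXz, ← he', ContinuousLinearMap.inverse_equiv]
  simp

variable {H : Type*} [TopologicalSpace H] (I : ModelWithCorners ℝ E H)
  {M : Type*} [TopologicalSpace M] [ChartedSpace H M]

theorem twoForm_sub_left (Ω : E [⋀^Fin 2]→L[ℝ] ℝ) (u v w : E) :
    Ω ![u - v, w] = Ω ![u, w] - Ω ![v, w] := by
  simp only [← bilinearCLM_apply]
  rw [map_sub]
  rfl

theorem twoForm_smul_left (Ω : E [⋀^Fin 2]→L[ℝ] ℝ) (c : ℝ) (v w : E) :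
    Ω ![c • v, w] = c * Ω ![v, w] := by
  simp only [← bilinearCLM_apply]
  rw [map_smul]
  rfl

theorem twoForm_self (Ω : E [⋀^Fin 2]→L[ℝ] ℝ) (v : E) : Ω ![v, v] = 0 := by
  linarith [twoForm_swap Ω v v]

theorem hamiltonianField_eq {Ω : DForm I M 2} (h : M → ℝ) (x : M)
    (hΩ : ∀ v : TangentSpace I x, (∀ w, Ω x ![v, w] = 0) → v = 0) (v : TangentSpace I x)
    (hv : ∀ w, Ω x ![v, w] = - differential I h x w) : hamiltonianField I Ω h x = v := by
  rw [← sub_eq_zero]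
  apply hΩ
  intro w
  refine (twoForm_sub_left (E := E) (Ω x) _ _ _).trans ?_
  exact sub_eq_zero.2 ((hamiltonianField_spec I h x hΩ w).trans (hv w).symm)

variable [I.Boundaryless] [IsManifold I ∞ M] {I}

theorem formInChart_hamiltonianField {Ω : DForm I M 2} (hΩ : IsSymplectic I Ω) {h : M → ℝ}
    (hh : ContMDiff I 𝓘(ℝ, ℝ) ∞ h) {x₀ : M} {y : E} (hy : y ∈ (extChartAt I x₀).target) (w : E) :
    formInChart I Ω x₀ y ![fieldInChart I (hamiltonianField I Ω h) x₀ y, w] =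
      - fderiv ℝ (h ∘ (extChartAt I x₀).symm) y w := by
  rw [fderiv_function_inChart I hy (hh.mdifferentiableAt (by simp)),
    ← hamiltonianField_spec I h _ (hΩ.nondegenerate _)]
  change Ω _ (fun i => mfderiv 𝓘(ℝ, E) I (extChartAt I x₀).symm y
    ((![fieldInChart I (hamiltonianField I Ω h) x₀ y, w] : Fin 2 → E) i)) = _
  congr 1
  funext i
  fin_cases i
  · exact mfderiv_symm_fieldInChart I _ hy
  · rfl

theorem IsSymplectic.isSmoothField_hamiltonianField {Ω : DForm I M 2} (hΩ : IsSymplectic I Ω)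
    {h : M → ℝ} (hh : ContMDiff I 𝓘(ℝ, ℝ) ∞ h) :
    IsSmoothField I (hamiltonianField I Ω h) := by
  rw [isSmoothField_iff]
  intro x
  have hy := mem_extChartAt_target (I := I) x
  refine contDiffAt_solution (B := fun y => bilinearCLM E (formInChart I Ω x y))
    (β := fun y => - fderiv ℝ (h ∘ (extChartAt I x).symm) y)
    (ContDiffAt.comp (extChartAt I x x) (g := bilinearCLM E)
      (ContinuousLinearMap.contDiff _).contDiffAt (hΩ.smooth.contDiffAt hy))
    ((contDiffAt_function_inChart I hh hy).fderiv_right (by simp)).neg ?_ ?_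
  · intro v hv
    refine hΩ.nondegenerate x v fun w => ?_
    refine Eq.trans ?_ (hv w)
    exact (formInChart_self I Ω x _).symm.trans (bilinearCLM_apply _ _ _).symm
  · filter_upwards [(isOpen_extChartAt_target x).mem_nhds hy] with y hy
    ext w
    rw [bilinearCLM_apply, formInChart_hamiltonianField hΩ hh hy]
    rfl

theorem extD_interiorProd_of_liouville {Ω : DForm I M 2} (hΩ : IsSymplectic I Ω) {D : VField I M}
    (hD : ∀ m, lieD I D Ω m = Ω m) (x : M) : extD I (interiorProd I D Ω) x = Ω x := by
  have h1 : interiorProd I D (extD I Ω) x = 0 := by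
    ext v
    change extD I Ω x (Matrix.vecCons (D x) v) = 0
    rw [hΩ.closed x]
    rfl
  have h2 := hD x
  unfold lieD at h2
  rwa [h1, add_zero] at h2

theorem lieBracket_hamiltonianField {Ω : DForm I M 2} (hΩ : IsSymplectic I Ω) {D : VField I M}
    (hDs : IsSmoothField I D) (hD : ∀ m, lieD I D Ω m = Ω m) {h : M → ℝ}
    (hh : ContMDiff I 𝓘(ℝ, ℝ) ∞ h) {Λ : ℝ} (hΛ : ∀ m, differential I h m (D m) = Λ * h m) (x : M) :
    fderiv ℝ (fieldInChart I (hamiltonianField I Ω h) x) (extChartAt I x x)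
        (fieldInChart I D x (extChartAt I x x)) -
      fderiv ℝ (fieldInChart I D x) (extChartAt I x x)
        (fieldInChart I (hamiltonianField I Ω h) x (extChartAt I x x)) =
      (Λ - 1) • fieldInChart I (hamiltonianField I Ω h) x (extChartAt I x x) := by
  have hy := mem_extChartAt_target (I := I) x
  have htarget := (isOpen_extChartAt_target (I := I) x).mem_nhds hy
  refine lieBracket_hamiltonian_flat (Ω := formInChart I Ω x) (f := h ∘ (extChartAt I x).symm)
    ((hΩ.smooth.contDiffAt hy).differentiableAt (by simp))
    ((hDs.contDiffAt hy).differentiableAt (by simp))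
    (((hΩ.isSmoothField_hamiltonianField hh).contDiffAt hy).differentiableAt (by simp))
    ((contDiffAt_function_inChart I hh hy).of_le two_le_infty) ?_ ?_ ?_ ?_ ?_
  · ext v
    rw [← extD_apply, hΩ.closed x]
    rfl
  · have hev : formInChart I (interiorProd I D Ω) x =ᶠ[𝓝 (extChartAt I x x)]
        fun y => (formInChart I Ω x y).curryLeft (fieldInChart I D x y) := by
      filter_upwards [htarget] with y hy using formInChart_interiorProd I D Ω hy
    ext v
    rw [← hev.extDeriv_eq, ← extD_apply, extD_interiorProd_of_liouville hΩ hD, formInChart_self]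
  · filter_upwards [htarget] with y hy w using formInChart_hamiltonianField hΩ hh hy w
  · filter_upwards [htarget] with y hy
    rw [fderiv_function_inChart I hy (hh.mdifferentiableAt (by simp)),
      mfderiv_symm_fieldInChart I D hy, hΛ]
    rfl
  · intro v hv
    refine hΩ.nondegenerate x v fun w => ?_
    exact (formInChart_self I Ω x _).symm.trans (hv w)

end Hamiltonian

section Products

variable {E : Type*} [NormedAddCommGroup E] [NormedSpace ℝ E] [FiniteDimensional ℝ E]
  {H : Type*} [TopologicalSpace H] (I : ModelWithCorners ℝ E H) [I.Boundaryless]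
  {M : Type*} [TopologicalSpace M] [ChartedSpace H M] [IsManifold I ∞ M] {k : ℕ}

theorem eq_fieldInChart {X : VField I M} {x₀ : M} {y : E} (hy : y ∈ (extChartAt I x₀).target)
    {w : E} (hw : mfderiv 𝓘(ℝ, E) I (extChartAt I x₀).symm y w = X ((extChartAt I x₀).symm y)) :
    fieldInChart I X x₀ y = w := by
  unfold fieldInChart
  rw [← hw]
  exact mfderiv_extChartAt_mfderiv_symm I hy w

theorem mem_target_lifted {x₀ : LiftedSpace M k} {z : E × (Fin k → ℝ) × (Fin k → ℝ)} :
    z ∈ (extChartAt (liftedModel I k) x₀).target ↔ z.1 ∈ (extChartAt I x₀.1).target := by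
  rw [extChartAt_prod, extChartAt_prod]
  simp only [PartialEquiv.prod_target, Set.mem_prod, extChartAt_model_space_eq_id,
    PartialEquiv.refl_target, Set.mem_univ, and_true]

theorem extChartAt_lifted_symm (x₀ : LiftedSpace M k) (z : E × (Fin k → ℝ) × (Fin k → ℝ)) :
    (extChartAt (liftedModel I k) x₀).symm z = ((extChartAt I x₀.1).symm z.1, z.2) := by
  rw [extChartAt_prod, extChartAt_prod]
  rfl

theorem mfderiv_extChartAt_lifted_symm {x₀ : LiftedSpace M k}
    {z : E × (Fin k → ℝ) × (Fin k → ℝ)} (hz : z.1 ∈ (extChartAt I x₀.1).target)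
    (v : E × (Fin k → ℝ) × (Fin k → ℝ)) :
    (mfderiv 𝓘(ℝ, E × (Fin k → ℝ) × (Fin k → ℝ)) (liftedModel I k)
      (extChartAt (liftedModel I k) x₀).symm z v : E × (Fin k → ℝ) × (Fin k → ℝ)) =
      (mfderiv 𝓘(ℝ, E) I (extChartAt I x₀.1).symm z.1 v.1, v.2) := by
  have h1 : HasMFDerivAt 𝓘(ℝ, E × (Fin k → ℝ) × (Fin k → ℝ)) 𝓘(ℝ, E)
      (fun z : E × (Fin k → ℝ) × (Fin k → ℝ) => z.1) z (ContinuousLinearMap.fst ℝ E ((Fin k → ℝ) × (Fin k → ℝ))) :=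
    hasMFDerivAt_iff_hasFDerivAt.2 hasFDerivAt_fst
  have h2 : HasMFDerivAt 𝓘(ℝ, E × (Fin k → ℝ) × (Fin k → ℝ)) 𝓘(ℝ, Fin k → ℝ)
      (fun z : E × (Fin k → ℝ) × (Fin k → ℝ) => z.2.1) z
      ((ContinuousLinearMap.fst ℝ (Fin k → ℝ) (Fin k → ℝ)).comp
        (ContinuousLinearMap.snd ℝ E ((Fin k → ℝ) × (Fin k → ℝ)))) :=
    hasMFDerivAt_iff_hasFDerivAt.2 (hasFDerivAt_fst.comp z hasFDerivAt_snd)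
  have h3 : HasMFDerivAt 𝓘(ℝ, E × (Fin k → ℝ) × (Fin k → ℝ)) 𝓘(ℝ, Fin k → ℝ)
      (fun z : E × (Fin k → ℝ) × (Fin k → ℝ) => z.2.2) z
      ((ContinuousLinearMap.snd ℝ (Fin k → ℝ) (Fin k → ℝ)).comp
        (ContinuousLinearMap.snd ℝ E ((Fin k → ℝ) × (Fin k → ℝ)))) :=
    hasMFDerivAt_iff_hasFDerivAt.2 (hasFDerivAt_snd.comp z hasFDerivAt_snd)
  have h4 := (mdifferentiableAt_extChartAt_symm I hz).hasMFDerivAt.comp z h1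
  have h5 := h4.prodMk (h2.prodMk h3)
  have h6 : ((extChartAt (liftedModel I k) x₀).symm : E × (Fin k → ℝ) × (Fin k → ℝ) → _) =
      fun z => ((extChartAt I x₀.1).symm z.1, z.2.1, z.2.2) :=
    funext fun z => extChartAt_lifted_symm I x₀ z
  rw [h6]
  exact congrArg (fun L => L v) h5.mfderiv

theorem mem_target_param {x₀ : ParamSpace M k} {z : E × (Fin k → ℝ)} :
    z ∈ (extChartAt (paramModel I k) x₀).target ↔ z.1 ∈ (extChartAt I x₀.1).target := by
  rw [extChartAt_prod]
  simp only [PartialEquiv.prod_target, Set.mem_prod, extChartAt_model_space_eq_id,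
    PartialEquiv.refl_target, Set.mem_univ, and_true]

theorem extChartAt_param_symm (x₀ : ParamSpace M k) (z : E × (Fin k → ℝ)) :
    (extChartAt (paramModel I k) x₀).symm z = ((extChartAt I x₀.1).symm z.1, z.2) := by
  rw [extChartAt_prod]
  rfl

theorem mfderiv_extChartAt_param_symm {x₀ : ParamSpace M k}
    {z : E × (Fin k → ℝ)} (hz : z.1 ∈ (extChartAt I x₀.1).target) (v : E × (Fin k → ℝ)) :
    (mfderiv 𝓘(ℝ, E × (Fin k → ℝ)) (paramModel I k)
      (extChartAt (paramModel I k) x₀).symm z v : E × (Fin k → ℝ)) =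
      (mfderiv 𝓘(ℝ, E) I (extChartAt I x₀.1).symm z.1 v.1, v.2) := by
  have h1 : HasMFDerivAt 𝓘(ℝ, E × (Fin k → ℝ)) 𝓘(ℝ, E)
      (fun z : E × (Fin k → ℝ) => z.1) z (ContinuousLinearMap.fst ℝ E (Fin k → ℝ)) :=
    hasMFDerivAt_iff_hasFDerivAt.2 hasFDerivAt_fst
  have h2 : HasMFDerivAt 𝓘(ℝ, E × (Fin k → ℝ)) 𝓘(ℝ, Fin k → ℝ)
      (fun z : E × (Fin k → ℝ) => z.2) z (ContinuousLinearMap.snd ℝ E (Fin k → ℝ)) :=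
    hasMFDerivAt_iff_hasFDerivAt.2 hasFDerivAt_snd
  have h4 := (mdifferentiableAt_extChartAt_symm I hz).hasMFDerivAt.comp z h1
  have h5 := h4.prodMk h2
  have h6 : ((extChartAt (paramModel I k) x₀).symm : E × (Fin k → ℝ) → _) =
      fun z => ((extChartAt I x₀.1).symm z.1, z.2) :=
    funext fun z => extChartAt_param_symm I x₀ z
  rw [h6]
  exact congrArg (fun L => L v) h5.mfderiv

theorem mfderiv_fst_lifted (x : LiftedSpace M k) (v : E × (Fin k → ℝ) × (Fin k → ℝ)) :
    (mfderiv (liftedModel I k) I Prod.fst x v : E) = v.1 := by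
  exact congrArg (fun L => L v) (mfderiv_fst (I := I)
    (I' := 𝓘(ℝ, Fin k → ℝ).prod 𝓘(ℝ, Fin k → ℝ)) (x := x))

theorem differential_param_coord (x : LiftedSpace M k) (i : Fin k)
    (v : E × (Fin k → ℝ) × (Fin k → ℝ)) :
    differential (liftedModel I k) (fun y : LiftedSpace M k => y.2.1 i) x v = v.2.1 i := by
  have h1 := hasMFDerivAt_snd (I := I) (I' := 𝓘(ℝ, Fin k → ℝ).prod 𝓘(ℝ, Fin k → ℝ)) x
  have h2 := hasMFDerivAt_fst (I := 𝓘(ℝ, Fin k → ℝ)) (I' := 𝓘(ℝ, Fin k → ℝ)) x.2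
  have h3 := (ContinuousLinearMap.proj (R := ℝ) (φ := fun _ : Fin k => ℝ) i).hasMFDerivAt
    (x := x.2.1)
  exact congrArg (fun L => L v) (h3.comp x (h2.comp x h1)).mfderiv

theorem differential_momentum_coord (x : LiftedSpace M k) (i : Fin k)
    (v : E × (Fin k → ℝ) × (Fin k → ℝ)) :
    differential (liftedModel I k) (fun y : LiftedSpace M k => y.2.2 i) x v = v.2.2 i := by
  have h1 := hasMFDerivAt_snd (I := I) (I' := 𝓘(ℝ, Fin k → ℝ).prod 𝓘(ℝ, Fin k → ℝ)) x
  have h2 := hasMFDerivAt_snd (I := 𝓘(ℝ, Fin k → ℝ)) (I' := 𝓘(ℝ, Fin k → ℝ)) x.2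
  have h3 := (ContinuousLinearMap.proj (R := ℝ) (φ := fun _ : Fin k => ℝ) i).hasMFDerivAt
    (x := x.2.2)
  exact congrArg (fun L => L v) (h3.comp x (h2.comp x h1)).mfderiv

theorem liftedForm_apply (Ω : DForm I M 2) (x : LiftedSpace M k)
    (u v : E × (Fin k → ℝ) × (Fin k → ℝ)) :
    liftedForm I k Ω x ![u, v] =
      Ω x.1 ![u.1, v.1] + ∑ i, (u.2.1 i * v.2.2 i - v.2.1 i * u.2.2 i) := by
  have h1 : pullbackForm (liftedModel I k) I Prod.fst Ω x ![u, v] = Ω x.1 ![u.1, v.1] := by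
    change Ω x.1 (fun i => mfderiv (liftedModel I k) I Prod.fst x
      ((![u, v] : Fin 2 → E × (Fin k → ℝ) × (Fin k → ℝ)) i)) = _
    congr 1
    funext i
    fin_cases i
    · exact mfderiv_fst_lifted I x u
    · exact mfderiv_fst_lifted I x v
  have h2 : (∑ i, wedgeCovectors (liftedModel I k)
      (differential (liftedModel I k) (fun y : LiftedSpace M k => y.2.1 i) x)
      (differential (liftedModel I k) (fun y : LiftedSpace M k => y.2.2 i) x)) ![u, v] =
      ∑ i, (u.2.1 i * v.2.2 i - v.2.1 i * u.2.2 i) := by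
    rw [ContinuousAlternatingMap.sum_apply]
    refine Finset.sum_congr rfl fun i _ => ?_
    refine (wedgeCovectors_apply (liftedModel I k) _ _ u v).trans ?_
    exact congrArg₂ (· - ·)
      (congrArg₂ (· * ·) (differential_param_coord I x i u) (differential_momentum_coord I x i v))
      (congrArg₂ (· * ·) (differential_param_coord I x i v) (differential_momentum_coord I x i u))
  exact congrArg₂ (· + ·) h1 h2

theorem formInChart_liftedForm (Ω : DForm I M 2) {x₀ : LiftedSpace M k}
    {z : E × (Fin k → ℝ) × (Fin k → ℝ)} (hz : z.1 ∈ (extChartAt I x₀.1).target)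
    (u v : E × (Fin k → ℝ) × (Fin k → ℝ)) :
    formInChart (liftedModel I k) (liftedForm I k Ω) x₀ z ![u, v] =
      formInChart I Ω x₀.1 z.1 ![u.1, v.1] + ∑ i, (u.2.1 i * v.2.2 i - v.2.1 i * u.2.2 i) := by
  have h0 : formInChart (liftedModel I k) (liftedForm I k Ω) x₀ z ![u, v] =
      liftedForm I k Ω ((extChartAt (liftedModel I k) x₀).symm z)
        ![(mfderiv 𝓘(ℝ, E) I (extChartAt I x₀.1).symm z.1 u.1, u.2),
          (mfderiv 𝓘(ℝ, E) I (extChartAt I x₀.1).symm z.1 v.1, v.2)] := by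
    change liftedForm I k Ω _ (fun i => mfderiv 𝓘(ℝ, E × (Fin k → ℝ) × (Fin k → ℝ))
      (liftedModel I k) (extChartAt (liftedModel I k) x₀).symm z
      ((![u, v] : Fin 2 → E × (Fin k → ℝ) × (Fin k → ℝ)) i)) = _
    congr 1
    funext i
    fin_cases i
    · exact mfderiv_extChartAt_lifted_symm I hz u
    · exact mfderiv_extChartAt_lifted_symm I hz v
  rw [h0, liftedForm_apply, extChartAt_lifted_symm]
  congr 1
  change _ = Ω _ (fun i => mfderiv 𝓘(ℝ, E) I (extChartAt I x₀.1).symm z.1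
      ((![u.1, v.1] : Fin 2 → E) i))
  congr 1
  funext i
  fin_cases i <;> rfl

theorem isSmoothForm_liftedForm {Ω : DForm I M 2} (hΩ : IsSmoothForm I Ω) :
    IsSmoothForm (liftedModel I k) (liftedForm I k Ω) := by
  intro x₀ z hz
  have hz' := (mem_target_lifted I).1 hz
  let C : (E × (Fin k → ℝ) × (Fin k → ℝ)) [⋀^Fin 2]→L[ℝ] ℝ :=
    liftedForm I k (fun _ => 0) x₀
  have hC : ∀ u v : E × (Fin k → ℝ) × (Fin k → ℝ), C ![u, v] =
      ∑ i, (u.2.1 i * v.2.2 i - v.2.1 i * u.2.2 i) := fun u v =>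
    (liftedForm_apply I (fun _ => 0) x₀ u v).trans (zero_add _)
  have h1 : ContDiffAt ℝ ∞ (fun z : E × (Fin k → ℝ) × (Fin k → ℝ) =>
      (ContinuousAlternatingMap.compContinuousLinearMapCLM
        (ContinuousLinearMap.fst ℝ E ((Fin k → ℝ) × (Fin k → ℝ))) :
        E [⋀^Fin 2]→L[ℝ] ℝ →L[ℝ] (E × (Fin k → ℝ) × (Fin k → ℝ)) [⋀^Fin 2]→L[ℝ] ℝ)
        (formInChart I Ω x₀.1 z.1) + C) z :=
    ((ContinuousLinearMap.contDiff _).contDiffAt.comp z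
      ((hΩ.contDiffAt hz').comp z contDiffAt_fst)).add contDiffAt_const
  refine (h1.congr_of_eventuallyEq ?_).contDiffWithinAt
  filter_upwards [(isOpen_extChartAt_target x₀).mem_nhds hz] with y hy
  ext w
  have hw : w = ![w 0, w 1] := by ext i : 1; fin_cases i <;> rfl
  rw [hw, formInChart_liftedForm I Ω ((mem_target_lifted I).1 hy), ← hC]
  change _ = formInChart I Ω x₀.1 y.1 (fun i => ((![w 0, w 1] : Fin 2 → _) i).1) + C ![w 0, w 1]
  congr 2
  funext i
  fin_cases i <;> rfl

theorem liftedForm_nondegenerate {Ω : DForm I M 2}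
    (hΩ : ∀ (x : M) (v : TangentSpace I x), (∀ w, Ω x ![v, w] = 0) → v = 0)
    (x : LiftedSpace M k) (v : TangentSpace (liftedModel I k) x)
    (hv : ∀ w, liftedForm I k Ω x ![v, w] = 0) : v = 0 := by
  have hv' : ∀ w : E × (Fin k → ℝ) × (Fin k → ℝ), Ω x.1 ![v.1, w.1] +
      ∑ i, (v.2.1 i * w.2.2 i - w.2.1 i * v.2.2 i) = 0 := fun w =>
    (liftedForm_apply I Ω x v w).symm.trans (hv w)
  have h0 : Ω x.1 ![v.1, (0 : E)] = 0 :=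
    (twoForm_swap (E := E) (Ω x.1) v.1 0).trans (by
      rw [neg_eq_zero]
      refine Eq.trans ?_ (twoForm_smul_left (E := E) (Ω x.1) 0 0 v.1) |>.trans (zero_mul _)
      rw [zero_smul])
  have h1 : v.1 = 0 := by
    refine hΩ x.1 v.1 fun w => ?_
    simpa using hv' (w, 0, 0)
  have h2 : v.2.1 = 0 := by
    funext i
    have h := hv' (0, 0, Pi.single i 1)
    rw [h0] at h
    simpa [Pi.single_apply] using h
  have h3 : v.2.2 = 0 := by
    funext i
    have h := hv' (0, Pi.single i 1, 0)
    rw [h0] at h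
    simpa [Pi.single_apply] using h
  exact Prod.ext h1 (Prod.ext h2 h3)

theorem fieldInChart_lifted {X : VField (liftedModel I k) (LiftedSpace M k)}
    {x₀ : LiftedSpace M k} {z : E × (Fin k → ℝ) × (Fin k → ℝ)}
    (hz : z.1 ∈ (extChartAt I x₀.1).target) {w : E} {c : (Fin k → ℝ) × (Fin k → ℝ)}
    (hX : X ((extChartAt (liftedModel I k) x₀).symm z) =
      ((mfderiv 𝓘(ℝ, E) I (extChartAt I x₀.1).symm z.1 w : E), c)) :
    fieldInChart (liftedModel I k) X x₀ z = (w, c) :=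
  eq_fieldInChart (liftedModel I k) ((mem_target_lifted I).2 hz)
    ((mfderiv_extChartAt_lifted_symm I hz (w, c)).trans hX.symm)

theorem fieldInChart_param {X : VField (paramModel I k) (ParamSpace M k)}
    {x₀ : ParamSpace M k} {z : E × (Fin k → ℝ)}
    (hz : z.1 ∈ (extChartAt I x₀.1).target) {w : E} {c : Fin k → ℝ}
    (hX : X ((extChartAt (paramModel I k) x₀).symm z) =
      ((mfderiv 𝓘(ℝ, E) I (extChartAt I x₀.1).symm z.1 w : E), c)) :
    fieldInChart (paramModel I k) X x₀ z = (w, c) :=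
  eq_fieldInChart (paramModel I k) ((mem_target_param I).2 hz)
    ((mfderiv_extChartAt_param_symm I hz (w, c)).trans hX.symm)

end Products

section FlatLifted

variable {E : Type*} [NormedAddCommGroup E] [NormedSpace ℝ E] {k : ℕ}

theorem twoForm_sum_left (Ω : E [⋀^Fin 2]→L[ℝ] ℝ) (c : Fin k → ℝ) (X : Fin k → E) (w : E) :
    Ω ![∑ i, c i • X i, w] = ∑ i, c i * Ω ![X i, w] := by
  simp only [← bilinearCLM_apply, map_sum, map_smul, sum_apply]
  rfl

theorem hasFDerivAt_param_coord (i : Fin k) (z : E × (Fin k → ℝ)) :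
    HasFDerivAt (fun z : E × (Fin k → ℝ) => z.2 i)
      ((ContinuousLinearMap.proj (R := ℝ) (φ := fun _ : Fin k => ℝ) i).comp
        (ContinuousLinearMap.snd ℝ E (Fin k → ℝ))) z :=
  ((ContinuousLinearMap.proj (R := ℝ) (φ := fun _ : Fin k => ℝ) i).comp
    (ContinuousLinearMap.snd ℝ E (Fin k → ℝ))).hasFDerivAt

theorem hasFDerivAt_lifted_param_coord (i : Fin k) (z : E × (Fin k → ℝ) × (Fin k → ℝ)) :
    HasFDerivAt (fun z : E × (Fin k → ℝ) × (Fin k → ℝ) => z.2.1 i)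
      ((ContinuousLinearMap.proj (R := ℝ) (φ := fun _ : Fin k => ℝ) i).comp
        ((ContinuousLinearMap.fst ℝ (Fin k → ℝ) (Fin k → ℝ)).comp
          (ContinuousLinearMap.snd ℝ E ((Fin k → ℝ) × (Fin k → ℝ))))) z :=
  ((ContinuousLinearMap.proj (R := ℝ) (φ := fun _ : Fin k => ℝ) i).comp
    ((ContinuousLinearMap.fst ℝ (Fin k → ℝ) (Fin k → ℝ)).comp
      (ContinuousLinearMap.snd ℝ E ((Fin k → ℝ) × (Fin k → ℝ))))).hasFDerivAt

theorem hasFDerivAt_lifted_momentum_coord (i : Fin k) (z : E × (Fin k → ℝ) × (Fin k → ℝ)) :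
    HasFDerivAt (fun z : E × (Fin k → ℝ) × (Fin k → ℝ) => z.2.2 i)
      ((ContinuousLinearMap.proj (R := ℝ) (φ := fun _ : Fin k => ℝ) i).comp
        ((ContinuousLinearMap.snd ℝ (Fin k → ℝ) (Fin k → ℝ)).comp
          (ContinuousLinearMap.snd ℝ E ((Fin k → ℝ) × (Fin k → ℝ))))) z :=
  ((ContinuousLinearMap.proj (R := ℝ) (φ := fun _ : Fin k => ℝ) i).comp
    ((ContinuousLinearMap.snd ℝ (Fin k → ℝ) (Fin k → ℝ)).comp
      (ContinuousLinearMap.snd ℝ E ((Fin k → ℝ) × (Fin k → ℝ))))).hasFDerivAt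

theorem fderiv_coupled {X : Fin k → E → E} {z : E × (Fin k → ℝ)}
    (hX : ∀ i, DifferentiableAt ℝ (X i) z.1) (v : E × (Fin k → ℝ)) :
    fderiv ℝ (fun z : E × (Fin k → ℝ) => (∑ i, z.2 i • X i z.1, (0 : Fin k → ℝ))) z v =
      (∑ i, (z.2 i • fderiv ℝ (X i) z.1 v.1 + v.2 i • X i z.1), 0) := by
  have h2 : ∀ i, HasFDerivAt (fun z : E × (Fin k → ℝ) => X i z.1)
      ((fderiv ℝ (X i) z.1).comp (ContinuousLinearMap.fst ℝ E (Fin k → ℝ))) z := fun i =>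
    (hX i).hasFDerivAt.comp z hasFDerivAt_fst
  have h3 := (HasFDerivAt.fun_sum (u := Finset.univ) fun i _ => (hasFDerivAt_param_coord i z).smul (h2 i)).prodMk
    (hasFDerivAt_const (0 : Fin k → ℝ) z)
  have h4 := congrArg (fun L => L v) h3.fderiv
  refine h4.trans ?_
  simp

theorem fderiv_lifted {X : Fin k → E → E} {g : Fin k → E → ℝ}
    {z : E × (Fin k → ℝ) × (Fin k → ℝ)} (hX : ∀ i, DifferentiableAt ℝ (X i) z.1)
    (hg : ∀ i, DifferentiableAt ℝ (g i) z.1) (v : E × (Fin k → ℝ) × (Fin k → ℝ)) :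
    fderiv ℝ (fun z : E × (Fin k → ℝ) × (Fin k → ℝ) =>
      (∑ i, z.2.1 i • X i z.1, (0 : Fin k → ℝ), fun i => g i z.1)) z v =
      (∑ i, (z.2.1 i • fderiv ℝ (X i) z.1 v.1 + v.2.1 i • X i z.1), 0,
        fun i => fderiv ℝ (g i) z.1 v.1) := by
  have h2 : ∀ i, HasFDerivAt (fun z : E × (Fin k → ℝ) × (Fin k → ℝ) => X i z.1)
      ((fderiv ℝ (X i) z.1).comp
        (ContinuousLinearMap.fst ℝ E ((Fin k → ℝ) × (Fin k → ℝ)))) z := fun i =>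
    (hX i).hasFDerivAt.comp z hasFDerivAt_fst
  have h3 : ∀ i, HasFDerivAt (fun z : E × (Fin k → ℝ) × (Fin k → ℝ) => g i z.1)
      ((fderiv ℝ (g i) z.1).comp
        (ContinuousLinearMap.fst ℝ E ((Fin k → ℝ) × (Fin k → ℝ)))) z := fun i =>
    (hg i).hasFDerivAt.comp z hasFDerivAt_fst
  have h4 := (HasFDerivAt.fun_sum (u := Finset.univ) fun i _ => (hasFDerivAt_lifted_param_coord i z).smul (h2 i)).prodMk
    ((hasFDerivAt_const (0 : Fin k → ℝ) z).prodMk (hasFDerivAt_pi.2 h3))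
  have h5 := congrArg (fun L => L v) h4.fderiv
  refine h5.trans ?_
  simp

theorem fderiv_paramScaling {D : E → E} {Λ : Fin k → ℝ} {z : E × (Fin k → ℝ)}
    (hD : DifferentiableAt ℝ D z.1) (v : E × (Fin k → ℝ)) :
    fderiv ℝ (fun z : E × (Fin k → ℝ) => (D z.1, fun i => (1 - Λ i) * z.2 i)) z v =
      (fderiv ℝ D z.1 v.1, fun i => (1 - Λ i) * v.2 i) := by
  have h2 : HasFDerivAt (fun z : E × (Fin k → ℝ) => D z.1)
      ((fderiv ℝ D z.1).comp (ContinuousLinearMap.fst ℝ E (Fin k → ℝ))) z :=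
    hD.hasFDerivAt.comp z hasFDerivAt_fst
  exact congrArg (fun L => L v)
    (h2.prodMk (hasFDerivAt_pi.2 fun i => (hasFDerivAt_param_coord i z).const_mul (1 - Λ i))).fderiv

theorem fderiv_liftedScaling {D : E → E} {Λ : Fin k → ℝ} {z : E × (Fin k → ℝ) × (Fin k → ℝ)}
    (hD : DifferentiableAt ℝ D z.1) (v : E × (Fin k → ℝ) × (Fin k → ℝ)) :
    fderiv ℝ (fun z : E × (Fin k → ℝ) × (Fin k → ℝ) =>
      (D z.1, (fun i => (1 - Λ i) * z.2.1 i), fun i => Λ i * z.2.2 i)) z v =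
      (fderiv ℝ D z.1 v.1, (fun i => (1 - Λ i) * v.2.1 i), fun i => Λ i * v.2.2 i) := by
  have h2 : HasFDerivAt (fun z : E × (Fin k → ℝ) × (Fin k → ℝ) => D z.1)
      ((fderiv ℝ D z.1).comp (ContinuousLinearMap.fst ℝ E ((Fin k → ℝ) × (Fin k → ℝ)))) z :=
    hD.hasFDerivAt.comp z hasFDerivAt_fst
  exact congrArg (fun L => L v)
    (h2.prodMk ((hasFDerivAt_pi.2 fun i => (hasFDerivAt_lifted_param_coord i z).const_mul (1 - Λ i)).prodMk
      (hasFDerivAt_pi.2 fun i => (hasFDerivAt_lifted_momentum_coord i z).const_mul (Λ i)))).fderiv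

theorem sum_bracket {A : E →L[ℝ] E} {B : Fin k → E →L[ℝ] E} {X : Fin k → E} {d : E}
    {Λ : Fin k → ℝ} (a : Fin k → ℝ) (h : ∀ i, B i d - A (X i) = (Λ i - 1) • X i) :
    ∑ i, (a i • B i d + ((1 - Λ i) * a i) • X i) = A (∑ i, a i • X i) := by
  rw [map_sum]
  refine Finset.sum_congr rfl fun i _ => ?_
  rw [map_smul, eq_add_of_sub_eq (h i)]
  module

end FlatLifted

section LiftedDynamics

variable {E : Type*} [NormedAddCommGroup E] [NormedSpace ℝ E] [FiniteDimensional ℝ E]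
  {H : Type*} [TopologicalSpace H] {I : ModelWithCorners ℝ E H} [I.Boundaryless]
  {M : Type*} [TopologicalSpace M] [ChartedSpace H M] [IsManifold I ∞ M] {k : ℕ}

theorem extChartAt_lifted (x₀ x : LiftedSpace M k) :
    extChartAt (liftedModel I k) x₀ x = (extChartAt I x₀.1 x.1, x.2) := by
  rw [extChartAt_prod, extChartAt_prod]
  rfl

theorem extChartAt_param (x₀ x : ParamSpace M k) :
    extChartAt (paramModel I k) x₀ x = (extChartAt I x₀.1 x.1, x.2) := by
  rw [extChartAt_prod]
  rfl

theorem contMDiff_liftedHamiltonian {h : Fin k → M → ℝ} (hh : ∀ j, ContMDiff I 𝓘(ℝ, ℝ) ∞ (h j)) :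
    ContMDiff (liftedModel I k) 𝓘(ℝ, ℝ) ∞ (liftedHamiltonian h) := by
  unfold liftedHamiltonian coupledHamiltonian
  refine contMDiff_finsetSum fun i _ => ContMDiff.mul ?_ ((hh i).comp contMDiff_fst)
  exact (ContinuousLinearMap.proj (R := ℝ) (φ := fun _ : Fin k => ℝ) i).contMDiff.comp
    (contMDiff_fst.comp contMDiff_snd)

theorem contMDiff_coupledHamiltonian {h : Fin k → M → ℝ} (hh : ∀ j, ContMDiff I 𝓘(ℝ, ℝ) ∞ (h j))
    (a : Fin k → ℝ) : ContMDiff I 𝓘(ℝ, ℝ) ∞ (coupledHamiltonian h a) := by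
  unfold coupledHamiltonian
  exact contMDiff_finsetSum fun i _ => contMDiff_const.mul (hh i)

theorem hasFDerivAt_inChart_self {f : M → ℝ} (hf : ContMDiff I 𝓘(ℝ, ℝ) ∞ f) (x : M) :
    HasFDerivAt (f ∘ (extChartAt I x).symm) (differential I f x : E →L[ℝ] ℝ)
      (extChartAt I x x) := by
  have h1 := ((contDiffAt_function_inChart I hf (mem_extChartAt_target x)).differentiableAt
    (by simp)).hasFDerivAt
  refine h1.congr_fderiv (ContinuousLinearMap.ext fun v => ?_)
  exact fderiv_function_inChart_self I (hf.mdifferentiableAt (by simp)) v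

theorem differential_liftedHamiltonian {h : Fin k → M → ℝ}
    (hh : ∀ j, ContMDiff I 𝓘(ℝ, ℝ) ∞ (h j)) (x : LiftedSpace M k)
    (v : E × (Fin k → ℝ) × (Fin k → ℝ)) :
    differential (liftedModel I k) (liftedHamiltonian h) x v =
      ∑ i, (x.2.1 i * differential I (h i) x.1 v.1 + v.2.1 i * h i x.1) := by
  have h2 : ∀ i, HasFDerivAt
      (fun z : E × (Fin k → ℝ) × (Fin k → ℝ) => (h i ∘ (extChartAt I x.1).symm) z.1)
      ((differential I (h i) x.1 : E →L[ℝ] ℝ).comp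
        (ContinuousLinearMap.fst ℝ E ((Fin k → ℝ) × (Fin k → ℝ)))) (extChartAt I x.1 x.1, x.2) :=
    fun i => HasFDerivAt.comp (f := Prod.fst) (extChartAt I x.1 x.1, x.2)
      (hasFDerivAt_inChart_self (hh i) x.1) hasFDerivAt_fst
  have h3 := HasFDerivAt.fun_sum (u := Finset.univ) fun i _ => (hasFDerivAt_lifted_param_coord i _).mul (h2 i)
  refine (fderiv_function_inChart_self (liftedModel I k)
    ((contMDiff_liftedHamiltonian hh).mdifferentiableAt (by simp)) v).symm.trans ?_
  have h4 : liftedHamiltonian h ∘ (extChartAt (liftedModel I k) x).symm =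
      fun z : E × (Fin k → ℝ) × (Fin k → ℝ) =>
        ∑ i, z.2.1 i * (h i ∘ (extChartAt I x.1).symm) z.1 := by
    funext z
    exact congrArg (liftedHamiltonian h) (extChartAt_lifted_symm I x z)
  rw [h4, extChartAt_lifted]
  refine (congrArg (fun L => L v) h3.fderiv).trans ?_
  simp only [sum_apply]
  refine Finset.sum_congr rfl fun i _ => ?_
  change x.2.1 i * differential I (h i) x.1 v.1 + h i ((extChartAt I x.1).symm _) * v.2.1 i = _
  rw [extChartAt_to_inv, mul_comm (h i x.1)]

theorem differential_coupledHamiltonian {h : Fin k → M → ℝ}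
    (hh : ∀ j, ContMDiff I 𝓘(ℝ, ℝ) ∞ (h j)) (a : Fin k → ℝ) (m : M) (v : E) :
    differential I (coupledHamiltonian h a) m v = ∑ i, a i * differential I (h i) m v := by
  have h3 := HasFDerivAt.fun_sum (u := Finset.univ) fun i _ =>
    (hasFDerivAt_inChart_self (hh i) m).const_mul (a i)
  refine (fderiv_function_inChart_self I
    ((contMDiff_coupledHamiltonian hh a).mdifferentiableAt (by simp)) v).symm.trans ?_
  refine (congrArg (fun L => L v) h3.fderiv).trans ?_
  simp only [sum_apply]
  rfl

theorem hamiltonianField_coupled {Ω : DForm I M 2} (hΩ : IsSymplectic I Ω) {h : Fin k → M → ℝ}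
    (hh : ∀ j, ContMDiff I 𝓘(ℝ, ℝ) ∞ (h j)) (a : Fin k → ℝ) (m : M) :
    (hamiltonianField I Ω (coupledHamiltonian h a) m : E) =
      ∑ i, a i • (hamiltonianField I Ω (h i) m : E) := by
  refine hamiltonianField_eq I _ m (hΩ.nondegenerate m) _ fun w => ?_
  refine (twoForm_sum_left (E := E) (Ω m) a _ w).trans ?_
  refine Eq.trans ?_ (congrArg Neg.neg (differential_coupledHamiltonian hh a m w).symm)
  rw [← Finset.sum_neg_distrib]
  refine Finset.sum_congr rfl fun i _ => ?_
  exact (congrArg (a i * ·) (hamiltonianField_spec I (h i) m (hΩ.nondegenerate m) w)).trans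
    (mul_neg _ _)

theorem liftedHamiltonianField_eq {Ω : DForm I M 2} (hΩ : IsSymplectic I Ω) {h : Fin k → M → ℝ}
    (hh : ∀ j, ContMDiff I 𝓘(ℝ, ℝ) ∞ (h j)) (x : LiftedSpace M k) :
    (liftedHamiltonianField I Ω h x : E × (Fin k → ℝ) × (Fin k → ℝ)) =
      (∑ i, x.2.1 i • (hamiltonianField I Ω (h i) x.1 : E), 0, fun i => h i x.1) := by
  refine hamiltonianField_eq (liftedModel I k) _ x
    (liftedForm_nondegenerate I hΩ.nondegenerate x) _ fun w => ?_
  refine (liftedForm_apply I Ω x _ w).trans ?_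
  refine Eq.trans ?_ (congrArg Neg.neg (differential_liftedHamiltonian hh x w).symm)
  refine (congrArg (· + _) (twoForm_sum_left (E := E) (Ω x.1) x.2.1 _ w.1)).trans ?_
  rw [← Finset.sum_add_distrib, ← Finset.sum_neg_distrib]
  refine Finset.sum_congr rfl fun i _ => ?_
  refine (congrArg (fun r => x.2.1 i * r + _)
    (hamiltonianField_spec I (h i) x.1 (hΩ.nondegenerate x.1) w.1)).trans ?_
  change _ * - _ + (0 * _ - w.2.1 i * h i x.1) = _
  ring

theorem map_sum_smul_field {A : E →L[ℝ] E} {c : Fin k → ℝ} {X Y : Fin k → E}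
    (h : ∀ i, A (X i) = Y i) : A (∑ i, c i • X i) = ∑ i, c i • Y i := by
  rw [map_sum]
  exact Finset.sum_congr rfl fun i _ => by rw [map_smul, h]

theorem fieldInChart_liftedScaling (D : VField I M) (Λ : Fin k → ℝ) {x₀ : LiftedSpace M k}
    {z : E × (Fin k → ℝ) × (Fin k → ℝ)} (hz : z.1 ∈ (extChartAt I x₀.1).target) :
    fieldInChart (liftedModel I k) (liftedScaling I D Λ) x₀ z =
      (fieldInChart (E := E) I D x₀.1 z.1, (fun i => (1 - Λ i) * z.2.1 i),
        fun i => Λ i * z.2.2 i) := by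
  refine fieldInChart_lifted I hz ?_
  rw [extChartAt_lifted_symm, mfderiv_symm_fieldInChart I D hz]
  rfl

theorem fieldInChart_paramScaling (D : VField I M) (Λ : Fin k → ℝ) {x₀ : ParamSpace M k}
    {z : E × (Fin k → ℝ)} (hz : z.1 ∈ (extChartAt I x₀.1).target) :
    fieldInChart (paramModel I k) (paramScaling I D Λ) x₀ z =
      (fieldInChart (E := E) I D x₀.1 z.1, fun i => (1 - Λ i) * z.2 i) := by
  refine fieldInChart_param I hz ?_
  rw [extChartAt_param_symm, mfderiv_symm_fieldInChart I D hz]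
  rfl

theorem fieldInChart_liftedHamiltonianField {Ω : DForm I M 2} (hΩ : IsSymplectic I Ω)
    {h : Fin k → M → ℝ} (hh : ∀ j, ContMDiff I 𝓘(ℝ, ℝ) ∞ (h j)) {x₀ : LiftedSpace M k}
    {z : E × (Fin k → ℝ) × (Fin k → ℝ)} (hz : z.1 ∈ (extChartAt I x₀.1).target) :
    fieldInChart (liftedModel I k) (liftedHamiltonianField I Ω h) x₀ z =
      (∑ i, z.2.1 i • fieldInChart (E := E) I (hamiltonianField I Ω (h i)) x₀.1 z.1, 0,
        fun i => (h i ∘ (extChartAt I x₀.1).symm) z.1) := by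
  refine fieldInChart_lifted I hz ?_
  rw [extChartAt_lifted_symm]
  let A : E →L[ℝ] E := mfderiv 𝓘(ℝ, E) I (extChartAt I x₀.1).symm z.1
  refine (liftedHamiltonianField_eq hΩ hh _).trans ?_
  refine congrArg (fun e : E => (e, (0 : Fin k → ℝ), fun i => h i ((extChartAt I x₀.1).symm z.1)))
    (map_sum_smul_field (A := A) fun i => ?_).symm
  exact mfderiv_symm_fieldInChart I _ hz

theorem fieldInChart_paramField {Ω : DForm I M 2} (hΩ : IsSymplectic I Ω)
    {h : Fin k → M → ℝ} (hh : ∀ j, ContMDiff I 𝓘(ℝ, ℝ) ∞ (h j)) {x₀ : ParamSpace M k}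
    {z : E × (Fin k → ℝ)} (hz : z.1 ∈ (extChartAt I x₀.1).target) :
    fieldInChart (paramModel I k) (paramField I Ω h) x₀ z =
      (∑ i, z.2 i • fieldInChart (E := E) I (hamiltonianField I Ω (h i)) x₀.1 z.1, 0) := by
  refine fieldInChart_param I hz ?_
  rw [extChartAt_param_symm]
  let A : E →L[ℝ] E := mfderiv 𝓘(ℝ, E) I (extChartAt I x₀.1).symm z.1
  refine congrArg (fun e : E => (e, (0 : Fin k → ℝ)))
    ((hamiltonianField_coupled hΩ hh _ _).trans
    (map_sum_smul_field (A := A) fun i => ?_).symm)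
  exact mfderiv_symm_fieldInChart I _ hz

theorem eventually_mem_target_lifted (x : LiftedSpace M k) :
    ∀ᶠ z in 𝓝 (extChartAt (liftedModel I k) x x), z.1 ∈ (extChartAt I x.1).target := by
  filter_upwards [(isOpen_extChartAt_target (I := liftedModel I k) x).mem_nhds
    (mem_extChartAt_target x)] with z hz using (mem_target_lifted I).1 hz

theorem eventually_mem_target_param (x : ParamSpace M k) :
    ∀ᶠ z in 𝓝 (extChartAt (paramModel I k) x x), z.1 ∈ (extChartAt I x.1).target := by
  filter_upwards [(isOpen_extChartAt_target (I := paramModel I k) x).mem_nhds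
    (mem_extChartAt_target x)] with z hz using (mem_target_param I).1 hz

theorem isSmoothField_liftedScaling {D : VField I M} (hD : IsSmoothField I D) (Λ : Fin k → ℝ) :
    IsSmoothField (liftedModel I k) (liftedScaling I D Λ) := by
  rw [isSmoothField_iff]
  intro x
  refine ContDiffAt.congr_of_eventuallyEq ?_ ((eventually_mem_target_lifted x).mono fun z hz =>
    fieldInChart_liftedScaling D Λ hz)
  rw [extChartAt_lifted]
  have h1 := (hD.contDiffAt (mem_extChartAt_target x.1)).comp
    ((extChartAt I x.1 x.1, x.2) : E × (Fin k → ℝ) × (Fin k → ℝ)) contDiffAt_fst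
  exact h1.prodMk (by fun_prop)

theorem isSmoothField_paramScaling {D : VField I M} (hD : IsSmoothField I D) (Λ : Fin k → ℝ) :
    IsSmoothField (paramModel I k) (paramScaling I D Λ) := by
  rw [isSmoothField_iff]
  intro x
  refine ContDiffAt.congr_of_eventuallyEq ?_ ((eventually_mem_target_param x).mono fun z hz =>
    fieldInChart_paramScaling D Λ hz)
  rw [extChartAt_param]
  have h1 := (hD.contDiffAt (mem_extChartAt_target x.1)).comp
    ((extChartAt I x.1 x.1, x.2) : E × (Fin k → ℝ)) contDiffAt_fst
  exact h1.prodMk (by fun_prop)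

theorem isSmoothField_liftedHamiltonianField {Ω : DForm I M 2} (hΩ : IsSymplectic I Ω)
    {h : Fin k → M → ℝ} (hh : ∀ j, ContMDiff I 𝓘(ℝ, ℝ) ∞ (h j)) :
    IsSmoothField (liftedModel I k) (liftedHamiltonianField I Ω h) := by
  rw [isSmoothField_iff]
  intro x
  refine ContDiffAt.congr_of_eventuallyEq ?_ ((eventually_mem_target_lifted x).mono fun z hz =>
    fieldInChart_liftedHamiltonianField hΩ hh hz)
  rw [extChartAt_lifted]
  have h1 := fun i => ((hΩ.isSmoothField_hamiltonianField (hh i)).contDiffAt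
    (mem_extChartAt_target x.1)).comp
    ((extChartAt I x.1 x.1, x.2) : E × (Fin k → ℝ) × (Fin k → ℝ)) contDiffAt_fst
  have h2 := fun i => (contDiffAt_function_inChart I (hh i) (mem_extChartAt_target x.1)).comp
    ((extChartAt I x.1 x.1, x.2) : E × (Fin k → ℝ) × (Fin k → ℝ)) contDiffAt_fst
  refine ContDiffAt.prodMk (ContDiffAt.sum fun i _ => ContDiffAt.smul (by fun_prop) (h1 i))
    (contDiffAt_const.prodMk (contDiffAt_pi.2 h2))

theorem isSmoothField_paramField {Ω : DForm I M 2} (hΩ : IsSymplectic I Ω)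
    {h : Fin k → M → ℝ} (hh : ∀ j, ContMDiff I 𝓘(ℝ, ℝ) ∞ (h j)) :
    IsSmoothField (paramModel I k) (paramField I Ω h) := by
  rw [isSmoothField_iff]
  intro x
  refine ContDiffAt.congr_of_eventuallyEq ?_ ((eventually_mem_target_param x).mono fun z hz =>
    fieldInChart_paramField hΩ hh hz)
  rw [extChartAt_param]
  have h1 := fun i => ((hΩ.isSmoothField_hamiltonianField (hh i)).contDiffAt
    (mem_extChartAt_target x.1)).comp
    ((extChartAt I x.1 x.1, x.2) : E × (Fin k → ℝ)) contDiffAt_fst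
  exact ContDiffAt.prodMk (ContDiffAt.sum fun i _ => ContDiffAt.smul (by fun_prop) (h1 i))
    contDiffAt_const

theorem bracket_hamiltonianField_self {Ω : DForm I M 2} (hΩ : IsSymplectic I Ω) {D : VField I M}
    (hD : IsSmoothField I D) (hDΩ : ∀ m, lieD I D Ω m = Ω m) {h : M → ℝ}
    (hh : ContMDiff I 𝓘(ℝ, ℝ) ∞ h) {Λ : ℝ} (hΛ : ∀ m, differential I h m (D m) = Λ * h m) (x : M) :
    (fderiv ℝ (fieldInChart (E := E) I (hamiltonianField I Ω h) x) (extChartAt I x x) (D x) -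
      fderiv ℝ (fieldInChart (E := E) I D x) (extChartAt I x x) (hamiltonianField I Ω h x) : E) =
      (Λ - 1) • (hamiltonianField I Ω h x : E) := by
  have h1 := lieBracket_hamiltonianField hΩ hD hDΩ hh hΛ x
  rw [fieldInChart_self, fieldInChart_self] at h1
  exact h1

theorem commute_liftedHamiltonianField_liftedScaling {Ω : DForm I M 2} (hΩ : IsSymplectic I Ω)
    {D : VField I M} (hD : IsSmoothField I D) (hDΩ : ∀ m, lieD I D Ω m = Ω m) {h : Fin k → M → ℝ}
    (hh : ∀ j, ContMDiff I 𝓘(ℝ, ℝ) ∞ (h j)) {Λ : Fin k → ℝ}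
    (hΛ : ∀ j m, differential I (h j) m (D m) = Λ j * h j m) (x : LiftedSpace M k) :
    fderiv ℝ (fieldInChart (liftedModel I k) (liftedHamiltonianField I Ω h) x)
        (extChartAt (liftedModel I k) x x) (liftedScaling I D Λ x) =
      fderiv ℝ (fieldInChart (liftedModel I k) (liftedScaling I D Λ) x)
        (extChartAt (liftedModel I k) x x) (liftedHamiltonianField I Ω h x) := by
  have hx := mem_extChartAt_target (I := I) x.1
  have e1 := (eventually_mem_target_lifted x).mono fun z hz =>
    fieldInChart_liftedHamiltonianField hΩ hh hz
  have e2 := (eventually_mem_target_lifted x).mono fun z hz => fieldInChart_liftedScaling D Λ hz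
  rw [Filter.EventuallyEq.fderiv_eq e1, Filter.EventuallyEq.fderiv_eq e2, extChartAt_lifted]
  refine (fderiv_lifted (fun i => ((hΩ.isSmoothField_hamiltonianField (hh i)).contDiffAt
    hx).differentiableAt (by simp)) (fun i => (contDiffAt_function_inChart I (hh i)
    hx).differentiableAt (by simp)) _).trans (Eq.trans ?_
    ((fderiv_liftedScaling ((hD.contDiffAt hx).differentiableAt (by simp)) _).trans (congrArg
      (fun v : E × (Fin k → ℝ) × (Fin k → ℝ) =>
        (fderiv ℝ (fieldInChart (E := E) I D x.1) (extChartAt I x.1 x.1) v.1,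
          (fun i => (1 - Λ i) * v.2.1 i), fun i => Λ i * v.2.2 i))
      (liftedHamiltonianField_eq hΩ hh x))).symm)
  refine Prod.ext ?_ (Prod.ext ?_ ?_)
  · refine Eq.trans ?_ (sum_bracket x.2.1 fun i =>
      bracket_hamiltonianField_self hΩ hD hDΩ (hh i) (hΛ i) x.1)
    refine Finset.sum_congr (s₁ := (Finset.univ : Finset (Fin k))) (M := E) rfl fun i _ => ?_
    exact congrArg (fun e : E => x.2.1 i • fderiv ℝ (fieldInChart (E := E) I
      (hamiltonianField I Ω (h i)) x.1) (extChartAt I x.1 x.1) (D x.1) +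
      ((1 - Λ i) * x.2.1 i) • e) (fieldInChart_self I _ x.1)
  · funext i
    exact (mul_zero _).symm
  · funext i
    exact (fderiv_function_inChart_self I ((hh i).mdifferentiableAt (by simp)) _).trans (hΛ i x.1)

theorem commute_paramField_paramScaling {Ω : DForm I M 2} (hΩ : IsSymplectic I Ω)
    {D : VField I M} (hD : IsSmoothField I D) (hDΩ : ∀ m, lieD I D Ω m = Ω m) {h : Fin k → M → ℝ}
    (hh : ∀ j, ContMDiff I 𝓘(ℝ, ℝ) ∞ (h j)) {Λ : Fin k → ℝ}
    (hΛ : ∀ j m, differential I (h j) m (D m) = Λ j * h j m) (x : ParamSpace M k) :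
    fderiv ℝ (fieldInChart (paramModel I k) (paramField I Ω h) x)
        (extChartAt (paramModel I k) x x) (paramScaling I D Λ x) =
      fderiv ℝ (fieldInChart (paramModel I k) (paramScaling I D Λ) x)
        (extChartAt (paramModel I k) x x) (paramField I Ω h x) := by
  have hx := mem_extChartAt_target (I := I) x.1
  have e1 := (eventually_mem_target_param x).mono fun z hz => fieldInChart_paramField hΩ hh hz
  have e2 := (eventually_mem_target_param x).mono fun z hz => fieldInChart_paramScaling D Λ hz
  rw [Filter.EventuallyEq.fderiv_eq e1, Filter.EventuallyEq.fderiv_eq e2, extChartAt_param]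
  refine (fderiv_coupled (fun i => ((hΩ.isSmoothField_hamiltonianField (hh i)).contDiffAt
    hx).differentiableAt (by simp)) _).trans (Eq.trans ?_
    ((fderiv_paramScaling ((hD.contDiffAt hx).differentiableAt (by simp)) _).trans (congrArg
      (fun e : E => (fderiv ℝ (fieldInChart (E := E) I D x.1) (extChartAt I x.1 x.1) e,
          (fun i => (1 - Λ i) * (0 : Fin k → ℝ) i)))
      (hamiltonianField_coupled hΩ hh x.2 x.1))).symm)
  refine Prod.ext ?_ ?_
  · refine Eq.trans ?_ (sum_bracket x.2 fun i =>
      bracket_hamiltonianField_self hΩ hD hDΩ (hh i) (hΛ i) x.1)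
    refine Finset.sum_congr (s₁ := (Finset.univ : Finset (Fin k))) (M := E) rfl fun i _ => ?_
    exact congrArg (fun e : E => x.2 i • fderiv ℝ (fieldInChart (E := E) I
      (hamiltonianField I Ω (h i)) x.1) (extChartAt I x.1 x.1) (D x.1) +
      ((1 - Λ i) * x.2 i) • e) (fieldInChart_self I _ x.1)
  · funext i
    exact (mul_zero _).symm

end LiftedDynamics

section OneForms

variable {E : Type*} [NormedAddCommGroup E] [NormedSpace ℝ E] [FiniteDimensional ℝ E]
  {H : Type*} [TopologicalSpace H] (I : ModelWithCorners ℝ E H) [I.Boundaryless]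
  {M : Type*} [TopologicalSpace M] [ChartedSpace H M] [IsManifold I ∞ M]

theorem differential_neg_div {F ρ : M → ℝ} (hF : ContMDiff I 𝓘(ℝ, ℝ) ∞ F)
    (hρ : ContMDiff I 𝓘(ℝ, ℝ) ∞ ρ) (hρ0 : ∀ x, ρ x ≠ 0) (x : M) (v : TangentSpace I x) :
    differential I (fun y => - F y / ρ y) x v =
      (ρ x)⁻¹ ^ 2 * F x * differential I ρ x v - (ρ x)⁻¹ * differential I F x v := by
  have h1 := hasFDerivAt_inChart_self hF x
  have h2 := hasFDerivAt_inChart_self hρ x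
  have hρ0' := hρ0 ((extChartAt I x).symm (extChartAt I x x))
  have h3 : ContMDiff I 𝓘(ℝ, ℝ) ∞ (fun y => - F y / ρ y) := hF.neg.div₀ hρ hρ0
  have h4 := (h1.neg.mul ((hasDerivAt_inv (hρ0' : (ρ ∘ (extChartAt I x).symm) (extChartAt I x x) ≠ 0)).comp_hasFDerivAt
    (extChartAt I x x) h2)).fderiv
  refine (fderiv_function_inChart_self I (h3.mdifferentiableAt (by simp)) v).symm.trans
    ((congrArg (fun L => L v) h4).trans ?_)
  change - F ((extChartAt I x).symm _) * (-(ρ ((extChartAt I x).symm _) ^ 2)⁻¹ *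
    differential I ρ x v) + (ρ ((extChartAt I x).symm _))⁻¹ * - differential I F x v = _
  rw [extChartAt_to_inv]
  have := hρ0 x
  field_simp
  ring

theorem differential_inv {ρ : M → ℝ} (hρ : ContMDiff I 𝓘(ℝ, ℝ) ∞ ρ) (hρ0 : ∀ x, ρ x ≠ 0) (x : M)
    (v : TangentSpace I x) :
    differential I (fun y => (ρ y)⁻¹) x v = - ((ρ x)⁻¹ ^ 2 * differential I ρ x v) := by
  have h2 := hasFDerivAt_inChart_self hρ x
  have hρ0' := hρ0 ((extChartAt I x).symm (extChartAt I x x))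
  have h4 := ((hasDerivAt_inv (hρ0' : (ρ ∘ (extChartAt I x).symm) (extChartAt I x x) ≠ 0)).comp_hasFDerivAt
    (extChartAt I x x) h2).fderiv
  refine (fderiv_function_inChart_self I ((hρ.inv₀ hρ0).mdifferentiableAt (by simp)) v).symm.trans
    ((congrArg (fun L => L v) h4).trans ?_)
  change -(ρ ((extChartAt I x).symm _) ^ 2)⁻¹ * differential I ρ x v = _
  rw [extChartAt_to_inv]
  ring

theorem formInChart_smul {n : ℕ} (f : M → ℝ) (α : DForm I M n) (x₀ : M) :
    formInChart I (fun x => f x • α x) x₀ =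
      fun y => (f ∘ (extChartAt I x₀).symm) y • formInChart I α x₀ y := by
  funext y
  ext v
  rfl

theorem IsSmoothForm.smul {n : ℕ} {f : M → ℝ} (hf : ContMDiff I 𝓘(ℝ, ℝ) ∞ f) {α : DForm I M n}
    (hα : IsSmoothForm I α) : IsSmoothForm I (fun x => f x • α x) := by
  intro x₀ y hy
  rw [formInChart_smul]
  exact ((contDiffAt_function_inChart I hf hy).smul (hα.contDiffAt hy)).contDiffWithinAt

theorem extD_smul_oneForm {f : M → ℝ} (hf : ContMDiff I 𝓘(ℝ, ℝ) ∞ f) {α : DForm I M 1}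
    (hα : IsSmoothForm I α) (x : M) (u v : TangentSpace I x) :
    extD I (fun x => f x • α x) x ![u, v] =
      f x * extD I α x ![u, v] + differential I f x u * α x ![v] -
        differential I f x v * α x ![u] := by
  have hy := mem_extChartAt_target (I := I) x
  have h1 := (hα.contDiffAt hy).differentiableAt (by simp)
  have h2 := ((IsSmoothForm.smul I hf hα).contDiffAt hy).differentiableAt (by simp)
  have h3 := hasFDerivAt_inChart_self hf x
  have key : ∀ u v : E, fderiv ℝ (fun y => formInChart I (fun x => f x • α x) x y ![v])
      (extChartAt I x x) u = f x * fderiv ℝ (fun y => formInChart I α x y ![v]) (extChartAt I x x) u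
        + differential I f x u * α x ![v] := by
    intro u v
    have h4 : DifferentiableAt ℝ (fun y => formInChart I α x y ![v]) (extChartAt I x x) := by
      simp only [← covectorCLM_apply]
      exact ((covectorCLM E).differentiableAt.comp _ h1).clm_apply (differentiableAt_const v)
    rw [formInChart_smul]
    refine (congrArg (fun L => L u) (h3.mul h4.hasFDerivAt).fderiv).trans ?_
    change f ((extChartAt I x).symm _) * _ + formInChart I α x _ ![v] * differential I f x u = _
    rw [extChartAt_to_inv]
    have h5 : formInChart I α x (extChartAt I x x) ![v] = α x ![v] := formInChart_self I α x _
    rw [h5, mul_comm (α x _)]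
    rfl
  refine (extD_apply I _ x _).trans ((extDeriv_oneForm h2 u v).trans
    ((congrArg₂ (· - ·) (key u v) (key v u)).trans ?_))
  have h6 : extD I α x ![u, v] = _ := (extD_apply I α x _).trans (extDeriv_oneForm h1 u v)
  rw [h6]
  ring

end OneForms

section ContactReduction

variable {E : Type*} [NormedAddCommGroup E] [NormedSpace ℝ E] [FiniteDimensional ℝ E]
  {H : Type*} [TopologicalSpace H] (I : ModelWithCorners ℝ E H) [I.Boundaryless]
  {M : Type*} [TopologicalSpace M] [ChartedSpace H M] [IsManifold I ∞ M]
  {E' : Type*} [NormedAddCommGroup E'] [NormedSpace ℝ E'] [FiniteDimensional ℝ E']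
  {H' : Type*} [TopologicalSpace H'] (I' : ModelWithCorners ℝ E' H') [I'.Boundaryless]
  {D : VField I M} [ChartedSpace H' (OrbitSpace I D)] [IsManifold I' ∞ (OrbitSpace I D)]

theorem exists_eq_smul_of_surjective {A : E →L[ℝ] E'} (hA : Function.Surjective A)
    (hdim : Module.finrank ℝ E' + 1 = Module.finrank ℝ E) {d : E} (hd : d ≠ 0) (hAd : A d = 0)
    {v : E} (hv : A v = 0) : ∃ c : ℝ, v = c • d := by
  have h1 := LinearMap.finrank_range_add_finrank_ker (A : E →ₗ[ℝ] E')
  rw [LinearMap.range_eq_top.2 hA, finrank_top] at h1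
  have h2 : Module.finrank ℝ (LinearMap.ker (A : E →ₗ[ℝ] E')) = 1 := by omega
  obtain ⟨c, hc⟩ := (finrank_eq_one_iff_of_nonzero'
    (⟨d, hAd⟩ : LinearMap.ker (A : E →ₗ[ℝ] E')) (fun h => hd (congrArg Subtype.val h))).1 h2 ⟨v, hv⟩
  exact ⟨c, (congrArg Subtype.val hc).symm⟩

theorem exists_eq_smul_of_mfderiv_orbitProj (hD : IsSmoothField I D) (hD0 : ∀ x, D x ≠ 0)
    (hsub : Manifold.IsSubmersion I I' ∞ (orbitProj I D))
    (hdim : Module.finrank ℝ E' + 1 = Module.finrank ℝ E) (x : M) (v : TangentSpace I x)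
    (hv : mfderiv I I' (orbitProj I D) x v = 0) : ∃ c : ℝ, v = c • D x :=
  exists_eq_smul_of_surjective (E := E) (E' := E') (A := mfderiv I I' (orbitProj I D) x)
    (surjective_mfderiv_of_isSubmersion hsub x) hdim (hD0 x)
    (mfderiv_orbitProj_self I I' hD hsub.contMDiff x) hv

theorem eq_smul_of_forall_ker {B : E [⋀^Fin 2]→L[ℝ] ℝ}
    (hB : ∀ v, (∀ w, B ![v, w] = 0) → v = 0) {d u : E} (hd : d ≠ 0)
    (hu : ∀ w, B ![d, w] = 0 → B ![u, w] = 0) : ∃ c : ℝ, u = c • d := by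
  obtain ⟨w₀, hw₀⟩ : ∃ w, B ![d, w] ≠ 0 := by
    by_contra! h
    exact hd (hB d h)
  refine ⟨B ![u, w₀] / B ![d, w₀], sub_eq_zero.1 (hB _ fun w => ?_)⟩
  have h1 : ∀ e : E, B ![e, w - (B ![d, w] / B ![d, w₀]) • w₀] =
      B ![e, w] - B ![d, w] / B ![d, w₀] * B ![e, w₀] := fun e => by
    simp only [← bilinearCLM_apply, map_sub, map_smul, smul_eq_mul]
  have h2 := hu (w - (B ![d, w] / B ![d, w₀]) • w₀) (by rw [h1]; field_simp; ring)
  rw [h1] at h2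
  rw [twoForm_sub_left, twoForm_smul_left]
  field_simp at h2 ⊢
  linarith

theorem scaledForm_apply (Ω : DForm I M 2) (D : VField I M) (ρ : M → ℝ) (x : M)
    (v : TangentSpace I x) :
    ((ρ x)⁻¹ • interiorProd I D Ω x) ![v] = (ρ x)⁻¹ * Ω x ![D x, v] := rfl

theorem extD_scaledForm {Ω : DForm I M 2} (hΩs : IsSmoothForm I Ω) (hD : IsSmoothField I D)
    (hDΩ : ∀ x, extD I (interiorProd I D Ω) x = Ω x) {ρ : M → ℝ}
    (hρ : IsScalingFunction I D ρ) (x : M) (u v : TangentSpace I x) :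
    extD I (fun x => (ρ x)⁻¹ • interiorProd I D Ω x) x ![u, v] =
      (ρ x)⁻¹ * Ω x ![u, v] - (ρ x)⁻¹ ^ 2 * differential I ρ x u * Ω x ![D x, v] +
        (ρ x)⁻¹ ^ 2 * differential I ρ x v * Ω x ![D x, u] := by
  refine (extD_smul_oneForm I (hρ.smooth.inv₀ hρ.ne_zero) (hΩs.interiorProd hD) x u v).trans ?_
  rw [hDΩ, differential_inv I hρ.smooth hρ.ne_zero, differential_inv I hρ.smooth hρ.ne_zero]
  change _ + _ * Ω x ![D x, v] - _ * Ω x ![D x, u] = _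
  ring

/-- Reduction of a Hamiltonian system by a Liouville vector field: the contact Hamiltonian system
on the space of orbits. -/
theorem exists_contact_reduction {Ω : DForm I M 2} (hΩs : IsSmoothForm I Ω)
    (hΩ : ∀ (x : M) (v : TangentSpace I x), (∀ w, Ω x ![v, w] = 0) → v = 0)
    (hD : IsSmoothField I D) (hD0 : ∀ x, D x ≠ 0)
    (hDΩ : ∀ x, extD I (interiorProd I D Ω) x = Ω x)
    {ρ : M → ℝ} (hρ : IsScalingFunction I D ρ) (hsub : Manifold.IsSubmersion I I' ∞ (orbitProj I D))
    (hdim : Module.finrank ℝ E' + 1 = Module.finrank ℝ E)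
    {F : M → ℝ} (hF : ContMDiff I 𝓘(ℝ, ℝ) ∞ F) (hFD : ∀ x, differential I F x (D x) = F x)
    {Y : VField I' (OrbitSpace I D)}
    (hY : IsPushforward I I' (orbitProj I D) (hamiltonianField I Ω F) Y) :
    ∃ (η : DForm I' (OrbitSpace I D) 1) (hc : OrbitSpace I D → ℝ), IsContactForm I' η ∧
      (∀ x, pullbackForm I I' (orbitProj I D) η x = (ρ x)⁻¹ • interiorProd I D Ω x) ∧
      ContMDiff I' 𝓘(ℝ, ℝ) ∞ hc ∧ (∀ x, hc (orbitProj I D x) = - F x / ρ x) ∧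
      IsContactHamiltonianField I' η hc Y := by
  have hsurj := orbitProj_surjective I D
  have hs := hsub.contMDiff
  have hker := exists_eq_smul_of_mfderiv_orbitProj I I' hD hD0 hsub hdim
  have hθs : IsSmoothForm I (fun x => (ρ x)⁻¹ • interiorProd I D Ω x) :=
    IsSmoothForm.smul I (hρ.smooth.inv₀ hρ.ne_zero) (hΩs.interiorProd hD)
  have hself : ∀ (x : M) (v : TangentSpace I x), Ω x ![v, v] = 0 := fun x v =>
    twoForm_self (E := E) (Ω x) v
  have hswap : ∀ (x : M) (u v : TangentSpace I x), Ω x ![u, v] = - Ω x ![v, u] := fun x u v =>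
    twoForm_swap (E := E) (Ω x) u v
  have hdθ := extD_scaledForm I hΩs hD hDΩ hρ
  obtain ⟨η, hηs, hη⟩ := exists_form_of_basic I I' hD hsub hker hθs
    (fun x => by rw [scaledForm_apply, hself, mul_zero])
    (fun x v => by
      rw [hdθ, hself, hρ.homogeneous]
      have := hρ.ne_zero x
      field_simp
      ring)
  have hη1 : ∀ (x : M) (v : TangentSpace I x), η (orbitProj I D x)
      ![mfderiv I I' (orbitProj I D) x v] = (ρ x)⁻¹ * Ω x ![D x, v] := fun x v => by
    refine Eq.trans ?_ (congrArg (fun L => L ![v]) (hη x))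
    change _ = η (orbitProj I D x) (fun i => mfderiv I I' (orbitProj I D) x ((![v] : Fin 1 → E) i))
    congr 1
    funext i
    fin_cases i
    rfl
  have hη2 : ∀ (x : M) (u v : TangentSpace I x), extD I' η (orbitProj I D x)
      ![mfderiv I I' (orbitProj I D) x u, mfderiv I I' (orbitProj I D) x v] =
      (ρ x)⁻¹ * Ω x ![u, v] - (ρ x)⁻¹ ^ 2 * differential I ρ x u * Ω x ![D x, v] +
        (ρ x)⁻¹ ^ 2 * differential I ρ x v * Ω x ![D x, u] := fun x u v => by
    refine Eq.trans ?_ ((extD_pullbackForm I I' hs hηs hη x ![u, v]).symm.trans (hdθ x u v))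
    congr 1
    funext i
    fin_cases i <;> rfl
  have hquot : ContMDiff I 𝓘(ℝ, ℝ) ∞ (fun x => - F x / ρ x) := hF.neg.div₀ hρ.smooth hρ.ne_zero
  have hdquot := differential_neg_div I hF hρ.smooth hρ.ne_zero
  choose r hr using hsurj
  have hhc : ∀ x, (fun c => - F (r c) / ρ (r c)) (orbitProj I D x) = - F x / ρ x := fun x =>
    eq_of_differential_eq_zero I hquot (fun x => by
      rw [hdquot, hρ.homogeneous, hFD]
      have := hρ.ne_zero x
      field_simp
      ring) (hr _)
  set hc : OrbitSpace I D → ℝ := fun c => - F (r c) / ρ (r c)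
  have hhcs : ContMDiff I' 𝓘(ℝ, ℝ) ∞ hc := contMDiff_of_comp_isSubmersion hsub
    (orbitProj_surjective I D) (hquot.congr hhc)
  have hdhc : ∀ (x : M) (v : TangentSpace I x), differential I' hc (orbitProj I D x)
      (mfderiv I I' (orbitProj I D) x v) =
      (ρ x)⁻¹ ^ 2 * F x * differential I ρ x v - (ρ x)⁻¹ * differential I F x v := fun x v => by
    refine Eq.trans ?_ (hdquot x v)
    rw [← funext hhc]
    exact (mfderiv_comp_apply x (hhcs.mdifferentiableAt (by simp))
      (hs.mdifferentiableAt (by simp)) v).symm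
  have hX := fun x => hamiltonianField_spec I F x (hΩ x)
  have hZ := fun x => hamiltonianField_spec I ρ x (hΩ x)
  have key : ∀ c : OrbitSpace I D, ∃ R : TangentSpace I' c, (∀ w, extD I' η c ![R, w] = 0) ∧
      η c ![R] = 1 ∧ (∀ w, extD I' η c ![Y c, w] =
        differential I' hc c w - differential I' hc c R * η c ![w]) ∧ η c ![Y c] = - hc c := by
    intro c
    obtain ⟨x, rfl⟩ := orbitProj_surjective I D c
    have hw := surjective_mfderiv_of_isSubmersion hsub x
    have hρx := hρ.ne_zero x
    have hDZ : Ω x ![D x, hamiltonianField I Ω ρ x] = ρ x := by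
      rw [hswap, hZ, hρ.homogeneous, neg_neg]
    have hDX : Ω x ![D x, hamiltonianField I Ω F x] = F x := by
      rw [hswap, hX, hFD, neg_neg]
    have hZZ : differential I ρ x (hamiltonianField I Ω ρ x) = 0 := by
      rw [← neg_eq_zero, ← hZ, hself]
    have hXZ : differential I ρ x (hamiltonianField I Ω F x) =
        - differential I F x (hamiltonianField I Ω ρ x) := by
      rw [← hX, hswap, hZ, neg_neg]
    refine ⟨mfderiv I I' (orbitProj I D) x (hamiltonianField I Ω ρ x), fun w => ?_, ?_, fun w => ?_,
      ?_⟩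
    · obtain ⟨w, rfl⟩ := hw w
      rw [hη2, hZ, hDZ, hZZ]
      field_simp
      ring
    · rw [hη1, hDZ, inv_mul_cancel₀ hρx]
    · obtain ⟨w, rfl⟩ := hw w
      rw [← hY x, hη2, hX, hDX, hXZ, hdhc, hdhc, hη1, hZZ]
      ring
    · rw [← hY x, hη1, hDX, hhc]
      field_simp
  choose R hR using key
  refine ⟨η, hc, ⟨hηs, fun c hc0 => ?_, fun c v hv0 hv => ?_⟩, hη, hhcs, hhc, R,
    ⟨fun c => (hR c).1, fun c => (hR c).2.1⟩, fun c => (hR c).2.2.1, fun c => (hR c).2.2.2⟩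
  · have h1 := (hR c).2.1
    rw [hc0] at h1
    exact zero_ne_one h1
  · obtain ⟨x, rfl⟩ := orbitProj_surjective I D c
    obtain ⟨u, rfl⟩ := surjective_mfderiv_of_isSubmersion hsub x v
    have hρx := inv_ne_zero (hρ.ne_zero x)
    rw [hη1] at hv0
    have hu : Ω x ![D x, u] = 0 := (mul_eq_zero.1 hv0).resolve_left hρx
    have hker : ∀ w : TangentSpace I x, Ω x ![D x, w] = 0 → Ω x ![u, w] = 0 := fun w hw => by
      have h1 := hv (mfderiv I I' (orbitProj I D) x w) (by rw [hη1, hw, mul_zero])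
      rw [hη2, hu, hw, mul_zero, mul_zero, sub_zero, add_zero] at h1
      exact (mul_eq_zero.1 h1).resolve_left hρx
    have hlin : ∃ c : ℝ, u = c • D x :=
      eq_smul_of_forall_ker (E := E) (B := Ω x) (hΩ x) (hD0 x) hker
    obtain ⟨c, hcu⟩ := hlin
    rw [hcu, map_smul, mfderiv_orbitProj_self I I' hD hs, smul_zero]

end ContactReduction

section HomogeneousCoordinates

variable {E : Type*} [NormedAddCommGroup E] [NormedSpace ℝ E] [FiniteDimensional ℝ E]
  {H : Type*} [TopologicalSpace H] (I : ModelWithCorners ℝ E H) [I.Boundaryless]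
  {M : Type*} [TopologicalSpace M] [ChartedSpace H M] [IsManifold I ∞ M] {k : ℕ}

/-- Along an orbit, functions that are homogeneous along the field are rescaled. -/
theorem exists_exp_mul_eq_of_orbitProj_eq {D : VField I M} {a : Fin k → M → ℝ}
    (ha : ∀ i, ContMDiff I 𝓘(ℝ, ℝ) ∞ (a i)) {c : Fin k → ℝ}
    (haD : ∀ i x, differential I (a i) x (D x) = c i * a i x) {x y : M}
    (hxy : orbitProj I D x = orbitProj I D y) : ∃ t, ∀ i, Real.exp (c i * t) * a i x = a i y := by
  refine rel_of_orbitProj_eq I (r := fun x y => ∃ t, ∀ i, Real.exp (c i * t) * a i x = a i y)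
    ⟨fun x => ⟨0, fun i => by simp⟩, ?_, ?_⟩ ?_ hxy
  · rintro x y ⟨t, ht⟩
    refine ⟨-t, fun i => ?_⟩
    rw [← ht, ← mul_assoc, ← Real.exp_add]
    simp
  · rintro x y z ⟨t, ht⟩ ⟨s, hs⟩
    refine ⟨t + s, fun i => ?_⟩
    rw [← hs, ← ht, ← mul_assoc, ← Real.exp_add]
    ring_nf
  · intro γ J hJ hJ' hγ s hs t ht
    refine ⟨t - s, fun i => ?_⟩
    have h1 : Real.exp (-(c i * s)) * a i (γ s) = Real.exp (-(c i * t)) * a i (γ t) := by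
      refine eq_of_hasDerivAt_zero (g := fun t => Real.exp (-(c i * t)) * a i (γ t)) hJ hJ'
        (fun u hu => ?_) hs ht
      have h2 := hasDerivAt_comp_integralCurve I (ha i) hJ hγ hu
      have h3 : HasDerivAt (fun t => Real.exp (-(c i * t))) (Real.exp (-(c i * u)) * -(c i * 1)) u :=
        (((hasDerivAt_id u).const_mul (c i)).neg).exp
      refine (h3.mul h2).congr_deriv ?_
      rw [haD]
      ring
    calc Real.exp (c i * (t - s)) * a i (γ s)
        = Real.exp (c i * t) * (Real.exp (-(c i * s)) * a i (γ s)) := by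
          rw [← mul_assoc, ← Real.exp_add]
          ring_nf
      _ = a i (γ t) := by
          rw [h1, ← mul_assoc, ← Real.exp_add]
          simp

theorem isInvariantSet_of_conserved {X : VField I M} {a : Fin k → M → ℝ}
    (ha : ∀ i, ContMDiff I 𝓘(ℝ, ℝ) ∞ (a i)) (haX : ∀ i x, differential I (a i) x (X x) = 0)
    (P : (Fin k → ℝ) → Prop) : IsInvariantSet I X {x | P fun i => a i x} := by
  intro γ J hJ hJ' hγ s hs hP t ht
  have h1 : (fun i => a i (γ t)) = fun i => a i (γ s) := funext fun i =>
    eq_of_hasDerivAt_zero (g := fun t => a i (γ t)) hJ hJ' (fun u hu =>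
      (hasDerivAt_comp_integralCurve I (ha i) hJ hγ hu).congr_deriv (haX i _)) ht hs
  change P fun i => a i (γ t)
  rw [h1]
  exact hP

theorem IsPushforward.comp {E' : Type*} [NormedAddCommGroup E'] [NormedSpace ℝ E']
    {H' : Type*} [TopologicalSpace H'] {I' : ModelWithCorners ℝ E' H'}
    {N : Type*} [TopologicalSpace N] [ChartedSpace H' N]
    {E'' : Type*} [NormedAddCommGroup E''] [NormedSpace ℝ E'']
    {H'' : Type*} [TopologicalSpace H''] {I'' : ModelWithCorners ℝ E'' H''}
    {L : Type*} [TopologicalSpace L] [ChartedSpace H'' L] {f : M → N} {g : N → L}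
    (hf : ContMDiff I I' ∞ f) (hg : ContMDiff I' I'' ∞ g) {X : VField I M} {Y : VField I' N}
    {Z : VField I'' L} (hXY : IsPushforward I I' f X Y) (hYZ : IsPushforward I' I'' g Y Z) :
    IsPushforward I I'' (fun x => g (f x)) X Z := fun x =>
  (mfderiv_comp_apply x (hg.mdifferentiableAt (by simp)) (hf.mdifferentiableAt (by simp))
    (X x)).trans ((congrArg _ (hXY x)).trans (hYZ (f x)))

end HomogeneousCoordinates

section LiftedReduction

variable {E : Type*} [NormedAddCommGroup E] [NormedSpace ℝ E] [FiniteDimensional ℝ E]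
  {H : Type*} [TopologicalSpace H] {I : ModelWithCorners ℝ E H} [I.Boundaryless]
  {M : Type*} [TopologicalSpace M] [ChartedSpace H M] [IsManifold I ∞ M] {k : ℕ}

theorem fderiv_inChart_liftedLiouville {Ω : DForm I M 2} (hΩ : IsSmoothForm I Ω) {D : VField I M}
    (hD : IsSmoothField I D) (Λ : Fin k → ℝ) (x : LiftedSpace M k)
    (u v : E × (Fin k → ℝ) × (Fin k → ℝ)) :
    fderiv ℝ (fun z => formInChart (liftedModel I k)
        (interiorProd (liftedModel I k) (liftedScaling I D Λ) (liftedForm I k Ω)) x z ![v])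
        (extChartAt (liftedModel I k) x x) u =
      fderiv ℝ (fun y => formInChart I (interiorProd I D Ω) x.1 y ![v.1]) (extChartAt I x.1 x.1) u.1
        + ∑ i, ((1 - Λ i) * u.2.1 i * v.2.2 i - v.2.1 i * (Λ i * u.2.2 i)) := by
  have e1 : (fun z => formInChart (liftedModel I k)
      (interiorProd (liftedModel I k) (liftedScaling I D Λ) (liftedForm I k Ω)) x z ![v])
      =ᶠ[𝓝 (extChartAt (liftedModel I k) x x)] fun z =>
        formInChart I (interiorProd I D Ω) x.1 z.1 ![v.1] +
          ∑ i, ((1 - Λ i) * z.2.1 i * v.2.2 i - v.2.1 i * (Λ i * z.2.2 i)) := by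
    filter_upwards [eventually_mem_target_lifted x] with z hz
    rw [formInChart_interiorProd _ _ _ ((mem_target_lifted I).2 hz),
      formInChart_interiorProd _ _ _ hz, fieldInChart_liftedScaling D Λ hz]
    exact formInChart_liftedForm I Ω hz _ v
  have h1 : DifferentiableAt ℝ (fun y => formInChart I (interiorProd I D Ω) x.1 y ![v.1])
      (extChartAt I x.1 x.1) := by
    simp only [← covectorCLM_apply]
    exact ((covectorCLM E).differentiableAt.comp _ (((hΩ.interiorProd hD).contDiffAt
      (mem_extChartAt_target x.1)).differentiableAt (by simp))).clm_apply (differentiableAt_const _)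
  have h2 : HasFDerivAt (fun z : E × (Fin k → ℝ) × (Fin k → ℝ) =>
      formInChart I (interiorProd I D Ω) x.1 z.1 ![v.1])
      ((fderiv ℝ (fun y => formInChart I (interiorProd I D Ω) x.1 y ![v.1])
        (extChartAt I x.1 x.1)).comp (ContinuousLinearMap.fst ℝ E ((Fin k → ℝ) × (Fin k → ℝ))))
      ((extChartAt I x.1 x.1, x.2) : E × (Fin k → ℝ) × (Fin k → ℝ)) :=
    HasFDerivAt.comp (f := Prod.fst)
      (g := fun y => formInChart I (interiorProd I D Ω) x.1 y ![v.1])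
      ((extChartAt I x.1 x.1, x.2) : E × (Fin k → ℝ) × (Fin k → ℝ)) h1.hasFDerivAt hasFDerivAt_fst
  have h3 := h2.add (HasFDerivAt.fun_sum (u := Finset.univ) fun i _ =>
    (((hasFDerivAt_lifted_param_coord i _).const_mul (1 - Λ i)).mul_const (v.2.2 i)).sub
      (((hasFDerivAt_lifted_momentum_coord i _).const_mul (Λ i)).const_mul (v.2.1 i)))
  rw [Filter.EventuallyEq.fderiv_eq e1, extChartAt_lifted]
  refine (congrArg (fun L => L u) h3.fderiv).trans ?_
  refine congrArg₂ (fun r s : ℝ => r + s) rfl ?_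
  change (∑ i, (_ : (E × (Fin k → ℝ) × (Fin k → ℝ)) →L[ℝ] ℝ)) u = _
  rw [sum_apply]
  refine Finset.sum_congr rfl fun i _ => ?_
  change v.2.2 i * ((1 - Λ i) * u.2.1 i) - v.2.1 i * (Λ i * u.2.2 i) = _
  ring

theorem extD_interiorProd_liftedForm {Ω : DForm I M 2} (hΩ : IsSmoothForm I Ω) {D : VField I M}
    (hD : IsSmoothField I D) (hDΩ : ∀ m, extD I (interiorProd I D Ω) m = Ω m) (Λ : Fin k → ℝ)
    (x : LiftedSpace M k) :
    extD (liftedModel I k)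
      (interiorProd (liftedModel I k) (liftedScaling I D Λ) (liftedForm I k Ω)) x =
      liftedForm I k Ω x := by
  refine ContinuousAlternatingMap.ext fun w => ?_
  obtain ⟨u, v, rfl⟩ : ∃ u v : E × (Fin k → ℝ) × (Fin k → ℝ), w = ![u, v] :=
    ⟨w 0, w 1, by funext i; fin_cases i <;> rfl⟩
  have hs := ((isSmoothForm_liftedForm (k := k) I hΩ).interiorProd
    (isSmoothField_liftedScaling hD Λ)).contDiffAt (mem_extChartAt_target x)
  refine (extD_apply _ _ x _).trans ((extDeriv_oneForm (hs.differentiableAt (by simp)) u v).trans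
    ((congrArg₂ (· - ·) (fderiv_inChart_liftedLiouville hΩ hD Λ x u v)
      (fderiv_inChart_liftedLiouville hΩ hD Λ x v u)).trans ?_))
  refine Eq.trans ?_ (liftedForm_apply I Ω x u v).symm
  have h1 := ((hΩ.interiorProd hD).contDiffAt
    (mem_extChartAt_target x.1)).differentiableAt (by simp)
  have h2 : fderiv ℝ (fun y => formInChart I (interiorProd I D Ω) x.1 y ![v.1])
      (extChartAt I x.1 x.1) u.1 - fderiv ℝ (fun y => formInChart I (interiorProd I D Ω) x.1 y
        ![u.1]) (extChartAt I x.1 x.1) v.1 = Ω x.1 ![u.1, v.1] :=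
    (extDeriv_oneForm h1 u.1 v.1).symm.trans ((extD_apply I _ x.1 _).symm.trans
      (congrArg (fun L => L ![u.1, v.1]) (hDΩ x.1)))
  rw [← h2, add_sub_add_comm, ← Finset.sum_sub_distrib]
  refine congrArg (_ + ·) (Finset.sum_congr rfl fun i _ => ?_)
  ring

theorem differential_liftedHamiltonian_liftedScaling {D : VField I M} {h : Fin k → M → ℝ}
    (hh : ∀ j, ContMDiff I 𝓘(ℝ, ℝ) ∞ (h j)) {Λ : Fin k → ℝ}
    (hΛ : ∀ j m, differential I (h j) m (D m) = Λ j * h j m) (x : LiftedSpace M k) :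
    differential (liftedModel I k) (liftedHamiltonian h) x (liftedScaling I D Λ x) =
      liftedHamiltonian h x := by
  refine (differential_liftedHamiltonian hh x _).trans (Finset.sum_congr rfl fun i _ => ?_)
  refine (congrArg (fun r => x.2.1 i * r + _) (hΛ i x.1)).trans ?_
  change _ + (1 - Λ i) * x.2.1 i * h i x.1 = _
  ring

variable (I M k) in
theorem contMDiff_forgetMomenta :
    ContMDiff (liftedModel I k) (paramModel I k) ∞ (forgetMomenta M k) :=
  contMDiff_fst.prodMk (contMDiff_fst.comp contMDiff_snd)

theorem mfderiv_forgetMomenta (x : LiftedSpace M k) (v : E × (Fin k → ℝ) × (Fin k → ℝ)) :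
    (mfderiv (liftedModel I k) (paramModel I k) (forgetMomenta M k) x v : E × (Fin k → ℝ)) =
      (v.1, v.2.1) := by
  have h1 := hasMFDerivAt_snd (I := I) (I' := 𝓘(ℝ, Fin k → ℝ).prod 𝓘(ℝ, Fin k → ℝ)) x
  have h2 := hasMFDerivAt_fst (I := 𝓘(ℝ, Fin k → ℝ)) (I' := 𝓘(ℝ, Fin k → ℝ)) x.2
  have h3 := hasMFDerivAt_fst (I := I) (I' := 𝓘(ℝ, Fin k → ℝ).prod 𝓘(ℝ, Fin k → ℝ)) x
  exact congrArg (fun L => L v) (h3.prodMk (h2.comp x h1)).mfderiv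

theorem isPushforward_forgetMomenta_liftedScaling (D : VField I M) (Λ : Fin k → ℝ) :
    IsPushforward (liftedModel I k) (paramModel I k) (forgetMomenta M k)
      (liftedScaling I D Λ) (paramScaling I D Λ) := fun x => mfderiv_forgetMomenta x _

theorem isPushforward_forgetMomenta_liftedHamiltonianField {Ω : DForm I M 2}
    (hΩ : IsSymplectic I Ω) {h : Fin k → M → ℝ} (hh : ∀ j, ContMDiff I 𝓘(ℝ, ℝ) ∞ (h j)) :
    IsPushforward (liftedModel I k) (paramModel I k) (forgetMomenta M k)
      (liftedHamiltonianField I Ω h) (paramField I Ω h) := fun x =>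
  (mfderiv_forgetMomenta x _).trans ((congrArg (fun v : E × (Fin k → ℝ) × (Fin k → ℝ) =>
    (v.1, v.2.1)) (liftedHamiltonianField_eq hΩ hh x)).trans (congrArg (fun e : E =>
      (e, (0 : Fin k → ℝ))) (hamiltonianField_coupled hΩ hh x.2.1 x.1).symm))

variable (I M) in
theorem contMDiff_lifted_param_coord (i : Fin k) :
    ContMDiff (liftedModel I k) 𝓘(ℝ, ℝ) ∞ (fun y : LiftedSpace M k => y.2.1 i) :=
  (ContinuousLinearMap.proj (R := ℝ) (φ := fun _ : Fin k => ℝ) i).contMDiff.comp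
    (contMDiff_fst.comp contMDiff_snd)

variable (I M) in
theorem contMDiff_param_coord (i : Fin k) :
    ContMDiff (paramModel I k) 𝓘(ℝ, ℝ) ∞ (fun y : ParamSpace M k => y.2 i) :=
  (ContinuousLinearMap.proj (R := ℝ) (φ := fun _ : Fin k => ℝ) i).contMDiff.comp contMDiff_snd

theorem differential_paramSpace_coord (x : ParamSpace M k) (i : Fin k) (v : E × (Fin k → ℝ)) :
    differential (paramModel I k) (fun y : ParamSpace M k => y.2 i) x v = v.2 i := by
  have h1 := hasMFDerivAt_snd (I := I) (I' := 𝓘(ℝ, Fin k → ℝ)) x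
  have h3 := (ContinuousLinearMap.proj (R := ℝ) (φ := fun _ : Fin k => ℝ) i).hasMFDerivAt
    (x := x.2)
  exact congrArg (fun L => L v) (h3.comp x h1).mfderiv

theorem isMIntegralCurveOn_liftedScaling {D : VField I M} (Λ : Fin k → ℝ) {γ : ℝ → M}
    (hγ : IsMIntegralCurve γ D) (a b : Fin k → ℝ) :
    IsMIntegralCurveOn (fun t => ((γ t, (fun i => Real.exp ((1 - Λ i) * t) * a i),
      fun i => Real.exp (Λ i * t) * b i) : LiftedSpace M k)) (liftedScaling I D Λ) Set.univ := by
  intro t _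
  have h0 : ∀ c r : ℝ, HasDerivAt (fun t => Real.exp (c * t) * r) (c * (Real.exp (c * t) * r)) t :=
    fun c r => (((hasDerivAt_id t).const_mul c).exp.mul_const r).congr_deriv (by simp; ring)
  have h1 : HasDerivAt (fun t i => Real.exp ((1 - Λ i) * t) * a i)
      (fun i => (1 - Λ i) * (Real.exp ((1 - Λ i) * t) * a i)) t :=
    hasDerivAt_pi.2 fun i => h0 _ _
  have h2 : HasDerivAt (fun t i => Real.exp (Λ i * t) * b i)
      (fun i => Λ i * (Real.exp (Λ i * t) * b i)) t := hasDerivAt_pi.2 fun i => h0 _ _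
  have h3 := ((hγ t).prodMk ((hasMFDerivAt_iff_hasFDerivAt.2 h1.hasFDerivAt).prodMk
    (hasMFDerivAt_iff_hasFDerivAt.2 h2.hasFDerivAt))).hasMFDerivWithinAt (s := Set.univ)
  exact h3.congr_mfderiv (by ext <;> rfl)

theorem preimage_fixedParamSet {D : VField I M} (hD : IsCompleteField I D) (Λ a₀ : Fin k → ℝ) :
    liftedProj I D Λ ⁻¹' fixedParamSet I D Λ a₀ =
      {x | ∃ t, ∀ i, Real.exp ((1 - Λ i) * t) * x.2.1 i = a₀ i} := by
  ext x
  constructor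
  · rintro ⟨y, rfl, hy⟩
    exact exists_exp_mul_eq_of_orbitProj_eq (liftedModel I k) (contMDiff_lifted_param_coord I M)
      (fun i x => differential_param_coord I x i _) hy.symm
  · rintro ⟨t, ht⟩
    obtain ⟨γ, hγ0, hγ⟩ := hD x.1
    have h1 := orbitProj_integralCurve (liftedModel I k) isOpen_univ Set.ordConnected_univ
      (isMIntegralCurveOn_liftedScaling Λ hγ x.2.1 x.2.2) (Set.mem_univ t) (Set.mem_univ 0)
    refine ⟨_, ?_, h1.trans (congrArg _ ?_)⟩
    · exact funext ht
    · simp [hγ0]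

end LiftedReduction

end

end ScalingReduction

theorem mainTheorem5
    {E : Type*} [NormedAddCommGroup E] [NormedSpace ℝ E] [FiniteDimensional ℝ E]
    {H : Type*} [TopologicalSpace H] (I : ModelWithCorners ℝ E H) [I.Boundaryless]
    {M : Type*} [TopologicalSpace M] [ChartedSpace H M] [IsManifold I ∞ M] [T2Space M]
    -- the symplectic manifold `(M, Ω)` and the Liouville vector field `D`
    (Ω : DForm I M 2) (hΩ : IsSymplectic I Ω)
    (D : VField I M) (hD : IsSmoothField I D) (hDcomplete : IsCompleteField I D)
    (hDzero : ∀ m, D m ≠ 0) (hDLiouville : ∀ m, lieD I D Ω m = Ω m)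
    -- the Hamiltonians `H_a = ∑ a_j h_j`, with `L_D h_j = Λ_j h_j`
    {k : ℕ} (h : Fin k → M → ℝ) (hh : ∀ j, ContMDiff I 𝓘(ℝ, ℝ) ∞ (h j))
    (Λ : Fin k → ℝ) (hΛ : ∀ j m, differential I (h j) m (D m) = Λ j * h j m)
    -- the orbit space of the lifted scaling field on `M × ℝ^k × ℝ^k` is a smooth manifold, of
    -- dimension one less, with submersive projection
    {EC : Type*} [NormedAddCommGroup EC] [NormedSpace ℝ EC] [FiniteDimensional ℝ EC]
    {HC : Type*} [TopologicalSpace HC] (IC : ModelWithCorners ℝ EC HC) [IC.Boundaryless]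
    [ChartedSpace HC (LiftedQuotient I D Λ)] [IsManifold IC ∞ (LiftedQuotient I D Λ)]
    [T2Space (LiftedQuotient I D Λ)]
    (hdimC : Module.finrank ℝ EC + 1 = Module.finrank ℝ E + 2 * k)
    (hsubC : Manifold.IsSubmersion (liftedModel I k) IC ∞ (liftedProj I D Λ))
    -- and so is the orbit space of the induced scaling field on `M × ℝ^k`
    {EB : Type*} [NormedAddCommGroup EB] [NormedSpace ℝ EB] [FiniteDimensional ℝ EB]
    {HB : Type*} [TopologicalSpace HB] (IB : ModelWithCorners ℝ EB HB) [IB.Boundaryless]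
    [ChartedSpace HB (ParamQuotient I D Λ)] [IsManifold IB ∞ (ParamQuotient I D Λ)]
    [T2Space (ParamQuotient I D Λ)]
    (hdimB : Module.finrank ℝ EB + 1 = Module.finrank ℝ E + k)
    (hsubB : Manifold.IsSubmersion (paramModel I k) IB ∞ (paramProj I D Λ)) :
    -- `X(m, a) = X_{H_a}(m)` is the projection to `M × ℝ^k` of the lifted Hamiltonian field
    IsPushforward (liftedModel I k) (paramModel I k) (forgetMomenta M k)
      (liftedHamiltonianField I Ω h) (paramField I Ω h) ∧
    -- the induced fields on the two orbit spaces, and the induced map between these, exist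
    (∃! Xhat : VField IC (LiftedQuotient I D Λ),
      IsPushforward (liftedModel I k) IC (liftedProj I D Λ) (liftedHamiltonianField I Ω h) Xhat) ∧
    (∃! Xbar : VField IB (ParamQuotient I D Λ),
      IsPushforward (paramModel I k) IB (paramProj I D Λ) (paramField I Ω h) Xbar) ∧
    (∃! piBar : LiftedQuotient I D Λ → ParamQuotient I D Λ,
      ∀ x, piBar (liftedProj I D Λ x) = paramProj I D Λ (forgetMomenta M k x)) ∧
    ∀ (Xhat : VField IC (LiftedQuotient I D Λ)) (Xbar : VField IB (ParamQuotient I D Λ))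
      (piBar : LiftedQuotient I D Λ → ParamQuotient I D Λ),
      IsPushforward (liftedModel I k) IC (liftedProj I D Λ) (liftedHamiltonianField I Ω h) Xhat →
      IsPushforward (paramModel I k) IB (paramProj I D Λ) (paramField I Ω h) Xbar →
      (∀ x, piBar (liftedProj I D Λ x) = paramProj I D Λ (forgetMomenta M k x)) →
      IsSmoothField IC Xhat ∧ IsSmoothField IB Xbar ∧ ContMDiff IC IB ∞ piBar ∧
      -- for every scaling function `ρ`, `Xhat` is the contact Hamiltonian vector field of the
      -- function induced by `- Ĥ / ρ` with respect to the contact form induced by `i_D̂ Ω̂ / ρ`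
      (∀ ρ : LiftedSpace M k → ℝ,
        IsScalingFunction (liftedModel I k) (liftedScaling I D Λ) ρ →
        ∃ (η : DForm IC (LiftedQuotient I D Λ) 1) (hc : LiftedQuotient I D Λ → ℝ),
          IsContactForm IC η ∧
          (∀ x, pullbackForm (liftedModel I k) IC (liftedProj I D Λ) η x =
            (ρ x)⁻¹ •
              interiorProd (liftedModel I k) (liftedScaling I D Λ) (liftedForm I k Ω) x) ∧
          ContMDiff IC 𝓘(ℝ, ℝ) ∞ hc ∧
          (∀ x, hc (liftedProj I D Λ x) = - liftedHamiltonian h x / ρ x) ∧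
          IsContactHamiltonianField IC η hc Xhat) ∧
      -- the reduced dynamics at the parameter value `a₀`
      ∀ a₀ : Fin k → ℝ,
        IsInvariantSet IC Xhat (fixedParamSet I D Λ a₀) ∧
        IsInvariantSet IB Xbar (piBar '' fixedParamSet I D Λ a₀) ∧
        ∀ c ∈ fixedParamSet I D Λ a₀, mfderiv IC IB piBar c (Xhat c) = Xbar (piBar c) := by
  have hDΩ := extD_interiorProd_of_liouville hΩ hDLiouville
  have hDhat := isSmoothField_liftedScaling (k := k) hD Λ
  have hDbar := isSmoothField_paramScaling (k := k) hD Λ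
  have hX := isSmoothField_liftedHamiltonianField hΩ hh
  have hXp := isSmoothField_paramField hΩ hh
  have hπ := hsubC.contMDiff
  have hπs := orbitProj_surjective (liftedModel I k) (liftedScaling I D Λ)
  have hfX := isPushforward_forgetMomenta_liftedHamiltonianField hΩ hh
  have hfs : ∀ {x y : LiftedSpace M k}, liftedProj I D Λ x = liftedProj I D Λ y →
      paramProj I D Λ (forgetMomenta M k x) = paramProj I D Λ (forgetMomenta M k y) :=
    fun {x y} hxy => rel_of_orbitProj_eq (liftedModel I k)
      (r := fun x y => paramProj I D Λ (forgetMomenta M k x) =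
        paramProj I D Λ (forgetMomenta M k y)) ⟨fun _ => rfl, Eq.symm, Eq.trans⟩
      (fun γ J hJ hJ' hγ s hs t ht => orbitProj_integralCurve (paramModel I k) hJ hJ'
        (hγ.comp_isPushforward (contMDiff_forgetMomenta I M k)
          (isPushforward_forgetMomenta_liftedScaling D Λ)) hs ht) hxy
  refine ⟨hfX, existsUnique_pushforward (liftedModel I k) IC hDhat hπ hX
      (commute_liftedHamiltonianField_liftedScaling hΩ hD hDLiouville hh hΛ),
    existsUnique_pushforward (paramModel I k) IB hDbar hsubB.contMDiff hXp
      (commute_paramField_paramScaling hΩ hD hDLiouville hh hΛ), ?_, ?_⟩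
  · choose r hr using hπs
    refine ⟨fun c => paramProj I D Λ (forgetMomenta M k (r c)), fun x => hfs (hr _),
      fun p hp => funext fun c => ?_⟩
    exact (congrArg p (hr c)).symm.trans (hp (r c))
  intro Xhat Xbar piBar hXhat hXbar hpi
  have hXhats := isSmoothField_of_isPushforward hsubC hπs hX hXhat
  have hXbars := isSmoothField_of_isPushforward hsubB (orbitProj_surjective _ _) hXp hXbar
  have hpis : ContMDiff IC IB ∞ piBar := contMDiff_of_comp_isSubmersion hsubC hπs
    ((hsubB.contMDiff.comp (contMDiff_forgetMomenta I M k)).congr hpi)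
  refine ⟨hXhats, hXbars, hpis, fun ρ hρ => ?_, fun a₀ => ⟨?_, ?_, ?_⟩⟩
  · refine exists_contact_reduction (liftedModel I k) IC (isSmoothForm_liftedForm I hΩ.smooth)
      (liftedForm_nondegenerate I hΩ.nondegenerate) hDhat
      (fun x h0 => hDzero x.1 (congrArg Prod.fst h0))
      (extD_interiorProd_liftedForm hΩ.smooth hD hDΩ Λ) hρ hsubC ?_
      (contMDiff_liftedHamiltonian hh) (differential_liftedHamiltonian_liftedScaling hh hΛ) hXhat
    simp only [Module.finrank_prod, Module.finrank_fin_fun]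
    omega
  · refine isInvariantSet_of_preimage hπ hπs hX hXhats hXhat ?_
    rw [preimage_fixedParamSet hDcomplete]
    refine isInvariantSet_of_conserved (liftedModel I k) (contMDiff_lifted_param_coord I M)
      (fun i x => ?_) (fun a => ∃ t, ∀ i, Real.exp ((1 - Λ i) * t) * a i = a₀ i)
    refine (differential_param_coord I x i _).trans ?_
    exact congrArg (fun v : E × (Fin k → ℝ) × (Fin k → ℝ) => v.2.1 i)
      (liftedHamiltonianField_eq hΩ hh x)
  · refine isInvariantSet_of_preimage hsubB.contMDiff (orbitProj_surjective _ _) hXp hXbars hXbar ?_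
    have hpre : paramProj I D Λ ⁻¹' (piBar '' fixedParamSet I D Λ a₀) =
        {y | ∃ t, ∀ i, Real.exp ((1 - Λ i) * t) * y.2 i = a₀ i} := by
      ext y
      constructor
      · rintro ⟨_, ⟨x, rfl, rfl⟩, hy⟩
        exact exists_exp_mul_eq_of_orbitProj_eq (paramModel I k) (contMDiff_param_coord I M)
          (fun i x => differential_paramSpace_coord x i _) (hy.symm.trans (hpi x))
      · intro hy
        have hx : ((y.1, y.2, 0) : LiftedSpace M k) ∈
            liftedProj I D Λ ⁻¹' fixedParamSet I D Λ a₀ := by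
          rw [preimage_fixedParamSet hDcomplete]
          exact hy
        exact ⟨_, hx, hpi _⟩
    rw [hpre]
    exact isInvariantSet_of_conserved (paramModel I k) (contMDiff_param_coord I M)
      (fun i x => differential_paramSpace_coord x i _)
      (fun a => ∃ t, ∀ i, Real.exp ((1 - Λ i) * t) * a i = a₀ i)
  · rintro _ ⟨x, -, rfl⟩
    have h1 : IsPushforward (liftedModel I k) IB (fun x => piBar (liftedProj I D Λ x))
        (liftedHamiltonianField I Ω h) Xbar := by
      rw [funext hpi]
      exact IsPushforward.comp (liftedModel I k) (contMDiff_forgetMomenta I M k) hsubB.contMDiff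
        hfX hXbar
    rw [← hXhat x]
    exact (mfderiv_comp_apply x (hpis.mdifferentiableAt (by simp))
      (hπ.mdifferentiableAt (by simp)) _).symm.trans (h1 x)
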